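/- Let $k$ be a field and $U$ a quasitriangular Hopf algebra over $k$ with universal $R$-matrix $\mathcal R=\mathcal R^{(1)}\otimes\mathcal R^{(2)}\in U\otimes U$ (invertible, $\Delta'(x)=\mathcal R\Delta(x)\mathcal R^{-1}$, $(\Delta\otimes\mathrm{id})\mathcal R=\mathcal R^{13}\mathcal R^{23}$, $(\mathrm{id}\otimes\Delta)\mathcal R=\mathcal R^{13}\mathcal R^{12}$). Left $U$-modules are braided by $\Psi(v\otimes w)=\mathcal R^{(2)}\triangleright w\otimes\mathcal R^{(1)}\triangleright v$. Let $\mathcal X$ and $\mathcal D$ be finite-dimensional Hopf algebras in the braided category of left $U$-modules (all structure maps are $U$-linear, and coproducts are multiplicative for the braided tensor product algebra structure), with antipodes denoted $S$. Let $\langle\cdot,\cdot\rangle:\mathcal D\otimes\mathcal X\to k$ be a nondegenerate $U$-invariant pairing with $\langle\sigma\tau,\xi\rangle=\langle\tau,\xi_{(1)}\rangle\langle\sigma,\xi_{(2)}\rangle$, $\langle\sigma,\xi\eta\rangle=\langle\sigma_{(1)},\eta\rangle\langle\sigma_{(2)},\xi\rangle$, $\langle1,\xi\rangle=\epsilon(\xi)$,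 $\langle\sigma,1\rangle=\epsilon(\sigma)$. Let $\{\phi^i\}\subset\mathcal X$ and $\{\epsilon_i\}\subset\mathcal D$ be dual bases, $\langle\epsilon_i,\phi^j\rangle=\delta_i^j$, and write $\Psi^{-1}(\phi^i\otimes\epsilon_i)=\epsilon'\otimes\phi'\in\mathcal D\otimes\mathcal X$ (sums understood). Define the braided trace integrals $$\langle\xi\rangle_{tr}=\langle S^{-2}(\epsilon'),\,\phi'\xi\rangle\quad(\xi\in\mathcal X),\qquad \langle\sigma\rangle_{tr}=\langle\cdot,\cdot\rangle\circ(\mathrm{id}\otimes S^{-2})\circ\Psi^{-1}(\phi^i\otimes\epsilon_i\sigma)\quad(\sigma\in\mathcal D),$$ and put $\underline\sigma=\langle1_{\mathcal X}\rangle_{tr}$. Then: 1. For all $\sigma\in\mathcal D$ and $\xi\in\mathcal X$, $$\langle\sigma\rangle_{tr}\,\langle\xi\rangle_{tr}=\underline\sigma\;\langle\sigma\,S^{-2}(\epsilon'),\,\phi'\xi\rangle .$$ 2. If $\underline\sigma\neq0$, then $\langle\cdot\rangle_{tr}$ is a nontrivial invariant integral on $\mathcal X$ (that is, it is not identically zero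 and $\xi_{(1)}\langle\xi_{(2)}\rangle_{tr}=\langle\xi\rangle_{tr}1_{\mathcal X}$ for all $\xi$), and $\langle\cdot\rangle_{tr}$ is not identically zero on $\mathcal D$. 3. If $\underline\sigma=0$, then $\langle\cdot\rangle_{tr}$ is identically zero on $\mathcal X$ or on $\mathcal D$ (or both). 4. If $k$ has characteristic zero (for instance $k=\mathbb C$), then $\langle\cdot\rangle_{tr}$ is identically zero on $\mathcal X$ if and only if $\underline\sigma=0$. -/

import Mathlib

open TensorProduct

/-! ### Quasitriangular Hopf algebras -/

section Quasitriangular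

variable {k U : Type*} [Field k] [Ring U] [HopfAlgebra k U]

/-- `R` is a universal R-matrix of the Hopf algebra `U`: it is an invertible element of `U ⊗ U`
such that `Δ'(x) = R Δ(x) R⁻¹`, `(Δ ⊗ id) R = R₁₃ R₂₃` and `(id ⊗ Δ) R = R₁₃ R₁₂`. -/
structure IsUniversalRMatrix (R : (U ⊗[k] U)ˣ) : Prop where
  /-- `Δ'(x) = R Δ(x) R⁻¹`, where `Δ'` is the opposite coproduct -/
  comul_op : ∀ x : U,
    TensorProduct.comm k U U (Coalgebra.comul x) =
      (R : U ⊗[k] U) * Coalgebra.comul x * ((R⁻¹ : (U ⊗[k] U)ˣ) : U ⊗[k] U)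
  /-- `(Δ ⊗ id) R = R₁₃ R₂₃` in `(U ⊗ U) ⊗ U` -/
  comul_left :
    Algebra.TensorProduct.map (Bialgebra.comulAlgHom k U) (AlgHom.id k U) (R : U ⊗[k] U) =
      Algebra.TensorProduct.map (Algebra.TensorProduct.includeLeft : U →ₐ[k] U ⊗[k] U)
          (AlgHom.id k U) (R : U ⊗[k] U) *
        Algebra.TensorProduct.map (Algebra.TensorProduct.includeRight : U →ₐ[k] U ⊗[k] U)
          (AlgHom.id k U) (R : U ⊗[k] U)
  /-- `(id ⊗ Δ) R = R₁₃ R₁₂` in `U ⊗ (U ⊗ U)` -/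
  comul_right :
    Algebra.TensorProduct.map (AlgHom.id k U) (Bialgebra.comulAlgHom k U) (R : U ⊗[k] U) =
      Algebra.TensorProduct.map (AlgHom.id k U)
          (Algebra.TensorProduct.includeRight : U →ₐ[k] U ⊗[k] U) (R : U ⊗[k] U) *
        Algebra.TensorProduct.map (AlgHom.id k U)
          (Algebra.TensorProduct.includeLeft : U →ₐ[k] U ⊗[k] U) (R : U ⊗[k] U)

end Quasitriangular

/-! ### The braiding of `U`-modules -/

section Braiding

variable {k U : Type*} [Field k] [Ring U] [HopfAlgebra k U]

/-- The componentwise action of `U ⊗ U` on `V ⊗ W`: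
`(x ⊗ y) (v ⊗ w) = (x ▷ v) ⊗ (y ▷ w)`. -/
noncomputable def tensorAction (V W : Type*) [AddCommGroup V] [Module k V] [Module U V]
    [IsScalarTower k U V] [AddCommGroup W] [Module k W] [Module U W] [IsScalarTower k U W] :
    U ⊗[k] U →ₗ[k] (V ⊗[k] W →ₗ[k] V ⊗[k] W) :=
  TensorProduct.homTensorHomMap (RingHom.id k) V W V W ∘ₗ
    TensorProduct.map (Algebra.lsmul k k V : U →ₐ[k] Module.End k V).toLinearMap
      (Algebra.lsmul k k W : U →ₐ[k] Module.End k W).toLinearMap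

/-- The braided transposition `Ψ : V ⊗ W → W ⊗ V`, `Ψ = τ ∘ (R⁽¹⁾ ▷ _ ⊗ R⁽²⁾ ▷ _)`. -/
noncomputable def braiding (R : (U ⊗[k] U)ˣ) (V W : Type*) [AddCommGroup V] [Module k V]
    [Module U V] [IsScalarTower k U V] [AddCommGroup W] [Module k W] [Module U W]
    [IsScalarTower k U W] : V ⊗[k] W →ₗ[k] W ⊗[k] V :=
  (TensorProduct.comm k V W).toLinearMap ∘ₗ tensorAction V W (R : U ⊗[k] U)

/-- The inverse braided transposition `Ψ⁻¹ : W ⊗ V → V ⊗ W`. -/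
noncomputable def braidingInv (R : (U ⊗[k] U)ˣ) (V W : Type*) [AddCommGroup V] [Module k V]
    [Module U V] [IsScalarTower k U V] [AddCommGroup W] [Module k W] [Module U W]
    [IsScalarTower k U W] : W ⊗[k] V →ₗ[k] V ⊗[k] W :=
  tensorAction V W ((R⁻¹ : (U ⊗[k] U)ˣ) : U ⊗[k] U) ∘ₗ (TensorProduct.comm k W V).toLinearMap

/-- The product of the braided tensor product algebra `X ⊗ X`, as the linear map
`(a ⊗ b) ⊗ (c ⊗ d) ↦ a Ψ(b ⊗ c) d`. -/
noncomputable def braidedTensorMul (R : (U ⊗[k] U)ˣ) (X : Type*) [Ring X] [Algebra k X]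
    [Module U X] [IsScalarTower k U X] :
    (X ⊗[k] X) ⊗[k] (X ⊗[k] X) →ₗ[k] X ⊗[k] X :=
  TensorProduct.map (LinearMap.mul' k X) (LinearMap.mul' k X) ∘ₗ
    (TensorProduct.assoc k X X (X ⊗[k] X)).symm.toLinearMap ∘ₗ
    LinearMap.lTensor X
      ((TensorProduct.assoc k X X X).toLinearMap ∘ₗ
        LinearMap.rTensor X (braiding R X X) ∘ₗ
        (TensorProduct.assoc k X X X).symm.toLinearMap) ∘ₗ
    (TensorProduct.assoc k X X (X ⊗[k] X)).toLinearMap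

end Braiding

/-! ### Braided Hopf algebras and their dual pairings -/

section BraidedHopf

variable {k U : Type*} [Field k] [Ring U] [HopfAlgebra k U]

/-- `X` (an algebra and a coalgebra with a left action of `U`) is, with antipode `S`, a Hopf
algebra in the category of left `U`-modules, braided by the universal R-matrix `R`. -/
structure IsBraidedHopfAlgebra (R : (U ⊗[k] U)ˣ) {X : Type*} [Ring X] [Algebra k X]
    [Coalgebra k X] [Module U X] [IsScalarTower k U X] (S : X →ₗ[k] X) : Prop where
  /-- the product is `U`-linear: `h ▷ (a b) = (h₁ ▷ a) (h₂ ▷ b)` -/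
  smul_mul : ∀ (h : U) (a b : X),
    h • (a * b) = LinearMap.mul' k X (tensorAction X X (Coalgebra.comul h) (a ⊗ₜ[k] b))
  /-- the unit is `U`-linear -/
  smul_one : ∀ h : U, h • (1 : X) = Coalgebra.counit (R := k) h • (1 : X)
  /-- the coproduct is `U`-linear -/
  comul_smul : ∀ (h : U) (a : X),
    Coalgebra.comul (R := k) (h • a) =
      tensorAction X X (Coalgebra.comul h) (Coalgebra.comul a)
  /-- the counit is `U`-linear -/
  counit_smul : ∀ (h : U) (a : X),
    Coalgebra.counit (R := k) (h • a) =
      Coalgebra.counit (R := k) h * Coalgebra.counit (R := k) a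
  /-- the antipode is `U`-linear -/
  antipode_smul : ∀ (h : U) (a : X), S (h • a) = h • S a
  /-- the coproduct is braided multiplicative -/
  comul_mul : ∀ a b : X,
    Coalgebra.comul (R := k) (a * b) =
      braidedTensorMul R X (Coalgebra.comul a ⊗ₜ[k] Coalgebra.comul b)
  comul_one : Coalgebra.comul (R := k) (1 : X) = 1 ⊗ₜ[k] 1
  counit_mul : ∀ a b : X,
    Coalgebra.counit (R := k) (a * b) =
      Coalgebra.counit (R := k) a * Coalgebra.counit (R := k) b
  counit_one : Coalgebra.counit (R := k) (1 : X) = 1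
  /-- `S(a₁) a₂ = ε(a) 1` -/
  antipode_left : ∀ a : X,
    LinearMap.mul' k X (LinearMap.rTensor X S (Coalgebra.comul a)) =
      Coalgebra.counit (R := k) a • (1 : X)
  /-- `a₁ S(a₂) = ε(a) 1` -/
  antipode_right : ∀ a : X,
    LinearMap.mul' k X (LinearMap.lTensor X S (Coalgebra.comul a)) =
      Coalgebra.counit (R := k) a • (1 : X)

/-- The bilinear form `⟨·,·⟩ : D × X → k` is a `U`-invariant pairing which relates products and
coproducts in the nested way appropriate to a braided category. -/
structure IsBraidedDualPairing (U : Type*) [Ring U] [HopfAlgebra k U] {X D : Type*}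
    [Ring X] [Algebra k X] [Coalgebra k X] [Module U X] [IsScalarTower k U X]
    [Ring D] [Algebra k D] [Coalgebra k D] [Module U D] [IsScalarTower k U D]
    (p : D →ₗ[k] X →ₗ[k] k) : Prop where
  /-- `⟨h₁ ▷ σ, h₂ ▷ ξ⟩ = ε(h) ⟨σ, ξ⟩` -/
  invariant : ∀ (h : U) (σ : D) (ξ : X),
    TensorProduct.lift p (tensorAction D X (Coalgebra.comul h) (σ ⊗ₜ[k] ξ)) =
      Coalgebra.counit (R := k) h * p σ ξ
  /-- `⟨σ τ, ξ⟩ = ⟨τ, ξ₁⟩ ⟨σ, ξ₂⟩` -/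
  mul_left : ∀ (σ τ : D) (ξ : X),
    p (σ * τ) ξ =
      LinearMap.mul' k k (TensorProduct.map (p τ) (p σ) (Coalgebra.comul ξ))
  /-- `⟨σ, ξ η⟩ = ⟨σ₁, η⟩ ⟨σ₂, ξ⟩` -/
  mul_right : ∀ (σ : D) (ξ η : X),
    p σ (ξ * η) =
      LinearMap.mul' k k (TensorProduct.map (p.flip η) (p.flip ξ) (Coalgebra.comul σ))
  /-- `⟨1, ξ⟩ = ε(ξ)` -/
  one_left : ∀ ξ : X, p 1 ξ = Coalgebra.counit (R := k) ξ
  /-- `⟨σ, 1⟩ = ε(σ)` -/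
  one_right : ∀ σ : D, p σ 1 = Coalgebra.counit (R := k) σ

end BraidedHopf

/-! ### Integrals and the braided trace formula -/

section Integrals

variable {k : Type*} [Field k]

/-- `I` is an invariant integral on `X`: `ξ₁ ⟨ξ₂⟩ = ⟨ξ⟩ 1` for all `ξ`. -/
def IsInvariantIntegral {X : Type*} [Ring X] [Algebra k X] [Coalgebra k X]
    (I : X →ₗ[k] k) : Prop :=
  ∀ ξ : X, TensorProduct.rid k X (LinearMap.lTensor X I (Coalgebra.comul ξ)) = I ξ • (1 : X)

/-- The map `S⁻²`. The antipode of a finite-dimensional braided Hopf algebra is always bijective,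
so that `Ring.inverse S` is its inverse map. -/
noncomputable def antipodeInvSq {V : Type*} [AddCommGroup V] [Module k V] (S : V →ₗ[k] V) :
    V →ₗ[k] V :=
  Ring.inverse (S : Module.End k V) ∘ₗ Ring.inverse (S : Module.End k V)

variable {U : Type*} [Ring U] [HopfAlgebra k U] {X D : Type*}
  [Ring X] [Algebra k X] [Module U X] [IsScalarTower k U X]
  [Ring D] [Algebra k D] [Module U D] [IsScalarTower k U D]

/-- The braided trace formula on `X`. If `c = φⁱ ⊗ εᵢ ∈ X ⊗ D` is the canonical element,
`Ψ⁻¹(c) = ε' ⊗ φ'` (summation understood) and `S` is the antipode of `D`, then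
`⟨ξ⟩ = ⟨S⁻²(ε'), φ' ξ⟩`. -/
noncomputable def braidedTrace (R : (U ⊗[k] U)ˣ) (p : D →ₗ[k] X →ₗ[k] k) (c : X ⊗[k] D)
    (S : D →ₗ[k] D) : X →ₗ[k] k :=
  TensorProduct.lift p ∘ₗ
    TensorProduct.map (antipodeInvSq S) (LinearMap.mul' k X) ∘ₗ
    (TensorProduct.assoc k D X X).toLinearMap ∘ₗ
    TensorProduct.mk k (D ⊗[k] X) X (braidingInv R D X c)

/-- The braided trace formula on `D`. If `c = φⁱ ⊗ εᵢ ∈ X ⊗ D` is the canonical element and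
`S` is the antipode of `X`, then `⟨σ⟩` is the value of the pairing on
`(id ⊗ S⁻²) Ψ⁻¹(φⁱ ⊗ εᵢ σ)`. -/
noncomputable def braidedTraceDual (R : (U ⊗[k] U)ˣ) (p : D →ₗ[k] X →ₗ[k] k) (c : X ⊗[k] D)
    (S : X →ₗ[k] X) : D →ₗ[k] k :=
  TensorProduct.lift p ∘ₗ
    LinearMap.lTensor D (antipodeInvSq S) ∘ₗ
    braidingInv R D X ∘ₗ
    LinearMap.lTensor X (LinearMap.mul' k D) ∘ₗ
    (TensorProduct.assoc k X D D).toLinearMap ∘ₗ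
    TensorProduct.mk k (X ⊗[k] D) D c

/-- If `c = φⁱ ⊗ εᵢ ∈ X ⊗ D` is the canonical element, `Ψ⁻¹(c) = ε' ⊗ φ'` (summation
understood) and `S` is the antipode of `D`, this is `⟨σ S⁻²(ε'), φ' ξ⟩`. -/
noncomputable def braidedLoop (R : (U ⊗[k] U)ˣ) (p : D →ₗ[k] X →ₗ[k] k) (c : X ⊗[k] D)
    (S : D →ₗ[k] D) (σ : D) (ξ : X) : k :=
  TensorProduct.lift p
    (TensorProduct.map (LinearMap.mulLeft k σ ∘ₗ antipodeInvSq S) (LinearMap.mulRight k ξ)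
      (braidingInv R D X c))

end Integrals

set_option linter.unusedSectionVars false

section LinearFunctions

variable {k V W M N : Type*} [Field k] [AddCommGroup V] [Module k V] [AddCommGroup W] [Module k W]
  [AddCommGroup M] [Module k M] [AddCommGroup N] [Module k N]

attribute [fun_prop] IsLinearMap

namespace IsLinearMap

@[fun_prop]
theorem id_fun : IsLinearMap k (fun x : V => x) := ⟨fun _ _ => rfl, fun _ _ => rfl⟩

@[fun_prop]
theorem comp_fun {f : W → M} {g : V → W} (hf : IsLinearMap k f) (hg : IsLinearMap k g) :
    IsLinearMap k (fun x => f (g x)) :=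
  ⟨fun x y => by rw [hg.map_add, hf.map_add], fun c x => by rw [hg.map_smul, hf.map_smul]⟩

@[fun_prop]
theorem coe_apply (f : W →ₗ[k] M) {g : V → W} (hg : IsLinearMap k g) :
    IsLinearMap k (fun x => f (g x)) :=
  ⟨fun x y => by rw [hg.map_add, f.map_add], fun c x => by rw [hg.map_smul, f.map_smul]⟩

@[fun_prop]
theorem sum {ι : Type*} {s : Finset ι} {f : ι → V → W} (hf : ∀ i, IsLinearMap k (fun x => f i x)) :
    IsLinearMap k (fun x => ∑ i ∈ s, f i x) :=
  ⟨fun x y => by simp_rw [(hf _).map_add, Finset.sum_add_distrib],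
   fun c x => by simp_rw [(hf _).map_smul, Finset.smul_sum]⟩

@[fun_prop]
theorem tmul_left {f : V → W} (hf : IsLinearMap k f) (m : M) :
    IsLinearMap k (fun x => f x ⊗ₜ[k] m) :=
  ⟨fun x y => by rw [hf.map_add, add_tmul], fun c x => by rw [hf.map_smul, smul_tmul']⟩

@[fun_prop]
theorem tmul_right {f : V → W} (hf : IsLinearMap k f) (m : M) :
    IsLinearMap k (fun x => m ⊗ₜ[k] f x) :=
  ⟨fun x y => by rw [hf.map_add, tmul_add], fun c x => by rw [hf.map_smul, tmul_smul]⟩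

section
variable {A : Type*} [Ring A] [Algebra k A]

@[fun_prop]
theorem mul_left {f : V → A} (hf : IsLinearMap k f) (m : A) : IsLinearMap k (fun x => f x * m) :=
  ⟨fun x y => by rw [hf.map_add, add_mul], fun c x => by rw [hf.map_smul, smul_mul_assoc]⟩

@[fun_prop]
theorem mul_right {f : V → A} (hf : IsLinearMap k f) (m : A) : IsLinearMap k (fun x => m * f x) :=
  ⟨fun x y => by rw [hf.map_add, mul_add], fun c x => by rw [hf.map_smul, mul_smul_comm]⟩

variable [Module A W] [IsScalarTower k A W]

@[fun_prop]
theorem act_left {f : V → A} (hf : IsLinearMap k f) (m : W) : IsLinearMap k (fun x => f x • m) :=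
  ⟨fun x y => by rw [hf.map_add, add_smul], fun c x => by rw [hf.map_smul, smul_assoc]⟩

@[fun_prop]
theorem act_right {f : V → W} (hf : IsLinearMap k f) (a : A) : IsLinearMap k (fun x => a • f x) :=
  ⟨fun x y => by rw [hf.map_add, smul_add], fun c x => by rw [hf.map_smul, smul_comm]⟩

end

@[fun_prop]
theorem scalar_left {f : V → k} (hf : IsLinearMap k f) (m : W) :
    IsLinearMap k (fun x => f x • m) :=
  ⟨fun x y => by rw [hf.map_add, add_smul], fun c x => by rw [hf.map_smul, smul_assoc]⟩

@[fun_prop]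
theorem pairing_left (p : W →ₗ[k] M →ₗ[k] N) {f : V → W} (hf : IsLinearMap k f) (m : M) :
    IsLinearMap k (fun x => p (f x) m) :=
  coe_apply (p.flip m) hf

end IsLinearMap

end LinearFunctions


section MultilinearExtension

variable {k V W Z M : Type*} [Field k] [AddCommGroup V] [Module k V] [AddCommGroup W] [Module k W]
  [AddCommGroup Z] [Module k Z] [AddCommGroup M] [Module k M]

/-- The linear map on a tensor product defined by a function which is linear in each argument. -/
noncomputable def bilinearLift (E : V → W → M) (h₁ : ∀ w, IsLinearMap k fun v => E v w)
    (h₂ : ∀ v, IsLinearMap k fun w => E v w) : V ⊗[k] W →ₗ[k] M :=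
  TensorProduct.lift (LinearMap.mk₂ k E (fun _ _ w => (h₁ w).map_add _ _)
    (fun _ _ w => (h₁ w).map_smul _ _) (fun v _ _ => (h₂ v).map_add _ _)
    (fun _ v _ => (h₂ v).map_smul _ _))

@[simp]
theorem bilinearLift_tmul (E : V → W → M) (h₁ : ∀ w, IsLinearMap k fun v => E v w)
    (h₂ : ∀ v, IsLinearMap k fun w => E v w) (v : V) (w : W) :
    bilinearLift E h₁ h₂ (v ⊗ₜ w) = E v w := by
  simp [bilinearLift]

/-- The linear map on a triple tensor product defined by a function which is linear in each
argument. -/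
noncomputable def trilinearLift (E : V → W → Z → M)
    (h₁ : ∀ w z, IsLinearMap k fun v => E v w z) (h₂ : ∀ v z, IsLinearMap k fun w => E v w z)
    (h₃ : ∀ v w, IsLinearMap k fun z => E v w z) : (V ⊗[k] W) ⊗[k] Z →ₗ[k] M :=
  bilinearLift (fun t z => bilinearLift (fun v w => E v w z) (fun w => h₁ w z) (fun v => h₂ v z) t)
    (fun z => (bilinearLift (fun v w => E v w z) (fun w => h₁ w z) (fun v => h₂ v z)).isLinear)
    (fun t => by
      induction t with
      | zero => exact ⟨by simp, by simp⟩
      | tmul v w => simpa using h₃ v w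
      | add s t hs ht =>
        exact ⟨fun x y => by rw [map_add, map_add, map_add, hs.map_add, ht.map_add]; abel,
          fun c x => by rw [map_add, map_add, hs.map_smul, ht.map_smul, smul_add]⟩)

@[simp]
theorem trilinearLift_tmul (E : V → W → Z → M)
    (h₁ : ∀ w z, IsLinearMap k fun v => E v w z) (h₂ : ∀ v z, IsLinearMap k fun w => E v w z)
    (h₃ : ∀ v w, IsLinearMap k fun z => E v w z) (v : V) (w : W) (z : Z) :
    trilinearLift E h₁ h₂ h₃ ((v ⊗ₜ w) ⊗ₜ z) = E v w z := by
  simp [trilinearLift]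

end MultilinearExtension

section Sweedler

open Coalgebra

variable {k C V M N : Type*} [Field k] [AddCommGroup C] [Module k C] [Coalgebra k C]
  [AddCommGroup M] [Module k M] [AddCommGroup N] [Module k N] [AddCommGroup V] [Module k V]

/-- Sweedler notation: `sweedler k x E` is `E x₁ x₂`, summation understood. -/
noncomputable def sweedler (k : Type*) {C M : Type*} [Field k] [AddCommGroup C] [Module k C]
    [Coalgebra k C] [AddCommGroup M] (x : C) (E : C → C → M) : M :=
  ∑ r ∈ (ℛ k x).index, E ((ℛ k x).left r) ((ℛ k x).right r)

theorem sweedler_eq_bilinearLift (x : C) (E : C → C → M) (h₁ : ∀ b, IsLinearMap k fun a => E a b)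
    (h₂ : ∀ a, IsLinearMap k fun b => E a b) :
    sweedler k x E = bilinearLift E h₁ h₂ (comul x) := by
  rw [← (ℛ k x).eq, map_sum]
  simp [sweedler]

theorem comul_eq_sweedler (x : C) : comul (R := k) x = sweedler k x fun a b => a ⊗ₜ[k] b :=
  (ℛ k x).eq.symm

theorem apply_sweedler {f : M → N} (hf : IsLinearMap k f) (x : C) (E : C → C → M) :
    f (sweedler k x E) = sweedler k x fun a b => f (E a b) :=
  map_sum (hf.mk' f) _ _

theorem sweedler_sum {I : Type*} (s : Finset I) (x : C) (E : I → C → C → M) :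
    (sweedler k x fun a b => ∑ i ∈ s, E i a b) = ∑ i ∈ s, sweedler k x (E i) :=
  Finset.sum_comm

theorem sweedler_comm {C' : Type*} [AddCommGroup C'] [Module k C'] [Coalgebra k C'] (x : C)
    (y : C') (E : C → C → C' → C' → M) :
    (sweedler k x fun a b => sweedler k y fun c d => E a b c d) =
      sweedler k y fun c d => sweedler k x fun a b => E a b c d :=
  Finset.sum_comm

namespace IsLinearMap

@[fun_prop]
theorem sweedler_left {f : V → C} (hf : IsLinearMap k f) {E : C → C → M}
    (h₁ : ∀ b, IsLinearMap k fun a => E a b) (h₂ : ∀ a, IsLinearMap k fun b => E a b) :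
    IsLinearMap k fun v => sweedler k (f v) E := by
  simp_rw [sweedler_eq_bilinearLift _ E h₁ h₂]
  exact coe_apply _ (coe_apply _ hf)

@[fun_prop]
theorem sweedler_right (x : C) {E : V → C → C → M}
    (h : ∀ a b, IsLinearMap k fun v => E v a b) :
    IsLinearMap k fun v => sweedler k x fun a b => E v a b :=
  IsLinearMap.sum fun _ => h _ _

end IsLinearMap

theorem sweedler_coassoc (x : C) (E : C → C → C → M)
    (h₁ : ∀ b c, IsLinearMap k fun a => E a b c) (h₂ : ∀ a c, IsLinearMap k fun b => E a b c)
    (h₃ : ∀ a b, IsLinearMap k fun c => E a b c) :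
    (sweedler k x fun a c => sweedler k a fun a b => E a b c) =
      sweedler k x fun a b => sweedler k b fun b c => E a b c := by
  have h := congrArg (trilinearLift E h₁ h₂ h₃) (coassoc_symm_apply (R := k) x)
  rw [comul_eq_sweedler x] at h
  simp only [sweedler, map_sum, LinearMap.lTensor_tmul, LinearMap.rTensor_tmul] at h
  simp only [comul_eq_sweedler, sweedler, map_sum, tmul_sum, sum_tmul,
    TensorProduct.assoc_symm_tmul, trilinearLift_tmul] at h
  exact h.symm

theorem sweedler_counit_left (x : C) {f : C → M} (hf : IsLinearMap k f) :
    (sweedler k x fun a b => counit (R := k) a • f b) = f x := by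
  rw [← one_smul k x, hf.map_smul]
  conv_rhs => rw [← sum_counit_smul (ℛ k x)]
  rw [one_smul, one_smul, ← hf.mk'_apply, map_sum]
  simp [sweedler]

theorem sweedler_counit_right (x : C) {f : C → M} (hf : IsLinearMap k f) :
    (sweedler k x fun a b => counit (R := k) b • f a) = f x := by
  have h := congrArg (fun t => hf.mk' f (TensorProduct.rid k C t)) (sum_tmul_counit_eq (ℛ k x))
  simp only [map_sum, TensorProduct.rid_tmul, map_smul, one_smul, IsLinearMap.mk'_apply] at h
  exact h

end Sweedler

section HopfSweedler

open Coalgebra HopfAlgebra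

variable {k U M : Type*} [Field k] [Ring U] [HopfAlgebra k U] [AddCommGroup M] [Module k M]

theorem sweedler_antipode_left (x : U) {f : U → M} (hf : IsLinearMap k f) :
    (sweedler k x fun a b => f (antipode k a * b)) = counit (R := k) x • f 1 := by
  rw [← hf.map_smul, ← sum_antipode_mul_eq_smul (ℛ k x), ← apply_sweedler hf]
  rfl

theorem sweedler_antipode_right (x : U) {f : U → M} (hf : IsLinearMap k f) :
    (sweedler k x fun a b => f (a * antipode k b)) = counit (R := k) x • f 1 := by
  rw [← hf.map_smul, ← sum_mul_antipode_eq_smul (ℛ k x), ← apply_sweedler hf]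
  rfl

theorem sweedler_mul (x y : U) (E : U → U → M) (h₁ : ∀ b, IsLinearMap k fun a => E a b)
    (h₂ : ∀ a, IsLinearMap k fun b => E a b) :
    sweedler k (x * y) E =
      sweedler k x fun a b => sweedler k y fun c d => E (a * c) (b * d) := by
  rw [sweedler_eq_bilinearLift _ E h₁ h₂, Bialgebra.comul_mul, comul_eq_sweedler x,
    comul_eq_sweedler y]
  simp only [sweedler, Finset.sum_mul_sum, map_sum, Algebra.TensorProduct.tmul_mul_tmul,
    bilinearLift_tmul]

open WithConv in
theorem comul_antipode (x : U) :
    comul (R := k) (antipode k x) = sweedler k x fun a b => antipode k b ⊗ₜ[k] antipode k a := by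
  let G : U →ₗ[k] U ⊗[k] U := TensorProduct.map (antipode k) (antipode k) ∘ₗ
    (TensorProduct.comm k U U).toLinearMap ∘ₗ comul
  have hG (y : U) : G y = sweedler k y fun a b => antipode k b ⊗ₜ[k] antipode k a := by
    change TensorProduct.map (antipode k) (antipode k) (TensorProduct.comm k U U (comul y)) = _
    rw [comul_eq_sweedler y]
    simp [sweedler, map_sum]
  have h : toConv G * toConv (comul (R := k) (A := U)) = 1 := by
    ext y
    have : (toConv G * toConv (comul (R := k) (A := U))).ofConv y =
        sweedler k y fun a b => G a * comul b := (ℛ k y).convMul_apply ..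
    refine this.trans ?_
    calc sweedler k y (fun a b => G a * comul b)
        = sweedler k y fun a b => sweedler k a fun a₁ a₂ => sweedler k b fun b₁ b₂ =>
            (antipode k a₂ * b₁) ⊗ₜ[k] (antipode k a₁ * b₂) := by
          simp only [hG, comul_eq_sweedler, sweedler, Finset.sum_mul_sum,
            Algebra.TensorProduct.tmul_mul_tmul]
      _ = sweedler k y fun a₁ b => sweedler k b fun a₂ b => sweedler k b fun b₁ b₂ =>
            (antipode k a₂ * b₁) ⊗ₜ[k] (antipode k a₁ * b₂) :=
          sweedler_coassoc y (fun a₁ a₂ b => sweedler k b fun b₁ b₂ =>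
            (antipode k a₂ * b₁) ⊗ₜ[k] (antipode k a₁ * b₂))
            (by fun_prop) (by fun_prop) (by fun_prop)
      _ = sweedler k y fun a₁ b => sweedler k b fun c b₂ => sweedler k c fun a₂ b₁ =>
            (antipode k a₂ * b₁) ⊗ₜ[k] (antipode k a₁ * b₂) := by
          congr! 3 with a₁ b
          exact (sweedler_coassoc b (fun a₂ b₁ b₂ =>
            (antipode k a₂ * b₁) ⊗ₜ[k] (antipode k a₁ * b₂))
            (by fun_prop) (by fun_prop) (by fun_prop)).symm
      _ = sweedler k y fun a₁ b => (1 : U) ⊗ₜ[k] (antipode k a₁ * b) := by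
          congr! 3 with a₁ b
          rw [← sweedler_counit_left b (f := fun b => (1 : U) ⊗ₜ[k] (antipode k a₁ * b))
            (by fun_prop)]
          congr! 3 with c b₂
          exact sweedler_antipode_left c (f := fun z => z ⊗ₜ[k] (antipode k a₁ * b₂)) (by fun_prop)
      _ = counit (R := k) y • (1 : U) ⊗ₜ[k] (1 : U) :=
          sweedler_antipode_left y (f := fun z => (1 : U) ⊗ₜ[k] z) (by fun_prop)
      _ = _ := by
        rw [← Algebra.TensorProduct.one_def, ← Algebra.algebraMap_eq_smul_one]
        simp
  have := left_inv_eq_right_inv h LinearMap.comul_right_inv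
  rw [← hG]
  exact (LinearMap.congr_fun (WithConv.toConv_injective this) x).symm

theorem sweedler_antipode (x : U) (E : U → U → M) (h₁ : ∀ b, IsLinearMap k fun a => E a b)
    (h₂ : ∀ a, IsLinearMap k fun b => E a b) :
    sweedler k (antipode k x) E = sweedler k x fun a b => E (antipode k b) (antipode k a) := by
  rw [sweedler_eq_bilinearLift _ E h₁ h₂, comul_antipode]
  simp [sweedler, map_sum]

end HopfSweedler

theorem Finset.sum_rotate {I J K M : Type*} {s : Finset I} {t : Finset J} {r : Finset K}
    [AddCommMonoid M] (f : I → J → K → M) :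
    ∑ i ∈ s, ∑ j ∈ t, ∑ l ∈ r, f i j l = ∑ l ∈ r, ∑ i ∈ s, ∑ j ∈ t, f i j l :=
  (Finset.sum_congr rfl fun _ _ => Finset.sum_comm).trans Finset.sum_comm

section RMatrix

open Coalgebra HopfAlgebra

variable {k U M : Type*} [Field k] [Ring U] [HopfAlgebra k U] [AddCommGroup M] [Module k M]

namespace IsUniversalRMatrix

variable {R : (U ⊗[k] U)ˣ} (hR : IsUniversalRMatrix R) {I : Type*} [Fintype I] {A B : I → U}
  (hAB : (R : U ⊗[k] U) = ∑ i, A i ⊗ₜ[k] B i)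

include hR hAB

theorem hexagon_left (E : U → U → U → M) (h₁ : ∀ b c, IsLinearMap k fun a => E a b c)
    (h₂ : ∀ a c, IsLinearMap k fun b => E a b c) (h₃ : ∀ a b, IsLinearMap k fun c => E a b c) :
    ∑ i, sweedler k (A i) (fun s t => E s t (B i)) = ∑ i, ∑ j, E (A i) (A j) (B i * B j) := by
  have h := congrArg (trilinearLift E h₁ h₂ h₃) hR.comul_left
  rw [hAB] at h
  simpa [sweedler, map_sum, Finset.sum_mul_sum, comul_eq_sweedler, sum_tmul] using h

theorem hexagon_right (E : U → U → U → M) (h₁ : ∀ b c, IsLinearMap k fun a => E a b c)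
    (h₂ : ∀ a c, IsLinearMap k fun b => E a b c) (h₃ : ∀ a b, IsLinearMap k fun c => E a b c) :
    ∑ i, sweedler k (B i) (fun s t => E (A i) s t) = ∑ i, ∑ j, E (A i * A j) (B j) (B i) := by
  have h := congrArg (fun t => trilinearLift E h₁ h₂ h₃ ((TensorProduct.assoc k U U U).symm t))
    hR.comul_right
  rw [hAB] at h
  simpa [sweedler, map_sum, Finset.sum_mul_sum, comul_eq_sweedler, tmul_sum] using h

theorem quasi_cocomm (x : U) (E : U → U → M) (h₁ : ∀ b, IsLinearMap k fun a => E a b)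
    (h₂ : ∀ a, IsLinearMap k fun b => E a b) :
    ∑ i, sweedler k x (fun a b => E (b * A i) (a * B i)) =
      ∑ i, sweedler k x (fun a b => E (A i * a) (B i * b)) := by
  have h := congrArg (fun t => bilinearLift E h₁ h₂ (t * R)) (hR.comul_op x)
  simp only [Units.inv_mul_cancel_right] at h
  rw [hAB, comul_eq_sweedler] at h
  simp only [sweedler, map_sum, Finset.sum_mul_sum, TensorProduct.comm_tmul,
    Algebra.TensorProduct.tmul_mul_tmul, bilinearLift_tmul] at h
  simp only [sweedler]
  rw [Finset.sum_comm, h]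

theorem counit_left : ∑ i, counit (R := k) (A i) • B i = 1 := by
  have h := hexagon_left hR hAB (fun a b c => counit (R := k) a • b ⊗ₜ[k] c)
    (by fun_prop) (fun a c => by fun_prop) (fun a c => by fun_prop)
  have e (i : I) : sweedler k (A i) (fun s t => counit (R := k) s • t ⊗ₜ[k] B i) = A i ⊗ₜ B i :=
    sweedler_counit_left (A i) (f := fun t => t ⊗ₜ[k] B i) (by fun_prop)
  simp only [e] at h
  have h' : (1 ⊗ₜ (∑ i, counit (R := k) (A i) • B i)) * (R : U ⊗[k] U) =
      1 * (R : U ⊗[k] U) := by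
    rw [one_mul]
    nth_rw 2 [hAB]
    rw [h, hAB, tmul_sum, Finset.sum_mul_sum]
    simp
  have h1 := congrArg (fun t => TensorProduct.lid k U
    (TensorProduct.map (counit (R := k) (A := U)) LinearMap.id t)) (R.isUnit.mul_right_cancel h')
  simpa [Algebra.TensorProduct.one_def] using h1

theorem counit_right : ∑ i, counit (R := k) (B i) • A i = 1 := by
  have h := hexagon_right hR hAB (fun a b c => counit (R := k) b • a ⊗ₜ[k] c)
    (by fun_prop) (fun a c => by fun_prop) (fun a c => by fun_prop)
  have e (i : I) : sweedler k (B i) (fun s t => counit (R := k) s • A i ⊗ₜ[k] t) = A i ⊗ₜ B i :=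
    sweedler_counit_left (B i) (f := fun t => A i ⊗ₜ[k] t) (by fun_prop)
  simp only [e] at h
  have h' : (R : U ⊗[k] U) * ((∑ i, counit (R := k) (B i) • A i) ⊗ₜ 1) =
      (R : U ⊗[k] U) * 1 := by
    rw [mul_one]
    nth_rw 2 [hAB]
    rw [h, hAB, sum_tmul, Finset.sum_mul_sum]
    simp [smul_tmul']
  have h1 := congrArg (fun t => TensorProduct.rid k U
    (TensorProduct.map LinearMap.id (counit (R := k) (A := U)) t)) (R.isUnit.mul_left_cancel h')
  simpa [Algebra.TensorProduct.one_def] using h1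

theorem antipode_mul_self :
    ∑ i, ∑ j, (antipode k (A i) * A j) ⊗ₜ[k] (B i * B j) = 1 := by
  rw [← hexagon_left hR hAB (fun a b c => (antipode k a * b) ⊗ₜ[k] c) (by fun_prop) (by fun_prop)
    (by fun_prop)]
  have e (i : I) := sweedler_antipode_left (A i) (f := fun z => z ⊗ₜ[k] B i) (by fun_prop)
  simp only [e, ← tmul_smul, ← tmul_sum, counit_left hR hAB, Algebra.TensorProduct.one_def]

theorem self_mul_antipode :
    ∑ i, ∑ j, (A i * antipode k (A j)) ⊗ₜ[k] (B i * B j) = 1 := by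
  rw [← hexagon_left hR hAB (fun a b c => (a * antipode k b) ⊗ₜ[k] c) (by fun_prop) (by fun_prop)
    (by fun_prop)]
  have e (i : I) := sweedler_antipode_right (A i) (f := fun z => z ⊗ₜ[k] B i) (by fun_prop)
  simp only [e, ← tmul_smul, ← tmul_sum, counit_left hR hAB, Algebra.TensorProduct.one_def]

theorem self_mul_op_antipode :
    ∑ i, ∑ j, (A i * A j) ⊗ₜ[k] (antipode k (B j) * B i) = 1 := by
  rw [← hexagon_right hR hAB (fun a b c => a ⊗ₜ[k] (antipode k b * c)) (by fun_prop) (by fun_prop)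
    (by fun_prop)]
  have e (i : I) := sweedler_antipode_left (B i) (f := fun z => A i ⊗ₜ[k] z) (by fun_prop)
  simp only [e, smul_tmul', ← sum_tmul, counit_right hR hAB, Algebra.TensorProduct.one_def]

theorem antipode_mul_op_self :
    ∑ i, ∑ j, (A i * A j) ⊗ₜ[k] (B j * antipode k (B i)) = 1 := by
  rw [← hexagon_right hR hAB (fun a b c => a ⊗ₜ[k] (b * antipode k c)) (by fun_prop) (by fun_prop)
    (by fun_prop)]
  have e (i : I) := sweedler_antipode_right (B i) (f := fun z => A i ⊗ₜ[k] z) (by fun_prop)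
  simp only [e, smul_tmul', ← sum_tmul, counit_right hR hAB, Algebra.TensorProduct.one_def]

theorem inv_eq : ((R⁻¹ : (U ⊗[k] U)ˣ) : U ⊗[k] U) = ∑ i, antipode k (A i) ⊗ₜ[k] B i := by
  refine (left_inv_eq_right_inv (a := (R : U ⊗[k] U)) ?_ R.mul_inv).symm
  rw [hAB, Finset.sum_mul_sum, ← antipode_mul_self hR hAB]
  simp

theorem antipode_tmul_antipode :
    ∑ i, antipode k (A i) ⊗ₜ[k] antipode k (B i) = ∑ i, A i ⊗ₜ[k] B i := by
  have h := congrArg (TensorProduct.map (antipode k) LinearMap.id) (self_mul_op_antipode hR hAB)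
  simp only [map_sum, TensorProduct.map_tmul, antipode_mul_antidistrib, LinearMap.id_apply,
    Algebra.TensorProduct.one_def, antipode_one] at h
  have h' : (∑ i, antipode k (A i) ⊗ₜ[k] antipode k (B i)) *
      ((R⁻¹ : (U ⊗[k] U)ˣ) : U ⊗[k] U) = 1 := by
    rw [inv_eq hR hAB, Finset.sum_mul_sum, Finset.sum_comm, Algebra.TensorProduct.one_def, ← h]
    simp
  rw [← hAB]
  exact (Units.mul_inv_eq_one.1 h')

theorem sum_antipode_antipode (E : U → U → M) (h₁ : ∀ b, IsLinearMap k fun a => E a b)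
    (h₂ : ∀ a, IsLinearMap k fun b => E a b) :
    ∑ i, E (antipode k (A i)) (antipode k (B i)) = ∑ i, E (A i) (B i) := by
  simpa [map_sum] using congrArg (bilinearLift E h₁ h₂) (antipode_tmul_antipode hR hAB)

theorem yang_baxter (E : U → U → U → M) (h₁ : ∀ b c, IsLinearMap k fun a => E a b c)
    (h₂ : ∀ a c, IsLinearMap k fun b => E a b c) (h₃ : ∀ a b, IsLinearMap k fun c => E a b c) :
    ∑ i, ∑ l, ∑ m, E (A i * A l) (B l * B m) (B i * A m) =
      ∑ i, ∑ l, ∑ m, E (A l * A i) (B m * B l) (A m * B i) := by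
  calc ∑ i, ∑ l, ∑ m, E (A i * A l) (B l * B m) (B i * A m)
      = ∑ m, ∑ i, ∑ l, E (A i * A l) (B l * B m) (B i * A m) := Finset.sum_rotate _
    _ = ∑ m, ∑ i, sweedler k (B i) fun s t => E (A i) (s * B m) (t * A m) :=
        Finset.sum_congr rfl fun m _ => (hexagon_right hR hAB
          (fun a s t => E a (s * B m) (t * A m)) (by fun_prop) (by fun_prop) (by fun_prop)).symm
    _ = ∑ i, ∑ m, sweedler k (B i) fun s t => E (A i) (s * B m) (t * A m) := Finset.sum_comm
    _ = ∑ i, ∑ m, sweedler k (B i) fun s t => E (A i) (B m * t) (A m * s) :=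
        Finset.sum_congr rfl fun i _ =>
          quasi_cocomm hR hAB (B i) (fun t s => E (A i) s t) (by fun_prop) (by fun_prop)
    _ = ∑ m, ∑ i, sweedler k (B i) fun s t => E (A i) (B m * t) (A m * s) := Finset.sum_comm
    _ = ∑ m, ∑ i, ∑ l, E (A i * A l) (B m * B i) (A m * B l) :=
        Finset.sum_congr rfl fun m _ => by
          rw [hexagon_right hR hAB (fun a s t => E a (B m * t) (A m * s)) (by fun_prop)
            (by fun_prop) (by fun_prop)]
    _ = ∑ m, ∑ i, ∑ l, E (A l * A i) (B m * B l) (A m * B i) :=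
        Finset.sum_congr rfl fun m _ => Finset.sum_comm
    _ = _ := (Finset.sum_rotate _).symm

/-- Drinfeld's element `u = S(R⁽²⁾) R⁽¹⁾`. -/
noncomputable def drinfeld (k : Type*) {U I : Type*} [Field k] [Ring U] [HopfAlgebra k U]
    [Fintype I] (A B : I → U) : U :=
  ∑ i, antipode k (B i) * A i

/-- The inverse `R⁽²⁾ S²(R⁽¹⁾)` of Drinfeld's element. -/
noncomputable def drinfeldInv (k : Type*) {U I : Type*} [Field k] [Ring U] [HopfAlgebra k U]
    [Fintype I] (A B : I → U) : U :=
  ∑ i, B i * antipode k (antipode k (A i))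

theorem antipode_drinfeld_mul (x : U) :
    (sweedler k x fun a b => antipode k b * drinfeld k A B * a) =
      counit (R := k) x • drinfeld k A B := by
  have h := quasi_cocomm hR hAB x (fun p q => antipode k q * p) (by fun_prop) (by fun_prop)
  simp only [antipode_mul_antidistrib] at h
  calc _ = ∑ i, sweedler k x (fun a b => antipode k b * antipode k (B i) * (A i * a)) := by
        rw [← sweedler_sum]
        simp only [drinfeld, Finset.mul_sum, Finset.sum_mul, mul_assoc]
    _ = ∑ i, counit (R := k) x • (antipode k (B i) * (1 * A i)) := by
        rw [← h]
        refine Finset.sum_congr rfl fun i _ => ?_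
        rw [← sweedler_antipode_left x (f := fun z => antipode k (B i) * (z * A i)) (by fun_prop)]
        simp only [mul_assoc]
    _ = _ := by simp [drinfeld, Finset.smul_sum]

theorem antipode_antipode_mul_drinfeld (x : U) :
    antipode k (antipode k x) * drinfeld k A B = drinfeld k A B * x := by
  have h₁ : (sweedler k x fun c d => sweedler k c fun a b =>
      antipode k (antipode k d) * (antipode k b * drinfeld k A B * a)) =
      antipode k (antipode k x) * drinfeld k A B := by
    rw [← sweedler_counit_left (k := k) x (f := fun x => antipode k (antipode k x) * drinfeld k A B)
      (by fun_prop)]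
    congr! 3 with c d
    rw [← apply_sweedler (k := k) (f := fun z => antipode k (antipode k d) * z) (by fun_prop),
      antipode_drinfeld_mul hR hAB]
    simp
  rw [← h₁, sweedler_coassoc x (fun a b d =>
    antipode k (antipode k d) * (antipode k b * drinfeld k A B * a)) (by fun_prop) (by fun_prop)
    (by fun_prop), ← sweedler_counit_right (k := k) x (f := fun x => drinfeld k A B * x) (by fun_prop)]
  congr! 3 with a d
  have := sweedler_antipode_right (k := k) d
    (f := fun z => antipode k z * (drinfeld k A B * a)) (by fun_prop)
  simpa [antipode_mul_antidistrib, mul_assoc] using this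

theorem drinfeld_mul_drinfeldInv : drinfeld k A B * drinfeldInv k A B = 1 := by
  have h := congrArg (LinearMap.mul' k U ∘ₗ (TensorProduct.comm k U U).toLinearMap)
    (antipode_mul_op_self hR hAB)
  simp only [map_sum, LinearMap.comp_apply, Algebra.TensorProduct.one_def, LinearEquiv.coe_coe,
    TensorProduct.comm_tmul, LinearMap.mul'_apply, mul_one] at h
  have e (i : I) : drinfeld k A B * (B i * antipode k (antipode k (A i))) =
      antipode k (antipode k (B i)) * drinfeld k A B * antipode k (antipode k (A i)) := by
    rw [← mul_assoc, ← antipode_antipode_mul_drinfeld hR hAB]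
  rw [← h, drinfeldInv, Finset.mul_sum, Finset.sum_comm]
  simp only [e]
  rw [sum_antipode_antipode hR hAB (fun a b => antipode k b * drinfeld k A B * antipode k a)
    (by fun_prop) (by fun_prop), sum_antipode_antipode hR hAB (fun a b => b * drinfeld k A B * a)
    (by fun_prop) (by fun_prop)]
  simp only [drinfeld, Finset.mul_sum, Finset.sum_mul, mul_assoc]

theorem drinfeldInv_mul_drinfeld : drinfeldInv k A B * drinfeld k A B = 1 := by
  have h := congrArg (LinearMap.mul' k U ∘ₗ (TensorProduct.comm k U U).toLinearMap)
    (antipode_mul_op_self hR hAB)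
  simp only [map_sum, LinearMap.comp_apply, Algebra.TensorProduct.one_def, LinearEquiv.coe_coe,
    TensorProduct.comm_tmul, LinearMap.mul'_apply, mul_one] at h
  rw [← h, drinfeldInv, Finset.sum_mul, Finset.sum_comm]
  simp only [mul_assoc, antipode_antipode_mul_drinfeld hR hAB]
  simp only [drinfeld, Finset.mul_sum, Finset.sum_mul, mul_assoc]

theorem drinfeldInv_mul_antipode_antipode (x : U) :
    drinfeldInv k A B * antipode k (antipode k x) = x * drinfeldInv k A B := by
  have h := congrArg (fun z => drinfeldInv k A B * z * drinfeldInv k A B)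
    (antipode_antipode_mul_drinfeld hR hAB x)
  simpa only [mul_assoc, drinfeld_mul_drinfeldInv hR hAB, mul_one,
    ← mul_assoc _ (drinfeld k A B), drinfeldInv_mul_drinfeld hR hAB, one_mul] using h

theorem exists_antipode_antipode_eq (x : U) : ∃ y : U, antipode k (antipode k y) = x := by
  refine ⟨drinfeldInv k A B * x * drinfeld k A B, ?_⟩
  rw [← mul_one (antipode k _), ← drinfeld_mul_drinfeldInv hR hAB, ← mul_assoc,
    antipode_antipode_mul_drinfeld hR hAB, ← mul_assoc, ← mul_assoc,
    drinfeld_mul_drinfeldInv hR hAB, one_mul, mul_assoc, drinfeld_mul_drinfeldInv hR hAB, mul_one]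

theorem sum_mul_drinfeldInv_mul_antipode :
    ∑ i, B i * drinfeldInv k A B * antipode k (A i) = 1 := by
  rw [← sum_antipode_antipode hR hAB (fun a b => b * drinfeldInv k A B * antipode k a)
    (by fun_prop) (by fun_prop)]
  simp only [mul_assoc, drinfeldInv_mul_antipode_antipode hR hAB]
  rw [← drinfeld_mul_drinfeldInv hR hAB]
  simp only [drinfeld, Finset.sum_mul, mul_assoc]

theorem sweedler_drinfeldInv (E : U → U → M) (h₁ : ∀ b, IsLinearMap k fun a => E a b)
    (h₂ : ∀ a, IsLinearMap k fun b => E a b) :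
    sweedler k (drinfeldInv k A B) E =
      ∑ m, ∑ i, E (B m * A i * drinfeldInv k A B) (A m * B i * drinfeldInv k A B) := by
  set q := drinfeldInv k A B with hq
  let σ : U →ₗ[k] U := antipode k ∘ₗ antipode k
  have hσm (a b : U) : σ (a * b) = σ a * σ b := by simp [σ, antipode_mul_antidistrib]
  have hqσ (c : U) : ∑ i, c * B i * σ (A i) = c * q := by
    simp [hq, drinfeldInv, Finset.mul_sum, mul_assoc, σ]
  have hqσ' (x : U) : q * σ x = x * q := drinfeldInv_mul_antipode_antipode hR hAB x
  have hsum : sweedler k q E = ∑ i, sweedler k (B i * σ (A i)) E := by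
    have : IsLinearMap k (fun x : U => sweedler k x E) := by fun_prop
    exact map_sum (this.mk' _) _ _
  calc sweedler k q E
      = ∑ i, sweedler k (A i) fun a₁ a₂ => sweedler k (B i) fun b₁ b₂ =>
          E (b₁ * σ a₁) (b₂ * σ a₂) := by
        rw [hsum]
        refine Finset.sum_congr rfl fun i _ => ?_
        rw [sweedler_mul _ _ _ h₁ h₂, sweedler_comm, LinearMap.comp_apply,
          sweedler_antipode _ _ (by fun_prop) (by fun_prop),
          sweedler_antipode _ _ (by fun_prop) (by fun_prop)]
        rfl
    _ = ∑ i, ∑ j, sweedler k (B i * B j) fun b₁ b₂ => E (b₁ * σ (A i)) (b₂ * σ (A j)) :=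
        hexagon_left hR hAB (fun a₁ a₂ z => sweedler k z fun b₁ b₂ => E (b₁ * σ a₁) (b₂ * σ a₂))
          (by fun_prop) (by fun_prop) (by fun_prop)
    _ = ∑ i, ∑ j, sweedler k (B i) fun b₁ b₂ => sweedler k (B j) fun c₁ c₂ =>
          E (b₁ * c₁ * σ (A i)) (b₂ * c₂ * σ (A j)) := by
        refine Finset.sum_congr rfl fun i _ => Finset.sum_congr rfl fun j _ => ?_
        exact sweedler_mul _ _ _ (by fun_prop) (by fun_prop)
    _ = ∑ j, ∑ i, sweedler k (B i) fun b₁ b₂ => sweedler k (B j) fun c₁ c₂ =>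
          E (b₁ * c₁ * σ (A i)) (b₂ * c₂ * σ (A j)) := Finset.sum_comm
    _ = ∑ j, ∑ i, ∑ l, sweedler k (B j) fun c₁ c₂ =>
          E (B l * c₁ * σ (A i * A l)) (B i * c₂ * σ (A j)) :=
        Finset.sum_congr rfl fun j _ => hexagon_right hR hAB (fun a b₁ b₂ => sweedler k (B j)
          fun c₁ c₂ => E (b₁ * c₁ * σ a) (b₂ * c₂ * σ (A j))) (by fun_prop) (by fun_prop)
          (by fun_prop)
    _ = ∑ i, ∑ l, ∑ j, sweedler k (B j) fun c₁ c₂ =>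
          E (B l * c₁ * σ (A i * A l)) (B i * c₂ * σ (A j)) := (Finset.sum_rotate _).symm
    _ = ∑ i, ∑ l, ∑ j, ∑ m,
          E (B l * B m * σ (A i * A l)) (B i * B j * σ (A j * A m)) :=
        Finset.sum_congr rfl fun i _ => Finset.sum_congr rfl fun l _ =>
          hexagon_right hR hAB (fun a c₁ c₂ => E (B l * c₁ * σ (A i * A l)) (B i * c₂ * σ a))
            (by fun_prop) (by fun_prop) (by fun_prop)
    _ = ∑ i, ∑ l, ∑ m, E (B l * B m * σ (A i * A l)) (B i * A m * q) := by
        refine Finset.sum_congr rfl fun i _ => Finset.sum_congr rfl fun l _ => ?_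
        rw [Finset.sum_comm]
        refine Finset.sum_congr rfl fun m _ => ?_
        have e : B i * A m * q = ∑ j, B i * B j * σ (A j * A m) := by
          rw [mul_assoc (B i), ← hqσ', ← mul_assoc, ← hqσ, Finset.sum_mul]
          simp only [hσm, ← mul_assoc]
        rw [e]
        exact (map_sum ((h₂ _).mk' _) _ _).symm
    _ = ∑ i, ∑ l, ∑ m, E (B m * B l * σ (A l * A i)) (A m * B i * q) :=
        yang_baxter hR hAB (fun a b c => E (b * σ a) (c * q)) (by fun_prop) (by fun_prop)
          (by fun_prop)
    _ = ∑ m, ∑ i, ∑ l, E (B m * B l * σ (A l * A i)) (A m * B i * q) := Finset.sum_rotate _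
    _ = _ := by
        refine Finset.sum_congr rfl fun m _ => Finset.sum_congr rfl fun i _ => ?_
        have e : B m * A i * q = ∑ l, B m * B l * σ (A l * A i) := by
          rw [mul_assoc (B m), ← hqσ', ← mul_assoc, ← hqσ, Finset.sum_mul]
          simp only [hσm, ← mul_assoc]
        rw [e]
        exact (map_sum ((h₁ _).mk' _) _ _).symm

end IsUniversalRMatrix
end RMatrix

section BraidedHopf

open Coalgebra HopfAlgebra

variable {k U M : Type*} [Field k] [Ring U] [HopfAlgebra k U] [AddCommGroup M] [Module k M]

@[simp]
theorem tensorAction_tmul {V W : Type*} [AddCommGroup V] [Module k V] [Module U V]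
    [IsScalarTower k U V] [AddCommGroup W] [Module k W] [Module U W] [IsScalarTower k U W]
    (x y : U) (v : V) (w : W) : tensorAction V W (x ⊗ₜ[k] y) (v ⊗ₜ[k] w) = (x • v) ⊗ₜ (y • w) := by
  simp [tensorAction]

namespace IsBraidedHopfAlgebra

variable {R : (U ⊗[k] U)ˣ} {Y : Type*} [Ring Y] [Algebra k Y] [Coalgebra k Y] [Module U Y]
  [IsScalarTower k U Y] {S : Y →ₗ[k] Y} (hY : IsBraidedHopfAlgebra R S)

include hY

theorem act_mul (h : U) (a b : Y) :
    h • (a * b) = sweedler k h fun s t => (s • a) * (t • b) := by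
  rw [hY.smul_mul, comul_eq_sweedler h]
  simp [sweedler, map_sum]

theorem sweedler_act (h : U) (x : Y) (E : Y → Y → M) (h₁ : ∀ b, IsLinearMap k fun a => E a b)
    (h₂ : ∀ a, IsLinearMap k fun b => E a b) :
    sweedler k (h • x) E = sweedler k h fun s t => sweedler k x fun a b => E (s • a) (t • b) := by
  rw [sweedler_eq_bilinearLift _ E h₁ h₂, hY.comul_smul, comul_eq_sweedler h, comul_eq_sweedler x]
  simp only [sweedler, map_sum, LinearMap.sum_apply, tensorAction_tmul, bilinearLift_tmul]
  exact Finset.sum_comm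

theorem sweedler_one (E : Y → Y → M) (h₁ : ∀ b, IsLinearMap k fun a => E a b)
    (h₂ : ∀ a, IsLinearMap k fun b => E a b) : sweedler k (1 : Y) E = E 1 1 := by
  rw [sweedler_eq_bilinearLift _ E h₁ h₂, hY.comul_one, bilinearLift_tmul]

theorem sweedler_antipode_left (x : Y) {f : Y → M} (hf : IsLinearMap k f) :
    (sweedler k x fun a b => f (S a * b)) = counit (R := k) x • f 1 := by
  rw [← hf.map_smul, ← hY.antipode_left, ← apply_sweedler hf, comul_eq_sweedler x]
  simp [sweedler, map_sum]

theorem sweedler_antipode_right (x : Y) {f : Y → M} (hf : IsLinearMap k f) :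
    (sweedler k x fun a b => f (a * S b)) = counit (R := k) x • f 1 := by
  rw [← hf.map_smul, ← hY.antipode_right, ← apply_sweedler hf, comul_eq_sweedler x]
  simp [sweedler, map_sum]

theorem antipode_one : S 1 = 1 := by
  have := hY.sweedler_antipode_left 1 (f := fun x => x) (by fun_prop)
  rwa [hY.sweedler_one _ (by fun_prop) (by fun_prop), mul_one, hY.counit_one, one_smul] at this

theorem counit_antipode (x : Y) : counit (R := k) (S x) = counit (R := k) x := by
  have h := hY.sweedler_antipode_left x (f := fun x => counit (R := k) x) (by fun_prop)
  simp only [hY.counit_mul, hY.counit_one, smul_eq_mul, mul_one] at h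
  rw [← h, ← sweedler_counit_right (k := k) x (f := fun a => counit (R := k) (S a)) (by fun_prop)]
  simp only [smul_eq_mul, mul_comm]

variable (hR : IsUniversalRMatrix R) {I : Type*} [Fintype I] {A B : I → U}
  (hAB : (R : U ⊗[k] U) = ∑ i, A i ⊗ₜ[k] B i)

include hAB

theorem sweedler_mul (x y : Y) (E : Y → Y → M) (h₁ : ∀ b, IsLinearMap k fun a => E a b)
    (h₂ : ∀ a, IsLinearMap k fun b => E a b) :
    sweedler k (x * y) E = ∑ i, sweedler k x fun a b => sweedler k y fun c d =>
      E (a * (B i • c)) ((A i • b) * d) := by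
  rw [sweedler_eq_bilinearLift _ E h₁ h₂, hY.comul_mul, comul_eq_sweedler x, comul_eq_sweedler y]
  simp only [sweedler, tmul_sum, sum_tmul, map_sum, braidedTensorMul, LinearMap.comp_apply,
    LinearEquiv.coe_coe, TensorProduct.assoc_tmul, TensorProduct.assoc_symm_tmul, braiding,
    LinearMap.lTensor_tmul, LinearMap.rTensor_tmul, hAB, LinearMap.sum_apply, tensorAction_tmul,
    TensorProduct.comm_tmul, TensorProduct.map_tmul, LinearMap.mul'_apply, bilinearLift_tmul]
  rw [Finset.sum_comm]
  exact Finset.sum_rotate _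

include hR

theorem sum_left_act_mul (a b : Y) (E : Y → U → M) (h₁ : ∀ b, IsLinearMap k fun a => E a b)
    (h₂ : ∀ a, IsLinearMap k fun b => E a b) :
    ∑ i, E (A i • (a * b)) (B i) = ∑ i, ∑ j, E ((A i • a) * (A j • b)) (B i * B j) := by
  rw [← hR.hexagon_left hAB (fun s t z => E ((s • a) * (t • b)) z) (by fun_prop) (by fun_prop)
    (by fun_prop)]
  refine Finset.sum_congr rfl fun i _ => ?_
  rw [hY.act_mul, apply_sweedler (h₁ _)]

theorem sum_right_act_mul (a b : Y) (E : U → Y → M) (h₁ : ∀ b, IsLinearMap k fun a => E a b)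
    (h₂ : ∀ a, IsLinearMap k fun b => E a b) :
    ∑ i, E (A i) (B i • (a * b)) = ∑ i, ∑ j, E (A i * A j) ((B j • a) * (B i • b)) := by
  rw [← hR.hexagon_right hAB (fun z s t => E z ((s • a) * (t • b))) (by fun_prop) (by fun_prop)
    (by fun_prop)]
  refine Finset.sum_congr rfl fun i _ => ?_
  rw [hY.act_mul, apply_sweedler (h₂ _)]

theorem sum_left_sweedler_act (x : Y) (E : Y → Y → U → M)
    (h₁ : ∀ b c, IsLinearMap k fun a => E a b c) (h₂ : ∀ a c, IsLinearMap k fun b => E a b c)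
    (h₃ : ∀ a b, IsLinearMap k fun c => E a b c) :
    ∑ i, sweedler k (A i • x) (fun a b => E a b (B i)) =
      ∑ i, ∑ j, sweedler k x fun a b => E (A i • a) (A j • b) (B i * B j) := by
  rw [← hR.hexagon_left hAB (fun s t z => sweedler k x fun a b => E (s • a) (t • b) z)
    (by fun_prop) (by fun_prop) (by fun_prop)]
  exact Finset.sum_congr rfl fun i _ => hY.sweedler_act _ _ _ (by fun_prop) (by fun_prop)


omit hR in
theorem sweedler_sweedler_mul_antipode (x y : Y) (E : Y → Y → M)
    (h₁ : ∀ b, IsLinearMap k fun a => E a b) (h₂ : ∀ a, IsLinearMap k fun b => E a b) :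
    (sweedler k y fun y₁ y₂ => sweedler k (x * y₁) fun z₁ z₂ => E z₁ (z₂ * S y₂)) =
      ∑ i, sweedler k x fun x₁ x₂ => E (x₁ * (B i • y)) (A i • x₂) := by
  calc (sweedler k y fun y₁ y₂ => sweedler k (x * y₁) fun z₁ z₂ => E z₁ (z₂ * S y₂))
      = ∑ i, sweedler k y fun y₁ y₂ => sweedler k y₁ fun c d => sweedler k x fun x₁ x₂ =>
          E (x₁ * (B i • c)) ((A i • x₂) * (d * S y₂)) := by
        rw [← sweedler_sum]
        congr! 3 with y₁ y₂
        rw [hY.sweedler_mul hAB _ _ _ (by fun_prop) (by fun_prop)]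
        refine Finset.sum_congr rfl fun i _ => ?_
        rw [sweedler_comm]
        simp only [mul_assoc]
    _ = _ := by
        refine Finset.sum_congr rfl fun i _ => ?_
        rw [sweedler_coassoc y (fun c d y₂ => sweedler k x fun x₁ x₂ =>
          E (x₁ * (B i • c)) ((A i • x₂) * (d * S y₂))) (by fun_prop) (by fun_prop) (by fun_prop),
          ← sweedler_counit_right (k := k) y (f := fun y => sweedler k x fun x₁ x₂ =>
            E (x₁ * (B i • y)) (A i • x₂)) (by fun_prop)]
        congr! 3 with c d
        rw [hY.sweedler_antipode_right d (f := fun z => sweedler k x fun x₁ x₂ =>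
            E (x₁ * (B i • c)) ((A i • x₂) * z)) (by fun_prop)]
        simp only [mul_one]

omit hR in
theorem sweedler_antipode_sweedler_mul (a y : Y) (E : Y → Y → M)
    (h₁ : ∀ b, IsLinearMap k fun a => E a b) (h₂ : ∀ a, IsLinearMap k fun b => E a b) :
    (sweedler k a fun a₁ a₂ => sweedler k (a₂ * y) fun z₁ z₂ => E (S a₁ * z₁) z₂) =
      ∑ i, sweedler k y fun y₁ y₂ => E (B i • y₁) ((A i • a) * y₂) := by
  calc (sweedler k a fun a₁ a₂ => sweedler k (a₂ * y) fun z₁ z₂ => E (S a₁ * z₁) z₂)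
      = ∑ i, sweedler k a fun a₁ a₂ => sweedler k a₂ fun c d => sweedler k y fun y₁ y₂ =>
          E (S a₁ * c * (B i • y₁)) ((A i • d) * y₂) := by
        rw [← sweedler_sum]
        congr! 3 with a₁ a₂
        rw [hY.sweedler_mul hAB _ _ _ (by fun_prop) (by fun_prop)]
        simp only [mul_assoc]
    _ = _ := by
        refine Finset.sum_congr rfl fun i _ => ?_
        rw [← sweedler_coassoc a (fun a₁ c d => sweedler k y fun y₁ y₂ =>
          E (S a₁ * c * (B i • y₁)) ((A i • d) * y₂)) (by fun_prop) (by fun_prop) (by fun_prop),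
          ← sweedler_counit_left (k := k) a (f := fun a => sweedler k y fun y₁ y₂ =>
            E (B i • y₁) ((A i • a) * y₂)) (by fun_prop)]
        congr! 3 with c d
        rw [hY.sweedler_antipode_left c (f := fun z => sweedler k y fun y₁ y₂ =>
            E (z * (B i • y₁)) ((A i • d) * y₂)) (by fun_prop)]
        simp only [one_mul]

omit hR in
theorem sum_sweedler_antipode_mul (x y : Y) :
    (∑ i, sweedler k x fun x₁ x₂ => S (x₁ * (B i • y)) * (A i • x₂)) =
      counit (R := k) x • S y := by
  rw [← hY.sweedler_sweedler_mul_antipode hAB x y (fun p q => S p * q) (by fun_prop) (by fun_prop),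
    ← sweedler_counit_left (k := k) y (f := fun y => counit (R := k) x • S y) (by fun_prop)]
  congr! 3 with y₁ y₂
  simp only [← mul_assoc]
  rw [hY.sweedler_antipode_left (x * y₁) (f := fun z => z * S y₂) (by fun_prop), hY.counit_mul,
    one_mul, mul_smul, smul_comm]

/-- The antipode is braided antimultiplicative. -/
theorem antipode_mul (a b : Y) : S (a * b) = ∑ i, (B i • S b) * (A i • S a) := by
  calc S (a * b)
      = sweedler k a fun a₁ c => sweedler k c fun a₂ a₃ =>
          ∑ i, S (a₁ * (B i • b)) * (A i • (a₂ * S a₃)) := by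
        rw [← sweedler_counit_right (k := k) a (f := fun a => S (a * b)) (by fun_prop)]
        congr! 3 with a₁ c
        rw [hY.sweedler_antipode_right c (f := fun z => ∑ i, S (a₁ * (B i • b)) * (A i • z))
          (by fun_prop)]
        nth_rw 1 [← one_smul U b, ← hR.counit_left hAB]
        simp [hY.smul_one, Finset.sum_smul, Finset.mul_sum, map_sum]
    _ = sweedler k a fun a₁ c => sweedler k c fun a₂ a₃ =>
          ∑ j, ∑ i, S (a₁ * (B i • B j • b)) * (A i • a₂) * (A j • S a₃) := by
        congr! 6 with a₁ c a₂ a₃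
        rw [hY.sum_left_act_mul hR hAB a₂ (S a₃) (fun p u => S (a₁ * (u • b)) * p) (by fun_prop)
          (by fun_prop), Finset.sum_comm]
        simp only [mul_assoc, mul_smul]
    _ = sweedler k a fun c a₃ => sweedler k c fun a₁ a₂ =>
          ∑ j, ∑ i, S (a₁ * (B i • B j • b)) * (A i • a₂) * (A j • S a₃) :=
        (sweedler_coassoc a (fun a₁ a₂ a₃ =>
          ∑ j, ∑ i, S (a₁ * (B i • B j • b)) * (A i • a₂) * (A j • S a₃)) (by fun_prop)
          (by fun_prop) (by fun_prop)).symm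
    _ = sweedler k a fun c a₃ => counit (R := k) c • ∑ j, (B j • S b) * (A j • S a₃) := by
        congr! 3 with c a₃
        rw [sweedler_sum, Finset.smul_sum]
        refine Finset.sum_congr rfl fun j _ => ?_
        rw [← hY.antipode_smul (B j) b, ← smul_mul_assoc, ← hY.sum_sweedler_antipode_mul hAB c (B j • b),
          sweedler_sum, Finset.sum_mul]
        refine Finset.sum_congr rfl fun i _ => ?_
        exact (apply_sweedler (k := k) (f := fun z => z * (A j • S a₃)) (by fun_prop) _ _).symm
    _ = _ := sweedler_counit_left a (f := fun a => ∑ j, (B j • S b) * (A j • S a)) (by fun_prop)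

omit hR in
theorem sweedler_sweedler_antipode_mul (a : Y) (E : Y → Y → M)
    (h₁ : ∀ b, IsLinearMap k fun a => E a b) (h₂ : ∀ a, IsLinearMap k fun b => E a b) :
    (sweedler k a fun a₁ a₂ => sweedler k (S a₁) fun s₁ s₂ =>
      ∑ i, E (s₁ * (B i • a₂)) (A i • s₂)) = E 1 (S a) := by
  calc (sweedler k a fun a₁ a₂ => sweedler k (S a₁) fun s₁ s₂ =>
        ∑ i, E (s₁ * (B i • a₂)) (A i • s₂))
      = sweedler k a fun a₁ a₂ => sweedler k a₂ fun y₁ y₂ => sweedler k (S a₁ * y₁) fun z₁ z₂ =>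
          E z₁ (z₂ * S y₂) := by
        congr! 3 with a₁ a₂
        rw [hY.sweedler_sweedler_mul_antipode hAB _ _ E h₁ h₂, sweedler_sum]
    _ = sweedler k a fun c y₂ => sweedler k c fun a₁ y₁ => sweedler k (S a₁ * y₁) fun z₁ z₂ =>
          E z₁ (z₂ * S y₂) :=
        (sweedler_coassoc a (fun a₁ y₁ y₂ => sweedler k (S a₁ * y₁) fun z₁ z₂ =>
          E z₁ (z₂ * S y₂)) (by fun_prop) (by fun_prop) (by fun_prop)).symm
    _ = sweedler k a fun c y₂ => counit (R := k) c • E 1 (S y₂) := by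
        congr! 3 with c y₂
        rw [hY.sweedler_antipode_left c (f := fun z => sweedler k z fun z₁ z₂ =>
          E z₁ (z₂ * S y₂)) (by fun_prop), hY.sweedler_one _ (by fun_prop) (by fun_prop), one_mul]
    _ = _ := sweedler_counit_left a (f := fun a => E 1 (S a)) (by fun_prop)

/-- The antipode is braided anticomultiplicative. -/
theorem sweedler_antipode (a : Y) (E : Y → Y → M)
    (h₁ : ∀ b, IsLinearMap k fun a => E a b) (h₂ : ∀ a, IsLinearMap k fun b => E a b) :
    sweedler k (S a) E = ∑ i, sweedler k a fun a₁ a₂ => E (B i • S a₂) (A i • S a₁) := by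
  calc sweedler k (S a) E
      = sweedler k a fun a₁ c => sweedler k c fun a₂ a₃ => sweedler k (S a₁) fun s₁ s₂ =>
          ∑ i, E (s₁ * (B i • (a₂ * S a₃))) (A i • s₂) := by
        rw [← sweedler_counit_right (k := k) a (f := fun a => sweedler k (S a) E) (by fun_prop)]
        congr! 3 with a₁ c
        rw [hY.sweedler_antipode_right c (f := fun z => sweedler k (S a₁) fun s₁ s₂ =>
          ∑ i, E (s₁ * (B i • z)) (A i • s₂)) (by fun_prop)]
        congr! 4 with s₁ s₂
        nth_rw 1 [← one_smul U s₂, ← hR.counit_right hAB]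
        simp only [hY.smul_one, Finset.sum_smul, mul_smul_comm, mul_one, smul_assoc]
        rw [show E s₁ (∑ i, counit (R := k) (B i) • A i • s₂) =
          ∑ i, E s₁ (counit (R := k) (B i) • A i • s₂) from map_sum ((h₂ s₁).mk' _) _ _]
        exact Finset.sum_congr rfl fun i _ => by rw [(h₁ _).map_smul, (h₂ _).map_smul]
    _ = sweedler k a fun a₁ c => sweedler k c fun a₂ a₃ => sweedler k (S a₁) fun s₁ s₂ =>
          ∑ i, ∑ j, E (s₁ * (B j • a₂) * (B i • S a₃)) (A i • A j • s₂) := by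
        congr! 9 with a₁ c a₂ a₃ s₁ s₂
        rw [hY.sum_right_act_mul hR hAB a₂ (S a₃) (fun u p => E (s₁ * p) (u • s₂)) (by fun_prop)
          (by fun_prop)]
        simp only [mul_assoc, mul_smul]
    _ = sweedler k a fun c a₃ => sweedler k c fun a₁ a₂ => sweedler k (S a₁) fun s₁ s₂ =>
          ∑ i, ∑ j, E (s₁ * (B j • a₂) * (B i • S a₃)) (A i • A j • s₂) :=
        (sweedler_coassoc a (fun a₁ a₂ a₃ => sweedler k (S a₁) fun s₁ s₂ =>
          ∑ i, ∑ j, E (s₁ * (B j • a₂) * (B i • S a₃)) (A i • A j • s₂)) (by fun_prop)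
          (by fun_prop) (by fun_prop)).symm
    _ = sweedler k a fun c a₃ => ∑ i, E (B i • S a₃) (A i • S c) := by
        congr! 3 with c a₃
        simp only [sweedler_sum]
        refine Finset.sum_congr rfl fun i _ => ?_
        have := hY.sweedler_sweedler_antipode_mul hAB c
          (fun p q => E (p * (B i • S a₃)) (A i • q)) (by fun_prop) (by fun_prop)
        simpa only [sweedler_sum, one_mul] using this
    _ = _ := sweedler_sum _ _ _

end IsBraidedHopfAlgebra
end BraidedHopf

section RMatrixApplied

open Coalgebra HopfAlgebra

variable {k U M : Type*} [Field k] [Ring U] [HopfAlgebra k U] [AddCommGroup M] [Module k M]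

namespace IsUniversalRMatrix

variable {R : (U ⊗[k] U)ˣ} (hR : IsUniversalRMatrix R) {I : Type*} [Fintype I] {A B : I → U}
  (hAB : (R : U ⊗[k] U) = ∑ i, A i ⊗ₜ[k] B i)

include hR hAB

theorem sum_antipode_mul_self (E : U → U → M) (h₁ : ∀ b, IsLinearMap k fun a => E a b)
    (h₂ : ∀ a, IsLinearMap k fun b => E a b) :
    ∑ i, ∑ j, E (antipode k (A i) * A j) (B i * B j) = E 1 1 := by
  simpa [map_sum, Algebra.TensorProduct.one_def] using
    congrArg (bilinearLift E h₁ h₂) (antipode_mul_self hR hAB)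

theorem sum_self_mul_antipode (E : U → U → M) (h₁ : ∀ b, IsLinearMap k fun a => E a b)
    (h₂ : ∀ a, IsLinearMap k fun b => E a b) :
    ∑ i, ∑ j, E (A i * antipode k (A j)) (B i * B j) = E 1 1 := by
  simpa [map_sum, Algebra.TensorProduct.one_def] using
    congrArg (bilinearLift E h₁ h₂) (self_mul_antipode hR hAB)

theorem sum_self_mul_op_antipode (E : U → U → M) (h₁ : ∀ b, IsLinearMap k fun a => E a b)
    (h₂ : ∀ a, IsLinearMap k fun b => E a b) :
    ∑ i, ∑ j, E (A i * A j) (antipode k (B j) * B i) = E 1 1 := by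
  simpa [map_sum, Algebra.TensorProduct.one_def] using
    congrArg (bilinearLift E h₁ h₂) (self_mul_op_antipode hR hAB)

theorem counit_drinfeldInv : counit (R := k) (drinfeldInv k A B) = 1 := by
  have h := congrArg (counit (R := k)) (counit_left hR hAB)
  simp only [map_sum, map_smul, Bialgebra.counit_one, smul_eq_mul] at h
  rw [← h]
  simp [drinfeldInv, map_sum, mul_comm]

end IsUniversalRMatrix
end RMatrixApplied

section BraidedAntipodeSquare

open Coalgebra HopfAlgebra IsUniversalRMatrix

variable {k U M : Type*} [Field k] [Ring U] [HopfAlgebra k U] [AddCommGroup M] [Module k M]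

/-- The map `q ▷ S⁻²(·)`, where `T` is the inverse of the antipode `S`. If `q` is the inverse of
Drinfeld's element, this is the inverse square of the antipode of the bosonization, restricted to
the braided Hopf algebra. -/
noncomputable def twist {Y : Type*} [AddCommGroup Y] [Module k Y] [Module U Y]
    [IsScalarTower k U Y] (q : U) (T : Y →ₗ[k] Y) : Y →ₗ[k] Y :=
  (Algebra.lsmul k k Y q : Y →ₗ[k] Y) ∘ₗ T ∘ₗ T

theorem twist_apply {Y : Type*} [AddCommGroup Y] [Module k Y] [Module U Y]
    [IsScalarTower k U Y] (q : U) (T : Y →ₗ[k] Y) (y : Y) : twist q T y = q • T (T y) := rfl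

namespace IsBraidedHopfAlgebra

variable {R : (U ⊗[k] U)ˣ} {Y : Type*} [Ring Y] [Algebra k Y] [Coalgebra k Y] [Module U Y]
  [IsScalarTower k U Y] {S : Y →ₗ[k] Y} (hY : IsBraidedHopfAlgebra R S)
  (hR : IsUniversalRMatrix R) {I : Type*} [Fintype I] {A B : I → U}
  (hAB : (R : U ⊗[k] U) = ∑ i, A i ⊗ₜ[k] B i)

include hY hR hAB

theorem antipode_antipode_mul (a b : Y) :
    S (S (a * b)) = ∑ i, ∑ j, ((B j * A i) • S (S a)) * ((A j * B i) • S (S b)) := by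
  rw [hY.antipode_mul hR hAB a b, map_sum]
  refine Finset.sum_congr rfl fun i _ => ?_
  rw [hY.antipode_mul hR hAB]
  simp only [hY.antipode_smul, mul_smul]

theorem sweedler_antipode_antipode (a : Y) (E : Y → Y → M)
    (h₁ : ∀ b, IsLinearMap k fun a => E a b) (h₂ : ∀ a, IsLinearMap k fun b => E a b) :
    sweedler k (S (S a)) E = ∑ j, ∑ i, sweedler k a fun a₁ a₂ =>
      E ((B j * A i) • S (S a₁)) ((A j * B i) • S (S a₂)) := by
  rw [hY.sweedler_antipode hR hAB _ E h₁ h₂]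
  refine Finset.sum_congr rfl fun j _ => ?_
  rw [hY.sweedler_antipode hR hAB _ _ (by fun_prop) (by fun_prop)]
  simp only [hY.antipode_smul, mul_smul]

theorem sweedler_mul_left_antipode (y a : Y) (E : Y → Y → M)
    (h₁ : ∀ b, IsLinearMap k fun a => E a b) (h₂ : ∀ a, IsLinearMap k fun b => E a b) :
    (sweedler k y fun y₁ y₂ => E y₁ (a * y₂)) = ∑ i, sweedler k (A i • a) fun b₁ b₂ =>
      sweedler k (b₂ * y) fun z₁ z₂ => E (antipode k (B i) • (S b₁ * z₁)) z₂ := by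
  calc (sweedler k y fun y₁ y₂ => E y₁ (a * y₂))
      = sweedler k y fun y₁ y₂ => E ((1 : U) • y₁) (((1 : U) • a) * y₂) := by simp only [one_smul]
    _ = ∑ i, ∑ j, sweedler k y fun y₁ y₂ =>
          E ((antipode k (B j) * B i) • y₁) (((A i * A j) • a) * y₂) :=
        (hR.sum_self_mul_op_antipode hAB (fun p q => sweedler k y fun y₁ y₂ =>
          E (q • y₁) ((p • a) * y₂)) (by fun_prop) (by fun_prop)).symm
    _ = ∑ j, ∑ i, sweedler k y fun y₁ y₂ =>
          E ((antipode k (B j) * B i) • y₁) (((A i * A j) • a) * y₂) := Finset.sum_comm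
    _ = _ := by
        refine Finset.sum_congr rfl fun j _ => ?_
        rw [hY.sweedler_antipode_sweedler_mul hAB (A j • a) y
          (fun p q => E (antipode k (B j) • p) q) (by fun_prop) (by fun_prop)]
        simp only [mul_smul]

theorem sum_antipode_left_sweedler_act (x : Y) (E : Y → Y → U → M)
    (h₁ : ∀ b c, IsLinearMap k fun a => E a b c) (h₂ : ∀ a c, IsLinearMap k fun b => E a b c)
    (h₃ : ∀ a b, IsLinearMap k fun c => E a b c) :
    ∑ i, sweedler k (antipode k (A i) • x) (fun a b => E a b (B i)) =
      ∑ i, ∑ j, sweedler k x fun a b =>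
        E (antipode k (A j) • a) (antipode k (A i) • b) (B i * B j) := by
  rw [← hR.hexagon_left hAB (fun s t z => sweedler k x fun a b =>
    E (antipode k t • a) (antipode k s • b) z) (by fun_prop) (by fun_prop) (by fun_prop)]
  refine Finset.sum_congr rfl fun i _ => ?_
  rw [hY.sweedler_act _ _ _ (by fun_prop) (by fun_prop),
    _root_.sweedler_antipode _ _ (by fun_prop) (by fun_prop)]

variable {T : Y →ₗ[k] Y} (hST : ∀ x, S (T x) = x) (hTS : ∀ x, T (S x) = x)

include hST hTS

omit hR hAB in
theorem inv_smul (h : U) (x : Y) : T (h • x) = h • T x := by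
  rw [← hTS (h • T x), hY.antipode_smul, hST]

omit hR hAB hTS in
theorem counit_inv (x : Y) : counit (R := k) (T x) = counit (R := k) x := by
  rw [← hY.counit_antipode, hST]

omit hR hAB hST in
theorem inv_one : T 1 = 1 := by
  rw [← hY.antipode_one, hTS, hY.antipode_one]

theorem twist_antipode_antipode_smul (h : U) (x : Y) :
    twist (drinfeldInv k A B) T (antipode k (antipode k h) • x) =
      h • twist (drinfeldInv k A B) T x := by
  simp only [twist_apply, hY.inv_smul hST hTS]
  rw [← mul_smul, hR.drinfeldInv_mul_antipode_antipode hAB, mul_smul]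

theorem counit_twist (x : Y) :
    counit (R := k) (twist (drinfeldInv k A B) T x) = counit (R := k) x := by
  rw [twist_apply, hY.counit_smul, hY.counit_inv hST, hY.counit_inv hST,
    hR.counit_drinfeldInv hAB, one_mul]

theorem twist_one : twist (drinfeldInv k A B) T (1 : Y) = 1 := by
  rw [twist_apply, hY.inv_one hTS, hY.inv_one hTS, hY.smul_one, hR.counit_drinfeldInv hAB, one_smul]

omit hR hAB in
theorem antipode_antipode_twist (q : U) (x : Y) : S (S (twist q T x)) = q • x := by
  rw [twist_apply, hY.antipode_smul, hST, hY.antipode_smul, hST]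

theorem twist_mul (a b : Y) :
    twist (drinfeldInv k A B) T (a * b) =
      twist (drinfeldInv k A B) T a * twist (drinfeldInv k A B) T b := by
  have hinj : Function.Injective fun x => S (S x) := fun x y h => by
    rw [← hTS x, ← hTS y, ← hTS (S x), ← hTS (S y)]
    exact congrArg _ (congrArg _ h)
  apply hinj
  simp only
  rw [hY.antipode_antipode_mul hR hAB]
  simp only [hY.antipode_antipode_twist hST hTS]
  rw [hY.act_mul, hR.sweedler_drinfeldInv hAB _ (by fun_prop) (by fun_prop), Finset.sum_comm]
  simp only [mul_smul]

theorem sweedler_twist (x : Y) (E : Y → Y → M)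
    (h₁ : ∀ b, IsLinearMap k fun a => E a b) (h₂ : ∀ a, IsLinearMap k fun b => E a b) :
    sweedler k (twist (drinfeldInv k A B) T x) E = sweedler k x fun a b =>
      E (twist (drinfeldInv k A B) T a) (twist (drinfeldInv k A B) T b) := by
  set q := drinfeldInv k A B with hq
  let F : Y → Y → M := fun p p' => ∑ j, ∑ l, E (T (T ((antipode k (A j) * B l) • p)))
    (T (T ((B j * antipode k (A l)) • p')))
  have hF₁ (p' : Y) : IsLinearMap k fun p => F p p' := by simp only [F]; fun_prop
  have hF₂ (p : Y) : IsLinearMap k fun p' => F p p' := by simp only [F]; fun_prop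
  have key (a b : Y) : ∑ m, ∑ i, F ((B m * A i) • a) ((A m * B i) • b) =
      E (T (T a)) (T (T b)) := by
    have h1 (i j : I) : ∑ m, ∑ l, E (T (T ((antipode k (A j) * B l) • (B m * A i) • a)))
        (T (T ((B j * antipode k (A l)) • (A m * B i) • b))) =
        E (T (T ((antipode k (A j) * A i) • a))) (T (T ((B j * B i) • b))) := by
      have := hR.sum_antipode_mul_self hAB (fun s t =>
        E (T (T ((antipode k (A j) * t * A i) • a))) (T (T ((B j * s * B i) • b))))
        (by fun_prop) (by fun_prop)
      rw [Finset.sum_comm] at this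
      simpa only [mul_one, ← mul_smul, mul_assoc] using this
    have h2 := hR.sum_antipode_mul_self hAB (fun s t => E (T (T (s • a))) (T (T (t • b))))
      (by fun_prop) (by fun_prop)
    rw [one_smul, one_smul] at h2
    rw [← h2]
    refine Eq.trans ?_
      (Finset.sum_congr rfl fun j _ => Finset.sum_congr rfl fun i _ => h1 i j)
    rw [Finset.sum_comm (s := Finset.univ (α := I)) (t := Finset.univ (α := I)) (f := fun j i =>
      ∑ m, ∑ l, E (T (T ((antipode k (A j) * B l) • (B m * A i) • a)))
        (T (T ((B j * antipode k (A l)) • (A m * B i) • b)))), Finset.sum_comm]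
    exact Finset.sum_congr rfl fun i _ => Finset.sum_comm
  calc sweedler k (twist q T x) E
      = ∑ m, ∑ i, sweedler k (twist q T x) fun a b =>
          F ((B m * A i) • S (S a)) ((A m * B i) • S (S b)) := by
        simp only [← sweedler_sum, key, hTS]
    _ = sweedler k (q • x) F := by
        rw [← hY.sweedler_antipode_antipode hR hAB _ F hF₁ hF₂, hY.antipode_antipode_twist hST hTS]
    _ = ∑ m, ∑ i, sweedler k x fun a b => F ((B m * A i) • q • a) ((A m * B i) • q • b) := by
        rw [hY.sweedler_act _ _ F hF₁ hF₂, hR.sweedler_drinfeldInv hAB _ (by fun_prop)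
          (by fun_prop)]
        simp only [mul_smul, hq]
    _ = _ := by simp only [← sweedler_sum, key, hY.inv_smul hST hTS, twist_apply]

theorem sum_sweedler_mul_inv (z : Y) :
    (∑ i, sweedler k z fun z₁ z₂ => (antipode k (A i) • z₂) * (B i • T z₁)) =
      counit (R := k) z • 1 := by
  apply Function.LeftInverse.injective hTS
  rw [S.map_smul, hY.antipode_one, ← hY.sweedler_antipode_right z (f := fun x => x) (by fun_prop),
    map_sum]
  calc ∑ i, S (sweedler k z fun z₁ z₂ => (antipode k (A i) • z₂) * (B i • T z₁))
      = ∑ i, ∑ j, sweedler k z fun z₁ z₂ =>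
          ((B j * B i) • z₁) * ((A j * antipode k (A i)) • S z₂) := by
        refine Finset.sum_congr rfl fun i _ => ?_
        rw [apply_sweedler S.isLinear, ← sweedler_sum]
        congr! 3 with a b
        rw [hY.antipode_mul hR hAB]
        simp only [hY.antipode_smul, hST, mul_smul]
    _ = _ := by
        rw [Finset.sum_comm, hR.sum_self_mul_antipode hAB (fun s t => sweedler k z fun z₁ z₂ =>
          (t • z₁) * (s • S z₂)) (by fun_prop) (by fun_prop)]
        simp only [one_smul]

theorem sum_sweedler_inv_mul (z : Y) :
    (∑ i, sweedler k z fun z₁ z₂ => (antipode k (A i) • T z₂) * (B i • z₁)) =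
      counit (R := k) z • 1 := by
  apply Function.LeftInverse.injective hTS
  rw [S.map_smul, hY.antipode_one, ← hY.sweedler_antipode_left z (f := fun x => x) (by fun_prop),
    map_sum]
  calc ∑ i, S (sweedler k z fun z₁ z₂ => (antipode k (A i) • T z₂) * (B i • z₁))
      = ∑ i, ∑ j, sweedler k z fun z₁ z₂ =>
          ((B j * B i) • S z₁) * ((A j * antipode k (A i)) • z₂) := by
        refine Finset.sum_congr rfl fun i _ => ?_
        rw [apply_sweedler S.isLinear, ← sweedler_sum]
        congr! 3 with a b
        rw [hY.antipode_mul hR hAB]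
        simp only [hY.antipode_smul, hST, mul_smul]
    _ = _ := by
        rw [Finset.sum_comm, hR.sum_self_mul_antipode hAB (fun s t => sweedler k z fun z₁ z₂ =>
          (t • S z₁) * (s • z₂)) (by fun_prop) (by fun_prop)]
        simp only [one_smul]

end IsBraidedHopfAlgebra
end BraidedAntipodeSquare

section Trace

variable {k Y M ι : Type*} [Field k] [AddCommGroup Y] [Module k Y] [AddCommGroup M] [Module k M]
  [Fintype ι] [DecidableEq ι]

theorem Module.Basis.trace_eq_sum (e : Module.Basis ι k Y) (f : Y →ₗ[k] Y) :
    LinearMap.trace k Y f = ∑ l, e.coord l (f (e l)) := by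
  rw [LinearMap.trace_eq_matrix_trace k e, Matrix.trace]
  simp [LinearMap.toMatrix_apply]

theorem Module.Basis.sum_coord_smul (e : Module.Basis ι k Y) {K : Y → M} (hK : IsLinearMap k K)
    (y : Y) : ∑ l, e.coord l y • K (e l) = K y := by
  conv_rhs => rw [← e.sum_repr y, ← hK.mk'_apply, map_sum]
  simp

theorem Module.Basis.sum_apply_comp (e : Module.Basis ι k Y) (G : Y →ₗ[k] Y) {K : ι → Y → M}
    (hK : ∀ l, IsLinearMap k (K l)) :
    ∑ l, K l (G (e l)) = ∑ m, ∑ l, e.coord m (G (e l)) • K l (e m) := by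
  rw [Finset.sum_comm]
  exact Finset.sum_congr rfl fun l _ => (e.sum_coord_smul (hK l) _).symm

variable [Coalgebra k Y]

theorem Module.Basis.sum_sweedler_coord (e : Module.Basis ι k Y) (x : Y) (E : Y → Y → M)
    (h₁ : ∀ b, IsLinearMap k fun a => E a b) (h₂ : ∀ a, IsLinearMap k fun b => E a b) :
    ∑ j, E (sweedler k x fun a b => e.coord j b • a) (e j) = sweedler k x E := by
  simp only [fun j => apply_sweedler (h₁ (e j)) x (fun a b => e.coord j b • a)]
  rw [← sweedler_sum]
  congr! 3 with a b
  simp only [fun j => (h₁ (e j)).map_smul]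
  exact e.sum_coord_smul (h₂ a) b

/-- The functional `y ↦ Tr(θ(·) y)`. -/
noncomputable def twistedTrace {Y : Type*} [Ring Y] [Algebra k Y] (θ : Y →ₗ[k] Y) : Y →ₗ[k] k :=
  LinearMap.trace k Y ∘ₗ LinearMap.lcomp k Y θ ∘ₗ (LinearMap.mul k Y).flip

theorem twistedTrace_apply {Y : Type*} [Ring Y] [Algebra k Y] (θ : Y →ₗ[k] Y) (y : Y) :
    twistedTrace θ y = LinearMap.trace k Y (LinearMap.mulRight k y ∘ₗ θ) := rfl

theorem twistedTrace_eq_sum {Y : Type*} [Ring Y] [Algebra k Y] (θ : Y →ₗ[k] Y)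
    (e : Module.Basis ι k Y) (y : Y) :
    twistedTrace θ y = ∑ l, e.coord l (θ (e l) * y) := by
  rw [twistedTrace_apply, e.trace_eq_sum]
  rfl

end Trace

section TraceIntegral

open Coalgebra HopfAlgebra IsUniversalRMatrix

variable {k U M : Type*} [Field k] [Ring U] [HopfAlgebra k U] [AddCommGroup M] [Module k M]

namespace IsBraidedHopfAlgebra

variable {R : (U ⊗[k] U)ˣ} {Y : Type*} [Ring Y] [Algebra k Y] [Coalgebra k Y] [Module U Y]
  [IsScalarTower k U Y] {S : Y →ₗ[k] Y} (hY : IsBraidedHopfAlgebra R S)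
  (hR : IsUniversalRMatrix R) {I : Type*} [Fintype I] {A B : I → U}
  (hAB : (R : U ⊗[k] U) = ∑ i, A i ⊗ₜ[k] B i)
  {T : Y →ₗ[k] Y} (hST : ∀ x, S (T x) = x) (hTS : ∀ x, T (S x) = x)

include hY hR hAB hST hTS

theorem sum_sweedler_antipode_twist_mul (z : Y) :
    (∑ i, sweedler k z fun z₁ z₂ =>
      antipode k (B i) • (S (A i • twist (drinfeldInv k A B) T z₂) * z₁)) =
      counit (R := k) z • 1 := by
  have key (z₁ z₂ : Y) : ∑ i, antipode k (B i) • (S (A i • twist (drinfeldInv k A B) T z₂) * z₁) =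
      ∑ i, (antipode k (A i) • T z₂) * (B i • z₁) := by
    set w := twist (drinfeldInv k A B) T z₂ with hw
    have hSw : S w = drinfeldInv k A B • T z₂ := by rw [hw, twist_apply, hY.antipode_smul, hST]
    calc ∑ i, antipode k (B i) • (S (A i • w) * z₁)
        = ∑ i, sweedler k (B i) fun s t =>
            (antipode k t • S (A i • w)) * (antipode k s • z₁) := by
          refine Finset.sum_congr rfl fun i _ => ?_
          rw [hY.act_mul, _root_.sweedler_antipode _ _ (by fun_prop) (by fun_prop)]
      _ = ∑ j, (∑ i, antipode k (B i) • (A i * A j) • S w) * (antipode k (B j) • z₁) := by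
          rw [hR.hexagon_right hAB (fun z s t =>
            (antipode k t • S (z • w)) * (antipode k s • z₁)) (by fun_prop) (by fun_prop)
            (by fun_prop), Finset.sum_comm]
          simp only [Finset.sum_mul, hY.antipode_smul]
      _ = ∑ j, (antipode k (antipode k (A j)) • T z₂) * (antipode k (B j) • z₁) := by
          refine Finset.sum_congr rfl fun j _ => ?_
          congr 1
          have : ∑ i, antipode k (B i) • (A i * A j) • S w =
              (drinfeld k A B * A j * drinfeldInv k A B) • T z₂ := by
            simp only [hSw, drinfeld, Finset.sum_mul, Finset.sum_smul, mul_smul]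
          rw [this, ← hR.antipode_antipode_mul_drinfeld hAB, mul_assoc,
            hR.drinfeld_mul_drinfeldInv hAB, mul_one]
      _ = _ := hR.sum_antipode_antipode hAB (fun s t => (antipode k s • T z₂) * (t • z₁))
          (by fun_prop) (by fun_prop)
  rw [← sweedler_sum, ← hY.sum_sweedler_inv_mul hR hAB hST hTS z, ← sweedler_sum]
  congr! 3 with z₁ z₂
  exact key z₁ z₂

theorem sum_sweedler_sweedler_act_twist (z : Y) (E : Y → Y → M)
    (h₁ : ∀ b, IsLinearMap k fun a => E a b) (h₂ : ∀ a, IsLinearMap k fun b => E a b) :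
    (∑ i, sweedler k z fun z₁ z₂ => sweedler k (A i • twist (drinfeldInv k A B) T z₂) fun w₁ w₂ =>
      E (antipode k (B i) • (S w₁ * z₁)) w₂) = E 1 (twist (drinfeldInv k A B) T z) := by
  set θ := twist (drinfeldInv k A B) T with hθ
  calc (∑ i, sweedler k z fun z₁ z₂ => sweedler k (A i • θ z₂) fun w₁ w₂ =>
        E (antipode k (B i) • (S w₁ * z₁)) w₂)
      = sweedler k z fun z₁ z₂ => ∑ i, sweedler k (A i • θ z₂) fun w₁ w₂ =>
        E (antipode k (B i) • (S w₁ * z₁)) w₂ := (sweedler_sum _ _ _).symm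
    _ = sweedler k z fun z₁ z₂ => sweedler k z₂ fun a b => ∑ i, ∑ j,
          E (antipode k (B j) • antipode k (B i) • (S (A i • θ a) * z₁)) (A j • θ b) := by
        congr! 3 with z₁ z₂
        rw [hY.sum_left_sweedler_act hR hAB (θ z₂) (fun a b c => E (antipode k c • (S a * z₁)) b)
          (by fun_prop) (by fun_prop) (by fun_prop)]
        simp only [sweedler_sum]
        refine Finset.sum_congr rfl fun i _ => Finset.sum_congr rfl fun j _ => ?_
        rw [hY.sweedler_twist hR hAB hST hTS _ _ (by fun_prop) (by fun_prop)]
        simp only [antipode_mul_antidistrib, mul_smul, hθ]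
    _ = sweedler k z fun c b => sweedler k c fun z₁ a => ∑ i, ∑ j,
          E (antipode k (B j) • antipode k (B i) • (S (A i • θ a) * z₁)) (A j • θ b) :=
        (sweedler_coassoc z (fun z₁ a b => ∑ i, ∑ j,
          E (antipode k (B j) • antipode k (B i) • (S (A i • θ a) * z₁)) (A j • θ b))
          (by fun_prop) (by fun_prop) (by fun_prop)).symm
    _ = sweedler k z fun c b => counit (R := k) c • E 1 (θ b) := by
        congr! 3 with c b
        let L : Y →ₗ[k] M := IsLinearMap.mk' (fun p => ∑ j, E (antipode k (B j) • p) (A j • θ b))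
          (by fun_prop)
        have e : L (counit (R := k) c • 1) = sweedler k c fun z₁ a => ∑ i, ∑ j,
            E (antipode k (B j) • antipode k (B i) • (S (A i • θ a) * z₁)) (A j • θ b) := by
          rw [← hY.sum_sweedler_antipode_twist_mul hR hAB hST hTS c, ← sweedler_sum,
            apply_sweedler L.isLinear]
          simp only [map_sum]
          rfl
        rw [← e, map_smul]
        congr 1
        have e (j : I) : E (antipode k (B j) • 1) (A j • θ b) =
            E 1 ((counit (R := k) (B j) • A j) • θ b) := by
          rw [hY.smul_one, HopfAlgebra.counit_antipode, (h₁ _).map_smul, ← (h₂ _).map_smul,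
            smul_assoc]
        simp only [L, IsLinearMap.mk'_apply, e]
        conv_rhs => rw [← one_smul U (θ b), ← hR.counit_right hAB, Finset.sum_smul]
        exact (map_sum ((h₂ 1).mk' _) _ _).symm
    _ = _ := sweedler_counit_left z (f := fun b => E 1 (θ b)) (by fun_prop)

/-- The functional `y ↦ Tr(θ(·) y)` is a left-invariant integral. -/
theorem sweedler_twistedTrace {ι : Type*} [Fintype ι] [DecidableEq ι] (e : Module.Basis ι k Y)
    (y : Y) :
    (sweedler k y fun y₁ y₂ => twistedTrace (twist (drinfeldInv k A B) T) y₂ • y₁) =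
      twistedTrace (twist (drinfeldInv k A B) T) y • (1 : Y) := by
  set θ := twist (drinfeldInv k A B) T with hθ
  simp only [twistedTrace_eq_sum θ e, Finset.sum_smul, sweedler_sum]
  calc ∑ j, (sweedler k y fun y₁ y₂ => e.coord j (θ (e j) * y₂) • y₁)
      = ∑ j, ∑ i, sweedler k (A i • θ (e j)) fun b₁ b₂ => sweedler k (b₂ * y) fun z₁ z₂ =>
          e.coord j z₂ • (antipode k (B i) • (S b₁ * z₁)) :=
        Finset.sum_congr rfl fun j _ => hY.sweedler_mul_left_antipode hR hAB y (θ (e j))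
          (fun p q => e.coord j q • p) (by fun_prop) (by fun_prop)
    _ = ∑ j, ∑ i, sweedler k (A i • θ (e j)) fun b₁ b₂ => ∑ l, e.coord l (b₂ * y) •
          (antipode k (B i) • (S b₁ * sweedler k (e l) fun z₁ z₂ => e.coord j z₂ • z₁)) := by
        congr! 6 with j _ i _ b₁ b₂
        rw [e.sum_coord_smul (K := fun v => antipode k (B i) • (S b₁ * sweedler k v fun z₁ z₂ =>
          e.coord j z₂ • z₁)) (by fun_prop), apply_sweedler (f := fun v =>
          antipode k (B i) • (S b₁ * v)) (by fun_prop) (k := k)]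
        simp only [mul_smul_comm, smul_comm (antipode k (B i)) (_ : k)]
    _ = ∑ l, ∑ i, ∑ j, sweedler k (A i • θ (e j)) fun b₁ b₂ => e.coord l (b₂ * y) •
          (antipode k (B i) • (S b₁ * sweedler k (e l) fun z₁ z₂ => e.coord j z₂ • z₁)) := by
        simp only [sweedler_sum]
        rw [Finset.sum_rotate]
        exact Finset.sum_congr rfl fun l _ => Finset.sum_comm
    _ = ∑ l, ∑ i, sweedler k (e l) fun z₁ z₂ => sweedler k (A i • θ z₂) fun b₁ b₂ =>
          e.coord l (b₂ * y) • (antipode k (B i) • (S b₁ * z₁)) := by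
        refine Finset.sum_congr rfl fun l _ => Finset.sum_congr rfl fun i _ => ?_
        exact e.sum_sweedler_coord (e l) (fun z₁ z₂ => sweedler k (A i • θ z₂) fun b₁ b₂ =>
          e.coord l (b₂ * y) • (antipode k (B i) • (S b₁ * z₁))) (by fun_prop) (by fun_prop)
    _ = _ := Finset.sum_congr rfl fun l _ =>
        hY.sum_sweedler_sweedler_act_twist hR hAB hST hTS (e l)
          (fun p q => e.coord l (q * y) • p) (by fun_prop) (by fun_prop)

omit hAB hST hTS hR in
theorem mul_antipode_smul (g : U) (a y : Y) :
    a * (antipode k g • y) = sweedler k g fun s t => antipode k s • ((t • a) * y) := by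
  symm
  calc (sweedler k g fun s t => antipode k s • ((t • a) * y))
      = sweedler k g fun c t => sweedler k c fun s s' =>
          ((antipode k s' * t) • a) * (antipode k s • y) := by
        congr! 3 with s t
        rw [hY.act_mul, _root_.sweedler_antipode _ _ (by fun_prop) (by fun_prop)]
        simp only [mul_smul]
    _ = sweedler k g fun s c => sweedler k c fun s' t =>
          ((antipode k s' * t) • a) * (antipode k s • y) :=
        sweedler_coassoc g (fun s s' t => ((antipode k s' * t) • a) * (antipode k s • y))
          (by fun_prop) (by fun_prop) (by fun_prop)
    _ = sweedler k g fun s c => counit (R := k) c • (((1 : U) • a) * (antipode k s • y)) := by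
        congr! 3 with s c
        exact _root_.sweedler_antipode_left c (f := fun z => (z • a) * (antipode k s • y))
          (by fun_prop)
    _ = _ := by
        rw [sweedler_counit_right g (f := fun t => ((1 : U) • a) * (antipode k t • y))
          (by fun_prop), one_smul]

/-- The functional `y ↦ Tr(θ(·) y)` is invariant under the action. -/
theorem twistedTrace_smul [FiniteDimensional k Y] (h : U) (y : Y) :
    twistedTrace (twist (drinfeldInv k A B) T) (h • y) =
      counit (R := k) h • twistedTrace (twist (drinfeldInv k A B) T) y := by
  set θ := twist (drinfeldInv k A B) T with hθ
  obtain ⟨g, rfl⟩ := hR.exists_antipode_antipode_eq hAB h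
  let L (u : U) : Y →ₗ[k] Y := Algebra.lsmul k k Y u
  let N (u : U) : Y →ₗ[k] Y := LinearMap.mulRight k y ∘ₗ L u ∘ₗ θ
  have hL (f : U → U) (hf : IsLinearMap k f) : IsLinearMap k fun u => L (f u) := by
    refine ⟨fun a b => ?_, fun c a => ?_⟩
    · simp only [L, hf.map_add, map_add]
    · simp only [L, hf.map_smul, map_smul]
  calc twistedTrace θ (antipode k (antipode k g) • y)
      = sweedler k (antipode k g) fun s t => LinearMap.trace k Y (L (antipode k s) ∘ₗ N t) := by
        rw [twistedTrace_apply]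
        have : LinearMap.mulRight k (antipode k (antipode k g) • y) ∘ₗ θ =
            sweedler k (antipode k g) fun s t => L (antipode k s) ∘ₗ N t := by
          ext a
          rw [show (sweedler k (antipode k g) fun s t => L (antipode k s) ∘ₗ N t) a =
            sweedler k (antipode k g) fun s t => antipode k s • ((t • θ a) * y) by
              simp [sweedler, L, N]]
          exact hY.mul_antipode_smul (antipode k g) (θ a) y
        rw [this, apply_sweedler (LinearMap.isLinear _)]
    _ = sweedler k (antipode k g) fun s t => LinearMap.trace k Y (N t ∘ₗ L (antipode k s)) := by
        congr! 3 with s t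
        exact LinearMap.trace_comp_comm' _ _
    _ = LinearMap.trace k Y (sweedler k g fun s t =>
          N (antipode k s) ∘ₗ L (antipode k (antipode k t))) := by
        rw [apply_sweedler (LinearMap.isLinear _)]
        refine _root_.sweedler_antipode g (fun s t =>
          LinearMap.trace k Y (N t ∘ₗ L (antipode k s))) ?_ ?_
        · intro t
          refine IsLinearMap.coe_apply _ ⟨fun a b => ?_, fun c a => ?_⟩
          · rw [(hL _ (by fun_prop)).map_add, LinearMap.comp_add]
          · rw [(hL _ (by fun_prop)).map_smul, LinearMap.comp_smul]
        · intro t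
          refine IsLinearMap.coe_apply _ ⟨fun a b => ?_, fun c a => ?_⟩
          · simp only [N, (hL _ IsLinearMap.id_fun).map_add, LinearMap.comp_add,
              LinearMap.add_comp]
          · simp only [N, (hL _ IsLinearMap.id_fun).map_smul, LinearMap.comp_smul,
              LinearMap.smul_comp]
    _ = counit (R := k) (antipode k (antipode k g)) • twistedTrace θ y := by
        rw [HopfAlgebra.counit_antipode, HopfAlgebra.counit_antipode, twistedTrace_apply, ← map_smul]
        congr 1
        ext a
        rw [show (sweedler k g fun s t => N (antipode k s) ∘ₗ L (antipode k (antipode k t))) a =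
            sweedler k g fun s t => ((antipode k s * t) • θ a) * y by
              simp [sweedler, N, L, hθ, hY.twist_antipode_antipode_smul hR hAB hST hTS, mul_smul]]
        rw [_root_.sweedler_antipode_left g (f := fun z => (z • θ a) * y) (by fun_prop), one_smul]
        rfl

theorem sum_sweedler_mul_act_twist (x a : Y) :
    (∑ i, sweedler k (antipode k (A i) • x) fun x₁ x₂ =>
      x₂ * (B i • (twist (drinfeldInv k A B) T (S x₁) * a))) = counit (R := k) x • a := by
  set q := drinfeldInv k A B with hq
  set θ := twist q T with hθ
  have hθS (u : U) (x : Y) : θ (u • S x) = (q * u) • T x := by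
    rw [hθ, twist_apply, hY.inv_smul hST hTS, hTS, hY.inv_smul hST hTS, mul_smul]
  have inner (x₁ : Y) : ∑ j, B j • (θ (antipode k (A j) • S x₁) * a) =
      ∑ j, (antipode k (A j) • T x₁) * (B j • a) := by
    calc ∑ j, B j • (θ (antipode k (A j) • S x₁) * a)
        = ∑ j, sweedler k (B j) fun s t =>
            (s • θ (antipode k (A j) • S x₁)) * (t • a) := by
          simp only [hY.act_mul]
      _ = ∑ j, ((∑ l, B l * q * antipode k (A l)) • antipode k (A j) • T x₁) * (B j • a) := by
          rw [hR.hexagon_right hAB (fun z s t => (s • θ (antipode k z • S x₁)) * (t • a))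
            (by fun_prop) (by fun_prop) (by fun_prop)]
          simp only [antipode_mul_antidistrib, hθS]
          simp only [Finset.sum_smul, Finset.sum_mul, mul_smul]
      _ = _ := by rw [hR.sum_mul_drinfeldInv_mul_antipode hAB]; simp only [one_smul]
  have outer (b c d : Y) : ∑ i, (antipode k (A i) • b) * (B i • (c * d)) =
      ∑ i, ∑ l, ((antipode k (A l) • antipode k (A i) • b) * (B l • c)) * (B i • d) := by
    rw [hY.sum_right_act_mul hR hAB c d (fun s p => (antipode k s • b) * p) (by fun_prop)
      (by fun_prop)]
    simp only [antipode_mul_antidistrib, mul_smul, mul_assoc]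
  calc (∑ i, sweedler k (antipode k (A i) • x) fun x₁ x₂ => x₂ * (B i • (θ (S x₁) * a)))
      = ∑ i, ∑ j, sweedler k x fun x₁ x₂ => (antipode k (A i) • x₂) *
          ((B i * B j) • (θ (S (antipode k (A j) • x₁)) * a)) :=
        hY.sum_antipode_left_sweedler_act hR hAB x (fun x₁ x₂ c => x₂ * (c • (θ (S x₁) * a)))
          (by fun_prop) (by fun_prop) (by fun_prop)
    _ = ∑ j, sweedler k x fun x₁ x₂ => ∑ i, (antipode k (A i) • x₂) *
          (B i • ((antipode k (A j) • T x₁) * (B j • a))) := by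
        simp only [sweedler_sum]
        rw [Finset.sum_comm (t := Finset.univ (α := I)) (s := Finset.univ (α := I))
          (f := fun j i => sweedler k x fun x₁ x₂ => (antipode k (A i) • x₂) *
            (B i • ((antipode k (A j) • T x₁) * (B j • a))))]
        refine Finset.sum_congr rfl fun i _ => ?_
        rw [← sweedler_sum, ← sweedler_sum]
        congr! 3 with x₁ x₂
        simp only [← Finset.mul_sum, ← Finset.smul_sum, ← inner, hY.antipode_smul, mul_smul]
    _ = ∑ j, ∑ i, sweedler k x fun x₁ x₂ => (fun a' b c => ∑ l, ((antipode k (A l) • b) *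
          (B l • T a')) * (c • a)) (antipode k (A j) • x₁) (antipode k (A i) • x₂) (B i * B j) := by
        refine Finset.sum_congr rfl fun j _ => ?_
        rw [← sweedler_sum]
        congr! 3 with x₁ x₂
        rw [outer]
        simp only [hY.inv_smul hST hTS, mul_smul]
    _ = ∑ i, sweedler k (antipode k (A i) • x) fun a' b => ∑ l, ((antipode k (A l) • b) *
          (B l • T a')) * (B i • a) := by
        rw [Finset.sum_comm]
        exact (hY.sum_antipode_left_sweedler_act hR hAB x (fun a' b c => ∑ l,
          ((antipode k (A l) • b) * (B l • T a')) * (c • a)) (by fun_prop) (by fun_prop)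
          (by fun_prop)).symm
    _ = ∑ i, (counit (R := k) (antipode k (A i) • x) • 1) * (B i • a) := by
        refine Finset.sum_congr rfl fun i _ => ?_
        rw [← hY.sum_sweedler_mul_inv hR hAB hST hTS, ← sweedler_sum,
          apply_sweedler (f := fun z => z * (B i • a)) (by fun_prop)]
        simp only [Finset.sum_mul]
    _ = _ := by
        simp only [hY.counit_smul, HopfAlgebra.counit_antipode, smul_mul_assoc, one_mul]
        conv_rhs => rw [← one_smul U a, ← hR.counit_left hAB, Finset.sum_smul, Finset.smul_sum]
        refine Finset.sum_congr rfl fun i _ => ?_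
        rw [smul_assoc, smul_smul, mul_comm]

end IsBraidedHopfAlgebra

/-- The element `∑ ⟨eˡ, θ((e_l y)₁)⟩ (e_l y)₂`, where `(e_l)` is a basis and `(eˡ)` its dual. -/
noncomputable def traceElement {Y ι : Type*} [Ring Y] [Algebra k Y] [Coalgebra k Y] [Fintype ι]
    (θ : Y →ₗ[k] Y) (e : Module.Basis ι k Y) (y : Y) : Y :=
  ∑ l, sweedler k (e l * y) fun a b => e.coord l (θ a) • b

namespace IsBraidedHopfAlgebra

variable {R : (U ⊗[k] U)ˣ} {Y : Type*} [Ring Y] [Algebra k Y] [Coalgebra k Y] [Module U Y]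
  [IsScalarTower k U Y] {S : Y →ₗ[k] Y} (hY : IsBraidedHopfAlgebra R S)
  (hR : IsUniversalRMatrix R) {I : Type*} [Fintype I] {A B : I → U}
  (hAB : (R : U ⊗[k] U) = ∑ i, A i ⊗ₜ[k] B i)
  {T : Y →ₗ[k] Y} (hST : ∀ x, S (T x) = x) (hTS : ∀ x, T (S x) = x)
  {ι : Type*} [Fintype ι] [DecidableEq ι] (e : Module.Basis ι k Y)

theorem counit_traceElement {Y : Type*} [Ring Y] [Algebra k Y] [Coalgebra k Y]
    (e : Module.Basis ι k Y) (θ : Y →ₗ[k] Y) (y : Y) :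
    counit (R := k) (traceElement θ e y) = twistedTrace θ y := by
  have : FiniteDimensional k Y := .of_basis e
  rw [twistedTrace_apply, LinearMap.trace_comp_comm', e.trace_eq_sum, traceElement, map_sum]
  refine Finset.sum_congr rfl fun l _ => ?_
  rw [apply_sweedler (LinearMap.isLinear _)]
  simp only [map_smul, smul_eq_mul, mul_comm (e.coord l _)]
  exact sweedler_counit_right (e l * y) (f := fun a => e.coord l (θ a)) (by fun_prop)

include hY hR hAB hST hTS

/-- The trace elements are left integrals. -/
theorem mul_traceElement (x y : Y) :
    x * traceElement (twist (drinfeldInv k A B) T) e y =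
      counit (R := k) x • traceElement (twist (drinfeldInv k A B) T) e y := by
  set θ := twist (drinfeldInv k A B) T with hθ
  have hcyc (b c : Y) (i : I) :
      (∑ l, sweedler k (b * (e l * y)) fun z₁ z₂ => e.coord l (B i • (θ (S c) * θ z₁)) • z₂) =
      ∑ l, sweedler k (e l * y) fun z₁ z₂ => e.coord l (b * (B i • (θ (S c) * θ z₁))) • z₂ := by
    have := e.sum_apply_comp (LinearMap.mulLeft k b) (K := fun l v => sweedler k (v * y) fun z₁ z₂ =>
      e.coord l (B i • (θ (S c) * θ z₁)) • z₂) (fun l => by fun_prop)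
    simp only [LinearMap.mulLeft_apply, mul_assoc] at this
    rw [this]
    refine Finset.sum_congr rfl fun m _ => ?_
    calc _ = ∑ l, sweedler k (e m * y) fun z₁ z₂ =>
          (e.coord l (B i • (θ (S c) * θ z₁)) • e.coord m (b * e l)) • z₂ := by
          refine Finset.sum_congr rfl fun l _ => ?_
          rw [apply_sweedler (k := k) (f := fun v => e.coord m (b * e l) • v) (by fun_prop)]
          simp only [smul_smul, smul_eq_mul, mul_comm]
      _ = _ := by
          rw [← sweedler_sum]
          congr! 3 with z₁ z₂
          rw [← Finset.sum_smul, e.sum_coord_smul (K := fun v => e.coord m (b * v)) (by fun_prop)]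
  calc x * traceElement θ e y
      = ∑ l, sweedler k (e l * y) fun y₁ y₂ => e.coord l (θ y₁) • (x * y₂) := by
        rw [traceElement, Finset.mul_sum]
        refine Finset.sum_congr rfl fun l _ => ?_
        rw [apply_sweedler (f := fun v => x * v) (by fun_prop) (k := k)]
        simp only [mul_smul_comm]
    _ = ∑ l, ∑ i, sweedler k (antipode k (A i) • x) fun b₁ b₂ => sweedler k (b₂ * (e l * y))
          fun z₁ z₂ => e.coord l (B i • (θ (S b₁) * θ z₁)) • z₂ := by
        refine Finset.sum_congr rfl fun l _ => ?_
        rw [hY.sweedler_mul_left_antipode hR hAB (e l * y) x (fun p q => e.coord l (θ p) • q)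
          (by fun_prop) (by fun_prop),
          ← hR.sum_antipode_antipode hAB (fun s t => sweedler k (s • x) fun b₁ b₂ =>
            sweedler k (b₂ * (e l * y)) fun z₁ z₂ =>
              e.coord l (θ (antipode k t • (S b₁ * z₁))) • z₂) (by fun_prop) (by fun_prop)]
        simp only [hθ, hY.twist_antipode_antipode_smul hR hAB hST hTS,
          hY.twist_mul hR hAB hST hTS]
    _ = ∑ i, sweedler k (antipode k (A i) • x) fun b₁ b₂ => ∑ l, sweedler k (e l * y)
          fun z₁ z₂ => e.coord l (b₂ * (B i • (θ (S b₁) * θ z₁))) • z₂ := by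
        rw [Finset.sum_comm]
        refine Finset.sum_congr rfl fun i _ => ?_
        rw [← sweedler_sum]
        simp only [hcyc]
    _ = ∑ l, sweedler k (e l * y) fun z₁ z₂ => e.coord l (∑ i, sweedler k (antipode k (A i) • x)
          fun b₁ b₂ => b₂ * (B i • (θ (S b₁) * θ z₁))) • z₂ := by
        simp only [sweedler_sum]
        rw [Finset.sum_comm]
        refine Finset.sum_congr rfl fun l _ => ?_
        simp only [map_sum, Finset.sum_smul, sweedler_sum]
        refine Finset.sum_congr rfl fun i _ => ?_
        rw [sweedler_comm]
        congr! 3 with z₁ z₂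
        rw [apply_sweedler (k := k) (f := fun v => e.coord l v • z₂) (by fun_prop)]
    _ = _ := by
        simp only [hθ, hY.sum_sweedler_mul_act_twist hR hAB hST hTS, map_smul]
        rw [traceElement, Finset.smul_sum]
        refine Finset.sum_congr rfl fun l _ => ?_
        rw [apply_sweedler (k := k) (f := fun v => counit (R := k) x • v) (by fun_prop)]
        simp only [smul_smul, smul_eq_mul]

end IsBraidedHopfAlgebra
end TraceIntegral

section DualPairing

open Coalgebra HopfAlgebra IsUniversalRMatrix

variable {k U M : Type*} [Field k] [Ring U] [HopfAlgebra k U] [AddCommGroup M] [Module k M]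

theorem antipodeInvSq_of_inverse {V : Type*} [AddCommGroup V] [Module k V] {S T : V →ₗ[k] V}
    (hST : ∀ x, S (T x) = x) (hTS : ∀ x, T (S x) = x) : antipodeInvSq S = T ∘ₗ T := by
  let u : (Module.End k V)ˣ := ⟨S, T, LinearMap.ext hST, LinearMap.ext hTS⟩
  have : Ring.inverse (S : Module.End k V) = T := Ring.inverse_unit u
  rw [antipodeInvSq, this]

theorem antipodeInvSq_of_not_isUnit {V : Type*} [AddCommGroup V] [Module k V] {S : V →ₗ[k] V}
    (h : ¬ IsUnit (S : Module.End k V)) : antipodeInvSq S = 0 := by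
  rw [antipodeInvSq, Ring.inverse_non_unit _ h, LinearMap.zero_comp]

theorem IsUniversalRMatrix.exists_eq_sum (R : U ⊗[k] U) :
    ∃ (n : ℕ) (A B : Fin n → U), R = ∑ i, A i ⊗ₜ[k] B i := by
  obtain ⟨s, hs⟩ := TensorProduct.exists_finset R
  refine ⟨s.card, fun i => (s.equivFin.symm i).1.1, fun i => (s.equivFin.symm i).1.2, ?_⟩
  rw [hs, ← Finset.sum_coe_sort s]
  exact (Equiv.sum_comp s.equivFin.symm
    (fun i : s => (i : U × U).1 ⊗ₜ[k] (i : U × U).2)).symm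

namespace IsBraidedDualPairing

variable {X D : Type*}
    [Ring X] [Algebra k X] [Coalgebra k X] [Module U X] [IsScalarTower k U X]
    [Ring D] [Algebra k D] [Coalgebra k D] [Module U D] [IsScalarTower k U D]
    {p : D →ₗ[k] X →ₗ[k] k} (hp : IsBraidedDualPairing U p)

include hp

theorem apply_mul_left (σ τ : D) (x : X) :
    p (σ * τ) x = sweedler k x fun x₁ x₂ => p τ x₁ * p σ x₂ := by
  rw [hp.mul_left, comul_eq_sweedler x]
  simp [sweedler, map_sum]

theorem apply_mul_right (σ : D) (x y : X) :
    p σ (x * y) = sweedler k σ fun σ₁ σ₂ => p σ₁ y * p σ₂ x := by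
  rw [hp.mul_right, comul_eq_sweedler σ]
  simp [sweedler, map_sum]

theorem smul_left (h : U) (σ : D) (x : X) : p (h • σ) x = p σ (antipode k h • x) := by
  have inv (h : U) (σ : D) (x : X) :
      (sweedler k h fun s t => p (s • σ) (t • x)) = counit (R := k) h • p σ x := by
    rw [smul_eq_mul, ← hp.invariant, comul_eq_sweedler h]
    simp [sweedler, map_sum]
  calc p (h • σ) x = sweedler k h fun s c => counit (R := k) c • p (s • σ) ((1 : U) • x) := by
        rw [sweedler_counit_right h (f := fun s => p (s • σ) ((1 : U) • x)) (by fun_prop), one_smul]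
    _ = sweedler k h fun s c => sweedler k c fun t t' => p (s • σ) ((t * antipode k t') • x) := by
        congr! 3 with s c
        exact (_root_.sweedler_antipode_right c (f := fun z => p (s • σ) (z • x))
          (by fun_prop)).symm
    _ = sweedler k h fun c t' => sweedler k c fun s t => p (s • σ) ((t * antipode k t') • x) :=
        (sweedler_coassoc h (fun s t t' => p (s • σ) ((t * antipode k t') • x)) (by fun_prop)
          (by fun_prop) (by fun_prop)).symm
    _ = sweedler k h fun c t' => counit (R := k) c • p σ (antipode k t' • x) := by
        simp only [mul_smul, inv]
    _ = _ := sweedler_counit_left h (f := fun t => p σ (antipode k t • x)) (by fun_prop)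

theorem antipode_left {R : (U ⊗[k] U)ˣ} {SX : X →ₗ[k] X} (hX : IsBraidedHopfAlgebra R SX)
    {SD : D →ₗ[k] D} (hD : IsBraidedHopfAlgebra R SD) (σ : D) (x : X) :
    p (SD σ) x = p σ (SX x) := by
  have left (σ : D) (x : X) : (sweedler k σ fun σ₁ σ₂ => sweedler k x fun x₁ x₂ =>
      p (SD σ₂) x₁ * p σ₁ x₂) = counit (R := k) σ * counit (R := k) x := by
    simp only [← hp.apply_mul_left]
    rw [hD.sweedler_antipode_right σ (f := fun σ => p σ x) (by fun_prop), hp.one_left, smul_eq_mul]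
  have right (σ : D) (x : X) : (sweedler k σ fun σ₁ σ₂ => sweedler k x fun x₁ x₂ =>
      p σ₁ (SX x₂) * p σ₂ x₁) = counit (R := k) x * counit (R := k) σ := by
    rw [sweedler_comm]
    simp only [← hp.apply_mul_right]
    rw [hX.sweedler_antipode_right x (f := fun x => p σ x) (by fun_prop), hp.one_right, smul_eq_mul]
  calc p (SD σ) x
      = sweedler k σ fun b σ₃ => sweedler k x fun x₁ c =>
          (counit (R := k) c * counit (R := k) b) * p (SD σ₃) x₁ := by
        simp only [mul_assoc]
        rw [← sweedler_counit_left (k := k) σ (f := fun σ => p (SD σ) x) (by fun_prop)]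
        congr! 3 with b σ₃
        exact (sweedler_counit_right (k := k) x (f := fun x => counit (R := k) b * p (SD σ₃) x)
          (by fun_prop)).symm
    _ = sweedler k σ fun b σ₃ => sweedler k x fun x₁ c => sweedler k b fun σ₁ σ₂ =>
          sweedler k c fun x₂ x₃ => p σ₁ (SX x₃) * (p σ₂ x₂ * p (SD σ₃) x₁) := by
        congr! 6 with b σ₃ x₁ c
        rw [← right, apply_sweedler (k := k) (f := fun z => z * p (SD σ₃) x₁) (by fun_prop)]
        congr! 3 with σ₁ σ₂
        rw [apply_sweedler (k := k) (f := fun z => z * p (SD σ₃) x₁) (by fun_prop)]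
        simp only [mul_assoc]
    _ = sweedler k σ fun b σ₃ => sweedler k b fun σ₁ σ₂ => sweedler k x fun x₁ c =>
          sweedler k c fun x₂ x₃ => p σ₁ (SX x₃) * (p σ₂ x₂ * p (SD σ₃) x₁) := by
        congr! 3 with b σ₃
        rw [sweedler_comm]
    _ = sweedler k σ fun b σ₃ => sweedler k b fun σ₁ σ₂ => sweedler k x fun c x₃ =>
          sweedler k c fun x₁ x₂ => p σ₁ (SX x₃) * (p σ₂ x₂ * p (SD σ₃) x₁) := by
        congr! 6 with b σ₃ σ₁ σ₂
        exact (sweedler_coassoc x (fun x₁ x₂ x₃ => p σ₁ (SX x₃) * (p σ₂ x₂ * p (SD σ₃) x₁))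
          (by fun_prop) (by fun_prop) (by fun_prop)).symm
    _ = sweedler k σ fun σ₁ b => sweedler k b fun σ₂ σ₃ => sweedler k x fun c x₃ =>
          sweedler k c fun x₁ x₂ => p σ₁ (SX x₃) * (p σ₂ x₂ * p (SD σ₃) x₁) :=
        sweedler_coassoc σ (fun σ₁ σ₂ σ₃ => sweedler k x fun c x₃ =>
          sweedler k c fun x₁ x₂ => p σ₁ (SX x₃) * (p σ₂ x₂ * p (SD σ₃) x₁))
          (by fun_prop) (by fun_prop) (by fun_prop)
    _ = sweedler k σ fun σ₁ b => sweedler k x fun c x₃ =>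
          (counit (R := k) b * counit (R := k) c) * p σ₁ (SX x₃) := by
        congr! 3 with σ₁ b
        rw [sweedler_comm]
        congr! 3 with c x₃
        rw [← left, apply_sweedler (k := k) (f := fun z => z * p σ₁ (SX x₃)) (by fun_prop)]
        congr! 3 with σ₁ σ₂
        rw [apply_sweedler (k := k) (f := fun z => z * p _ (SX x₃)) (by fun_prop)]
        congr! 3 with x₁ x₂
        ring
    _ = _ := by
        simp only [mul_assoc]
        rw [← sweedler_counit_right (k := k) σ (f := fun σ => p σ (SX x)) (by fun_prop)]
        congr! 3 with σ₁ b
        rw [← sweedler_counit_left (k := k) x (f := fun x => counit (R := k) b • p σ₁ (SX x))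
          (by fun_prop)]
        congr! 3 with c x₃
        simp only [smul_eq_mul]
        ring

theorem inv_left {R : (U ⊗[k] U)ˣ} {SX TX : X →ₗ[k] X} (hX : IsBraidedHopfAlgebra R SX)
    {SD TD : D →ₗ[k] D} (hD : IsBraidedHopfAlgebra R SD) (hSTX : ∀ x, SX (TX x) = x)
    (hSTD : ∀ x, SD (TD x) = x) (σ : D) (x : X) : p (TD σ) x = p σ (TX x) := by
  rw [← hSTX x, ← hp.antipode_left hX hD, hSTD, hSTX]

variable {R : (U ⊗[k] U)ˣ} (hR : IsUniversalRMatrix R) {I : Type*} [Fintype I] {A B : I → U}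
  (hAB : (R : U ⊗[k] U) = ∑ i, A i ⊗ₜ[k] B i)

include hR hAB

theorem sum_antipode_smul_smul (σ : D) (x : X) :
    ∑ i, p (antipode k (A i) • σ) (B i • x) = p (drinfeldInv k A B • σ) x := by
  rw [← hR.sum_antipode_antipode hAB (fun s t => p (antipode k s • σ) (t • x)) (by fun_prop)
    (by fun_prop)]
  simp only [← hp.smul_left, ← mul_smul, drinfeldInv, Finset.sum_smul, map_sum, LinearMap.sum_apply]

variable {SX : X →ₗ[k] X} (hX : IsBraidedHopfAlgebra R SX)
  {SD : D →ₗ[k] D} (hD : IsBraidedHopfAlgebra R SD)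
  {ι : Type*} [Fintype ι] [DecidableEq ι] {φ : Module.Basis ι k X} {ε : Module.Basis ι k D}
  (hdual : ∀ i j, p (ε i) (φ j) = if i = j then 1 else 0)

omit hR hAB hp in
include hdual in
theorem apply_basis_left (i : ι) (x : X) : p (ε i) x = φ.coord i x := by
  have : p (ε i) = φ.coord i := φ.ext fun j => by
    simp [hdual, Finsupp.single_apply, eq_comm]
  rw [this]

omit hR hAB hp in
include hdual in
theorem apply_basis_right (i : ι) (σ : D) : p σ (φ i) = ε.coord i σ := by
  have : p.flip (φ i) = ε.coord i := ε.ext fun j => by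
    simp [hdual, Finsupp.single_apply]
  rw [← this, LinearMap.flip_apply]

omit hp in
theorem _root_.braidingInv_sum_tmul :
    braidingInv R D X (∑ i, φ i ⊗ₜ[k] ε i) =
      ∑ j, ∑ i, (antipode k (A j) • ε i) ⊗ₜ[k] (B j • φ i) := by
  simp only [braidingInv, LinearMap.comp_apply, hR.inv_eq hAB, map_sum, LinearMap.sum_apply,
    LinearEquiv.coe_coe, TensorProduct.comm_tmul, tensorAction_tmul]
  exact Finset.sum_comm

include hX hD hdual

variable {TX : X →ₗ[k] X} (hSTX : ∀ x, SX (TX x) = x) (hTSX : ∀ x, TX (SX x) = x)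
  {TD : D →ₗ[k] D} (hSTD : ∀ x, SD (TD x) = x) (hTSD : ∀ x, TD (SD x) = x)

include hSTX hTSX hSTD hTSD

theorem braidedTrace_apply (ξ : X) :
    braidedTrace R p (∑ i, φ i ⊗ₜ[k] ε i) SD ξ = twistedTrace (twist (drinfeldInv k A B) TX) ξ := by
  have : FiniteDimensional k X := .of_basis φ
  have e1 (i : ι) (j : I) : p (TD (TD (antipode k (A j) • ε i))) ((B j • φ i) * ξ) =
      φ.coord i (antipode k (antipode k (A j)) • TX (TX ((B j • φ i) * ξ))) := by
    rw [hp.inv_left hX hD hSTX hSTD, hp.inv_left hX hD hSTX hSTD, hp.smul_left,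
      apply_basis_left hdual]
  let L (u : U) : X →ₗ[k] X := Algebra.lsmul k k X u
  calc braidedTrace R p (∑ i, φ i ⊗ₜ[k] ε i) SD ξ
      = ∑ j, ∑ i, p (TD (TD (antipode k (A j) • ε i))) ((B j • φ i) * ξ) := by
        simp only [braidedTrace, LinearMap.comp_apply, TensorProduct.mk_apply,
          braidingInv_sum_tmul hR hAB, antipodeInvSq_of_inverse hSTD hTSD]
        simp [sum_tmul, map_sum]
    _ = ∑ j, LinearMap.trace k X
          ((L (antipode k (antipode k (A j))) ∘ₗ TX ∘ₗ TX ∘ₗ LinearMap.mulRight k ξ) ∘ₗ L (B j)) := by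
        refine Finset.sum_congr rfl fun j _ => ?_
        rw [φ.trace_eq_sum]
        exact Finset.sum_congr rfl fun i _ => e1 i j
    _ = LinearMap.trace k X (∑ j, L (B j) ∘ₗ
          (L (antipode k (antipode k (A j))) ∘ₗ TX ∘ₗ TX ∘ₗ LinearMap.mulRight k ξ)) := by
        rw [map_sum]
        exact Finset.sum_congr rfl fun j _ => LinearMap.trace_comp_comm' _ _
    _ = _ := by
        rw [twistedTrace_apply, LinearMap.trace_comp_comm']
        congr 1
        ext a
        simp [L, twist_apply, drinfeldInv, Finset.sum_smul, mul_smul]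

theorem braidedTraceDual_apply (σ : D) :
    braidedTraceDual R p (∑ i, φ i ⊗ₜ[k] ε i) SX σ =
      twistedTrace (twist (drinfeldInv k A B) TD) σ := by
  have : FiniteDimensional k D := .of_basis ε
  calc braidedTraceDual R p (∑ i, φ i ⊗ₜ[k] ε i) SX σ
      = ∑ i, ∑ j, p (antipode k (A j) • (ε i * σ)) (TX (TX (B j • φ i))) := by
        simp only [braidedTraceDual, LinearMap.comp_apply, TensorProduct.mk_apply,
          antipodeInvSq_of_inverse hSTX hTSX, map_sum, LinearEquiv.coe_coe,
          TensorProduct.assoc_tmul, LinearMap.lTensor_tmul, LinearMap.mul'_apply, braidingInv,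
          hR.inv_eq hAB, TensorProduct.comm_tmul, LinearMap.sum_apply, tensorAction_tmul,
          TensorProduct.lift.tmul]
    _ = ∑ i, ε.coord i (twist (drinfeldInv k A B) TD (ε i * σ)) := by
        refine Finset.sum_congr rfl fun i _ => ?_
        simp only [hX.inv_smul hSTX hTSX]
        rw [hp.sum_antipode_smul_smul hR hAB, ← hp.inv_left hX hD hSTX hSTD,
          ← hp.inv_left hX hD hSTX hSTD, hD.inv_smul hSTD hTSD, hD.inv_smul hSTD hTSD,
          apply_basis_right hdual, twist_apply]
    _ = _ := by
        rw [twistedTrace_apply, LinearMap.trace_comp_comm', ε.trace_eq_sum]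
        rfl

theorem braidedLoop_apply (σ : D) (ξ : X) :
    braidedLoop R p (∑ i, φ i ⊗ₜ[k] ε i) SD σ ξ =
      p σ (traceElement (twist (drinfeldInv k A B) TX) φ ξ) := by
  have e1 (i : ι) (j : I) : p (σ * TD (TD (antipode k (A j) • ε i))) ((B j • φ i) * ξ) =
      sweedler k ((B j • φ i) * ξ) fun y₁ y₂ =>
        φ.coord i (antipode k (antipode k (A j)) • TX (TX y₁)) • p σ y₂ := by
    rw [hp.apply_mul_left]
    congr! 3 with y₁ y₂
    rw [hp.inv_left hX hD hSTX hSTD, hp.inv_left hX hD hSTX hSTD, hp.smul_left,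
      apply_basis_left hdual, smul_eq_mul]
  let L (u : U) : X →ₗ[k] X := Algebra.lsmul k k X u
  calc braidedLoop R p (∑ i, φ i ⊗ₜ[k] ε i) SD σ ξ
      = ∑ j, ∑ i, p (σ * TD (TD (antipode k (A j) • ε i))) ((B j • φ i) * ξ) := by
        simp only [braidedLoop, braidingInv_sum_tmul hR hAB, antipodeInvSq_of_inverse hSTD hTSD]
        simp [map_sum]
    _ = ∑ j, ∑ i, sweedler k (L (B j) (φ i) * ξ) fun y₁ y₂ =>
        φ.coord i (antipode k (antipode k (A j)) • TX (TX y₁)) • p σ y₂ :=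
        Finset.sum_congr rfl fun j _ => Finset.sum_congr rfl fun i _ => e1 i j
    _ = ∑ j, ∑ m, sweedler k (φ m * ξ) fun y₁ y₂ =>
        φ.coord m (B j • antipode k (antipode k (A j)) • TX (TX y₁)) • p σ y₂ := by
        refine Finset.sum_congr rfl fun j _ => ?_
        rw [φ.sum_apply_comp (L (B j)) (K := fun l v => sweedler k (v * ξ) fun y₁ y₂ =>
          φ.coord l (antipode k (antipode k (A j)) • TX (TX y₁)) • p σ y₂) (fun l => by fun_prop)]
        refine Finset.sum_congr rfl fun m _ => ?_
        have e2 (c : k) (z : X) (E : X → X → k) :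
            c • sweedler k z E = sweedler k z fun a b => c • E a b :=
          apply_sweedler (f := fun v : k => c • v) (by fun_prop) z E
        simp only [e2]
        rw [← sweedler_sum]
        congr! 3 with y₁ y₂
        simp only [smul_smul, mul_comm (φ.coord m (L _ _))]
        rw [← Finset.sum_smul]
        congr 1
        refine (φ.sum_coord_smul (K := fun v => φ.coord m (L (B j) v)) (by fun_prop) _).trans ?_
        simp [L, mul_smul]
    _ = _ := by
        rw [Finset.sum_comm, traceElement, map_sum]
        refine Finset.sum_congr rfl fun m _ => ?_
        rw [apply_sweedler (p σ).isLinear, ← sweedler_sum]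
        congr! 3 with y₁ y₂
        rw [map_smul, ← Finset.sum_smul, ← map_sum, twist_apply]
        simp only [drinfeldInv, Finset.sum_smul, mul_smul]

theorem braidedTrace_one_eq :
    braidedTrace R p (∑ i, φ i ⊗ₜ[k] ε i) SD 1 = braidedTraceDual R p (∑ i, φ i ⊗ₜ[k] ε i) SX 1 := by
  simp only [braidedTrace, LinearMap.comp_apply, TensorProduct.mk_apply, braidedTraceDual,
          antipodeInvSq_of_inverse hSTX hTSX, antipodeInvSq_of_inverse hSTD hTSD, map_sum,
          LinearEquiv.coe_coe, TensorProduct.map_tmul,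
          TensorProduct.assoc_tmul, LinearMap.lTensor_tmul, LinearMap.mul'_apply, braidingInv,
          hR.inv_eq hAB, TensorProduct.comm_tmul, LinearMap.sum_apply, tensorAction_tmul,
          TensorProduct.lift.tmul, mul_one, hp.inv_left hX hD hSTX hSTD]

theorem braidedTraceDual_mul_braidedTrace (σ : D) (ξ : X) :
    braidedTraceDual R p (∑ i, φ i ⊗ₜ[k] ε i) SX σ * braidedTrace R p (∑ i, φ i ⊗ₜ[k] ε i) SD ξ =
      braidedTrace R p (∑ i, φ i ⊗ₜ[k] ε i) SD 1 *
        braidedLoop R p (∑ i, φ i ⊗ₜ[k] ε i) SD σ ξ := by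
  rw [hp.braidedTrace_one_eq hR hAB hX hD hdual hSTX hTSX hSTD hTSD,
    hp.braidedLoop_apply hR hAB hX hD hdual hSTX hTSX hSTD hTSD,
    hp.braidedTrace_apply hR hAB hX hD hdual hSTX hTSX hSTD hTSD]
  simp only [hp.braidedTraceDual_apply hR hAB hX hD hdual hSTX hTSX hSTD hTSD]
  set θ := twist (drinfeldInv k A B) TX
  set t := twistedTrace (twist (drinfeldInv k A B) TD) with ht
  set P : X := ∑ j, t (ε j) • φ j with hP
  have hPσ (σ : D) : p σ P = t σ := by
    simp only [hP, map_sum, map_smul, apply_basis_right hdual, smul_eq_mul, mul_comm (t _)]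
    exact ε.sum_coord_smul t.isLinear σ
  have hinj (x y : X) (h : ∀ σ, p σ x = p σ y) : x = y :=
    φ.ext_elem fun i => by
      simpa [apply_basis_left hdual] using h (ε i)
  have hPy (y : X) : P * y = counit (R := k) y • P := by
    refine hinj _ _ fun σ => ?_
    have h := congrArg (fun σ => p σ y)
      (hD.sweedler_twistedTrace hR hAB hSTD hTSD ε σ)
    simp only [map_smul, LinearMap.smul_apply, hp.one_left, smul_eq_mul] at h
    rw [hp.apply_mul_right, map_smul, hPσ, smul_eq_mul, mul_comm, ← h,
      apply_sweedler (k := k) (f := fun σ => p σ y) (by fun_prop)]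
    simp only [hPσ, map_smul, LinearMap.smul_apply, smul_eq_mul, ht, mul_comm]
  have h := hX.mul_traceElement hR hAB hSTX hTSX φ P ξ
  rw [hPy, IsBraidedHopfAlgebra.counit_traceElement] at h
  have h' := congrArg (p σ) h
  rw [map_smul, map_smul, hPσ, ← hp.one_left, hPσ] at h'
  simpa only [smul_eq_mul, mul_comm] using h'

theorem isInvariantIntegral_braidedTrace :
    IsInvariantIntegral (braidedTrace R p (∑ i, φ i ⊗ₜ[k] ε i) SD) := by
  intro ξ
  rw [hp.braidedTrace_apply hR hAB hX hD hdual hSTX hTSX hSTD hTSD,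
    ← hX.sweedler_twistedTrace hR hAB hSTX hTSX φ ξ, comul_eq_sweedler ξ]
  simp [sweedler, hp.braidedTrace_apply hR hAB hX hD hdual hSTX hTSX hSTD hTSD]

end IsBraidedDualPairing
end DualPairing

section MinimalTensor

variable {k V W : Type*} [Field k] [AddCommGroup V] [Module k V] [AddCommGroup W] [Module k W]

theorem TensorProduct.exists_shorter_of_not_linearIndependent {n : ℕ} {A : Fin n → V} {B : Fin n → W}
    (h : ¬ LinearIndependent k A) : ∃ (m : ℕ) (A' : Fin m → V) (B' : Fin m → W), m < n ∧
      ∑ i, A i ⊗ₜ[k] B i = ∑ i, A' i ⊗ₜ[k] B' i := by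
  obtain ⟨g, hg, i, hi⟩ := Fintype.not_linearIndependent_iff.1 h
  obtain ⟨m, rfl⟩ : ∃ m, n = m + 1 := ⟨n - 1, by have := i.2; omega⟩
  refine ⟨m, fun j => A (i.succAbove j), fun j => B (i.succAbove j) -
    ((g i)⁻¹ * g (i.succAbove j)) • B i, m.lt_succ_self, ?_⟩
  have h0 : ∑ j, A j ⊗ₜ[k] (B j - ((g i)⁻¹ * g j) • B i) = ∑ j, A j ⊗ₜ[k] B j := by
    have : ∑ j, A j ⊗ₜ[k] (((g i)⁻¹ * g j) • B i) = 0 := by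
      calc _ = (∑ j, g j • A j) ⊗ₜ[k] ((g i)⁻¹ • B i) := by
            rw [sum_tmul]
            refine Finset.sum_congr rfl fun j _ => ?_
            rw [smul_tmul, smul_smul, mul_comm]
        _ = 0 := by rw [hg, zero_tmul]
    simp only [tmul_sub, Finset.sum_sub_distrib, this, sub_zero]
  rw [← h0, Fin.sum_univ_succAbove _ i]
  simp [hi]

/-- Every tensor can be written with linearly independent legs. -/
theorem TensorProduct.exists_linearIndependent_eq_sum (x : V ⊗[k] W) :
    ∃ (n : ℕ) (A : Fin n → V) (B : Fin n → W), x = ∑ i, A i ⊗ₜ[k] B i ∧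
      LinearIndependent k A ∧ LinearIndependent k B := by
  classical
  have hex : ∃ (n : ℕ) (A : Fin n → V) (B : Fin n → W), x = ∑ i, A i ⊗ₜ[k] B i := by
    obtain ⟨s, hs⟩ := TensorProduct.exists_finset x
    refine ⟨s.card, fun i => (s.equivFin.symm i).1.1, fun i => (s.equivFin.symm i).1.2, ?_⟩
    rw [hs, ← Finset.sum_coe_sort s]
    exact (Equiv.sum_comp s.equivFin.symm
      (fun i : s => (i : V × W).1 ⊗ₜ[k] (i : V × W).2)).symm
  obtain ⟨A, B, hAB⟩ := Nat.find_spec hex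
  refine ⟨Nat.find hex, A, B, hAB, ?_, ?_⟩
  · by_contra h
    obtain ⟨m, A', B', hm, h'⟩ := exists_shorter_of_not_linearIndependent (B := B) h
    exact Nat.find_min hex hm ⟨A', B', hAB.trans h'⟩
  · by_contra h
    obtain ⟨m, B', A', hm, h'⟩ := exists_shorter_of_not_linearIndependent (B := A) h
    refine Nat.find_min hex hm ⟨A', B', hAB.trans ?_⟩
    simpa [map_sum] using congrArg (TensorProduct.comm k W V) h'

theorem LinearIndependent.exists_dual {I : Type*} {v : I → V} (hv : LinearIndependent k v)
    (i : I) : ∃ f : V →ₗ[k] k, f (v i) = 1 ∧ ∀ j, j ≠ i → f (v j) = 0 := by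
  classical
  obtain ⟨f, hf⟩ := LinearMap.exists_extend ((Finsupp.lapply i : (I →₀ k) →ₗ[k] k) ∘ₗ hv.repr)
  have (j : I) : f (v j) = (Finsupp.single j (1 : k)) i := by
    rw [← hv.repr_eq_single j ⟨v j, Submodule.subset_span ⟨j, rfl⟩⟩ rfl]
    exact LinearMap.congr_fun hf ⟨v j, Submodule.subset_span ⟨j, rfl⟩⟩
  refine ⟨f, by simp [this], fun j hj => by simp [this, hj]⟩

end MinimalTensor

section GroupLikeFiniteOrder

variable {k C : Type*} [Field k] [AddCommGroup C] [Module k C] [Coalgebra k C]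

/-- A sequence of group-like elements in a finite-dimensional space has a repetition. -/
theorem exists_ne_eq_of_isGroupLikeElem {W : Submodule k C} [FiniteDimensional k W] {f : ℕ → C}
    (hf : ∀ n, IsGroupLikeElem k (f n)) (hW : ∀ n, f n ∈ W) : ∃ m n, m < n ∧ f m = f n := by
  by_contra! h
  have hinj : Function.Injective f := fun m n hmn => by
    rcases lt_trichotomy m n with hlt | rfl | hlt
    · exact absurd hmn (h m n hlt)
    · rfl
    · exact absurd hmn.symm (h n m hlt)
  have hli : LinearIndependent k f :=
    (linearIndepOn_isGroupLikeElem (R := k) (A := C)).linearIndependent.comp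
      (fun n => (⟨f n, hf n⟩ : {a : C | IsGroupLikeElem k a}))
      fun m n hmn => hinj (congrArg Subtype.val hmn)
  have : LinearIndependent k fun n => (⟨f n, hW n⟩ : W) := .of_comp W.subtype hli
  exact Set.infinite_univ (Set.finite_univ_iff.2 this.finite)

end GroupLikeFiniteOrder

section RMatrixGroupLike

open Coalgebra HopfAlgebra

variable {k U M : Type*} [Field k] [Ring U] [HopfAlgebra k U] [AddCommGroup M] [Module k M]

namespace IsUniversalRMatrix

variable {R : (U ⊗[k] U)ˣ} (hR : IsUniversalRMatrix R) {I : Type*} [Fintype I] {A B : I → U}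
  (hAB : (R : U ⊗[k] U) = ∑ i, A i ⊗ₜ[k] B i)

/-- The group-like element `S(u)⁻¹ u`, where `u` is Drinfeld's element. -/
noncomputable def drinfeldGroupLike (k : Type*) {U I : Type*} [Field k] [Ring U] [HopfAlgebra k U]
    [Fintype I] (A B : I → U) : U :=
  antipode k (drinfeldInv k A B) * drinfeld k A B

include hR hAB

theorem comul_drinfeldInv : comul (R := k) (drinfeldInv k A B) =
    TensorProduct.comm k U U (R : U ⊗[k] U) * (R : U ⊗[k] U) * (drinfeldInv k A B ⊗ₜ[k] drinfeldInv k A B) := by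
  rw [comul_eq_sweedler, sweedler_drinfeldInv hR hAB _ (by fun_prop) (by fun_prop), hAB]
  simp only [map_sum, TensorProduct.comm_tmul, Finset.sum_mul_sum]
  simp only [Finset.sum_mul, Algebra.TensorProduct.tmul_mul_tmul]

theorem drinfeldInv_tmul_mul_comm :
    (drinfeldInv k A B ⊗ₜ[k] drinfeldInv k A B) * (R : U ⊗[k] U) =
    (R : U ⊗[k] U) * (drinfeldInv k A B ⊗ₜ[k] drinfeldInv k A B) := by
  rw [hAB, Finset.mul_sum, Finset.sum_mul]
  simp only [Algebra.TensorProduct.tmul_mul_tmul]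
  rw [← sum_antipode_antipode hR hAB (fun s t => (drinfeldInv k A B * s) ⊗ₜ[k] (drinfeldInv k A B * t))
    (by fun_prop) (by fun_prop), ← sum_antipode_antipode hR hAB (fun s t =>
      (drinfeldInv k A B * antipode k s) ⊗ₜ[k] (drinfeldInv k A B * antipode k t))
    (by fun_prop) (by fun_prop)]
  simp only [drinfeldInv_mul_antipode_antipode hR hAB]

theorem comul_drinfeldInv' : comul (R := k) (drinfeldInv k A B) =
    (drinfeldInv k A B ⊗ₜ[k] drinfeldInv k A B) * (TensorProduct.comm k U U (R : U ⊗[k] U) * (R : U ⊗[k] U)) := by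
  have h := congrArg (Algebra.TensorProduct.comm k U U) (drinfeldInv_tmul_mul_comm hR hAB)
  rw [map_mul, map_mul] at h
  change _ * (TensorProduct.comm k U U R) = (TensorProduct.comm k U U R) * _ at h
  rw [Algebra.TensorProduct.comm_tmul] at h
  rw [comul_drinfeldInv hR hAB, mul_assoc, ← drinfeldInv_tmul_mul_comm hR hAB, ← mul_assoc, ← h,
    mul_assoc]

theorem comul_antipode_drinfeldInv : comul (R := k) (antipode k (drinfeldInv k A B)) =
    (antipode k (drinfeldInv k A B) ⊗ₜ[k] antipode k (drinfeldInv k A B)) *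
      (TensorProduct.comm k U U (R : U ⊗[k] U) * (R : U ⊗[k] U)) := by
  have hcomm : TensorProduct.comm k U U R = ∑ i, antipode k (B i) ⊗ₜ[k] antipode k (A i) := by
    rw [sum_antipode_antipode hR hAB (fun a b => b ⊗ₜ[k] a) (by fun_prop) (by fun_prop), hAB]
    simp [map_sum]
  have hR' : (R : U ⊗[k] U) = ∑ i, antipode k (A i) ⊗ₜ[k] antipode k (B i) := by
    rw [sum_antipode_antipode hR hAB (fun a b => a ⊗ₜ[k] b) (by fun_prop) (by fun_prop), hAB]
  rw [hcomm, hR', comul_antipode, sweedler_drinfeldInv hR hAB (fun a b =>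
    antipode k b ⊗ₜ[k] antipode k a) (by fun_prop) (by fun_prop), Finset.sum_comm]
  simp only [Finset.sum_mul_sum]
  simp [Finset.mul_sum, antipode_mul_antidistrib, mul_assoc]

theorem drinfeldGroupLike_mul_drinfeldInv :
    drinfeldGroupLike k A B * drinfeldInv k A B = antipode k (drinfeldInv k A B) := by
  rw [drinfeldGroupLike, mul_assoc, drinfeld_mul_drinfeldInv hR hAB, mul_one]

theorem isGroupLikeElem_drinfeldGroupLike : IsGroupLikeElem k (drinfeldGroupLike k A B) where
  counit_eq_one := by
    have h := congrArg (counit (R := k)) (drinfeldGroupLike_mul_drinfeldInv hR hAB)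
    rwa [Bialgebra.counit_mul, HopfAlgebra.counit_antipode, counit_drinfeldInv hR hAB,
      mul_one] at h
  comul_eq_tmul_self := by
    set w := drinfeldGroupLike k A B
    have h := congrArg (comul (R := k)) (drinfeldGroupLike_mul_drinfeldInv hR hAB)
    have hinv : comul (R := k) (drinfeldInv k A B) * comul (R := k) (drinfeld k A B) = 1 := by
      rw [← Bialgebra.comul_mul, drinfeldInv_mul_drinfeld hR hAB, Bialgebra.comul_one]
    have h' : (w ⊗ₜ[k] w) * comul (R := k) (drinfeldInv k A B) =
        comul (R := k) w * comul (R := k) (drinfeldInv k A B) := by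
      rw [← Bialgebra.comul_mul, drinfeldGroupLike_mul_drinfeldInv hR hAB,
        comul_antipode_drinfeldInv hR hAB, comul_drinfeldInv' hR hAB, ← mul_assoc,
        Algebra.TensorProduct.tmul_mul_tmul, drinfeldGroupLike_mul_drinfeldInv hR hAB]
    have := congrArg (· * comul (R := k) (drinfeld k A B)) h'
    simpa only [mul_assoc, hinv, mul_one] using this.symm

theorem antipode_injective : Function.Injective (antipode k : U →ₗ[k] U) := by
  rw [injective_iff_map_eq_zero]
  intro x hx
  have h := antipode_antipode_mul_drinfeld hR hAB x
  rw [hx, map_zero, zero_mul] at h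
  rw [← one_mul x, ← drinfeldInv_mul_drinfeld hR hAB, mul_assoc, ← h, mul_zero]

variable (hA : LinearIndependent k A) (hB : LinearIndependent k B)

omit hR hAB in
theorem sum_dual_smul {V : Type*} [AddCommGroup V] [Module k V] {A : I → V}
    {f : V →ₗ[k] k} {i : I} (h₁ : f (A i) = 1) (h₀ : ∀ j, j ≠ i → f (A j) = 0) (v : I → M) :
    ∑ j, f (A j) • v j = v i := by
  rw [Finset.sum_eq_single i (fun j _ hj => by rw [h₀ j hj, zero_smul]) (by simp), h₁, one_smul]

omit hR hAB in
theorem _root_.sweedler_mem {C : Type*} [AddCommGroup C] [Module k C] [Coalgebra k C]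
    {W : Submodule k M} (x : C) {E : C → C → M} (h : ∀ a b, E a b ∈ W) : sweedler k x E ∈ W :=
  Submodule.sum_mem _ fun _ _ => h _ _

include hA in
theorem span_right_mul_le :
    Submodule.span k (Set.range B) * Submodule.span k (Set.range B) ≤
      Submodule.span k (Set.range B) := by
  rw [Submodule.span_mul_span, Submodule.span_le]
  rintro _ ⟨_, ⟨i, rfl⟩, _, ⟨j, rfl⟩, rfl⟩
  obtain ⟨f, hf₁, hf₀⟩ := hA.exists_dual i
  obtain ⟨g, hg₁, hg₀⟩ := hA.exists_dual j
  have h := hexagon_left hR hAB (fun s t z => f s • g t • z) (by fun_prop) (by fun_prop)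
    (by fun_prop)
  simp only [fun a b => smul_comm (f (A a)) (g (A b)) (B a * B b)] at h
  rw [Finset.sum_comm] at h
  simp only [← Finset.smul_sum, sum_dual_smul hf₁ hf₀ fun a => B a * B _] at h
  rw [sum_dual_smul hg₁ hg₀ fun b => B i * B b] at h
  change B i * B j ∈ _
  rw [← h]
  refine Submodule.sum_mem _ fun l _ => sweedler_mem _ fun s t => ?_
  exact Submodule.smul_mem _ _ (Submodule.smul_mem _ _ (Submodule.subset_span ⟨l, rfl⟩))

include hB in
theorem span_left_mul_le :
    Submodule.span k (Set.range A) * Submodule.span k (Set.range A) ≤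
      Submodule.span k (Set.range A) := by
  rw [Submodule.span_mul_span, Submodule.span_le]
  rintro _ ⟨_, ⟨i, rfl⟩, _, ⟨j, rfl⟩, rfl⟩
  obtain ⟨f, hf₁, hf₀⟩ := hB.exists_dual i
  obtain ⟨g, hg₁, hg₀⟩ := hB.exists_dual j
  have h := hexagon_right hR hAB (fun z s t => g s • f t • z) (by fun_prop) (by fun_prop)
    (by fun_prop)
  simp only [fun a => sum_dual_smul hg₁ hg₀ fun b => f (B a) • (A a * A b)] at h
  rw [sum_dual_smul hf₁ hf₀ fun a => A a * A j] at h
  change A i * A j ∈ _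
  rw [← h]
  refine Submodule.sum_mem _ fun l _ => sweedler_mem _ fun s t => ?_
  exact Submodule.smul_mem _ _ (Submodule.smul_mem _ _ (Submodule.subset_span ⟨l, rfl⟩))

omit hR hAB in
theorem _root_.Submodule.map_mem_of_le_map {V : Type*} [AddCommGroup V] [Module k V]
    {W : Submodule k V} [FiniteDimensional k W] {f : V →ₗ[k] V} (h : W ≤ W.map f) {x : V}
    (hx : x ∈ W) : f x ∈ W := by
  have : W = W.map f := Submodule.eq_of_le_of_finrank_le h (Submodule.finrank_map_le f W)
  rw [this]
  exact Submodule.mem_map_of_mem hx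

include hB in
theorem antipode_left_mem {x : U} (hx : x ∈ Submodule.span k (Set.range A)) :
    antipode k x ∈ Submodule.span k (Set.range A) := by
  have : FiniteDimensional k (Submodule.span k (Set.range A)) :=
    FiniteDimensional.span_of_finite k (Set.finite_range A)
  refine Submodule.map_mem_of_le_map (f := antipode k) (Submodule.span_le.2 ?_) hx
  rintro _ ⟨i, rfl⟩
  obtain ⟨f, hf₁, hf₀⟩ := hB.exists_dual i
  have h := sum_antipode_antipode hR hAB (fun s t => f t • s) (by fun_prop) (by fun_prop)
  rw [sum_dual_smul hf₁ hf₀] at h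
  rw [← h]
  exact Submodule.sum_mem _ fun j _ => Submodule.smul_mem _ _
    (Submodule.mem_map_of_mem (Submodule.subset_span ⟨j, rfl⟩))

include hA in
theorem antipode_right_mem {x : U} (hx : x ∈ Submodule.span k (Set.range B)) :
    antipode k x ∈ Submodule.span k (Set.range B) := by
  have : FiniteDimensional k (Submodule.span k (Set.range B)) :=
    FiniteDimensional.span_of_finite k (Set.finite_range B)
  refine Submodule.map_mem_of_le_map (f := antipode k) (Submodule.span_le.2 ?_) hx
  rintro _ ⟨i, rfl⟩
  obtain ⟨f, hf₁, hf₀⟩ := hA.exists_dual i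
  have h := sum_antipode_antipode hR hAB (fun s t => f s • t) (by fun_prop) (by fun_prop)
  rw [sum_dual_smul hf₁ hf₀] at h
  rw [← h]
  exact Submodule.sum_mem _ fun j _ => Submodule.smul_mem _ _
    (Submodule.mem_map_of_mem (Submodule.subset_span ⟨j, rfl⟩))

include hA hB in
theorem span_left_mul_span_right_le :
    Submodule.span k (Set.range A) * Submodule.span k (Set.range B) ≤
      Submodule.span k (Set.range B) * Submodule.span k (Set.range A) := by
  rw [Submodule.span_mul_span, Submodule.span_le]
  rintro _ ⟨_, ⟨m, rfl⟩, _, ⟨i, rfl⟩, rfl⟩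
  obtain ⟨r01, hr01⟩ : ∃ r : (U ⊗[k] U) ⊗[k] U, r = ∑ i, (A i ⊗ₜ[k] B i) ⊗ₜ[k] (1 : U) := ⟨_, rfl⟩
  obtain ⟨r02, hr02⟩ : ∃ r : (U ⊗[k] U) ⊗[k] U, r = ∑ i, (A i ⊗ₜ[k] (1 : U)) ⊗ₜ[k] B i := ⟨_, rfl⟩
  obtain ⟨r21, hr21⟩ : ∃ r : (U ⊗[k] U) ⊗[k] U, r = ∑ i, ((1 : U) ⊗ₜ[k] B i) ⊗ₜ[k] A i := ⟨_, rfl⟩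
  obtain ⟨s01, hs01⟩ : ∃ r : (U ⊗[k] U) ⊗[k] U, r = ∑ i, (antipode k (A i) ⊗ₜ[k] B i) ⊗ₜ[k] (1 : U) := ⟨_, rfl⟩
  obtain ⟨s02, hs02⟩ : ∃ r : (U ⊗[k] U) ⊗[k] U, r = ∑ i, (antipode k (A i) ⊗ₜ[k] (1 : U)) ⊗ₜ[k] B i := ⟨_, rfl⟩
  have hyb : r02 * r01 * r21 = r21 * r01 * r02 := by
    have h := yang_baxter hR hAB (fun a b c => (a ⊗ₜ[k] b) ⊗ₜ[k] c) (by fun_prop) (by fun_prop)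
      (by fun_prop)
    simp only [hr02, hr01, hr21, Finset.sum_mul, Finset.mul_sum,
      Algebra.TensorProduct.tmul_mul_tmul, one_mul, mul_one]
    exact ((Finset.sum_rotate _).trans (Finset.sum_congr rfl fun _ _ => Finset.sum_comm)).trans h
  have h1 : s01 * r01 = 1 := by
    have h := sum_antipode_mul_self hR hAB (fun a b => (a ⊗ₜ[k] b) ⊗ₜ[k] (1 : U)) (by fun_prop)
      (by fun_prop)
    simpa [hs01, hr01, Finset.sum_mul_sum, Algebra.TensorProduct.one_def] using h
  have h2 : r01 * s01 = 1 := by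
    have h := sum_self_mul_antipode hR hAB (fun a b => (a ⊗ₜ[k] b) ⊗ₜ[k] (1 : U)) (by fun_prop)
      (by fun_prop)
    simpa [hs01, hr01, Finset.sum_mul_sum, Algebra.TensorProduct.one_def] using h
  have h3 : s02 * r02 = 1 := by
    have h := sum_antipode_mul_self hR hAB (fun a b => (a ⊗ₜ[k] (1 : U)) ⊗ₜ[k] b) (by fun_prop)
      (by fun_prop)
    simpa [hs02, hr02, Finset.sum_mul_sum, Algebra.TensorProduct.one_def] using h
  have h4 : r02 * s02 = 1 := by
    have h := sum_self_mul_antipode hR hAB (fun a b => (a ⊗ₜ[k] (1 : U)) ⊗ₜ[k] b) (by fun_prop)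
      (by fun_prop)
    simpa [hs02, hr02, Finset.sum_mul_sum, Algebra.TensorProduct.one_def] using h
  have key : r21 * s02 = s01 * s02 * r21 * r01 := by
    calc r21 * s02 = s01 * (s02 * r02) * (r01 * r21) * s02 := by
          rw [h3, mul_one, ← mul_assoc s01, h1, one_mul]
      _ = s01 * s02 * (r02 * r01 * r21) * s02 := by simp only [mul_assoc]
      _ = s01 * s02 * r21 * r01 * (r02 * s02) := by rw [hyb]; simp only [mul_assoc]
      _ = _ := by rw [h4, mul_one]
  obtain ⟨f, hf₁, hf₀⟩ := (hA.map' (antipode k) (LinearMap.ker_eq_bot.2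
    (antipode_injective hR hAB))).exists_dual i
  obtain ⟨g, hg₁, hg₀⟩ := hB.exists_dual m
  have h := congrArg (trilinearLift (fun a b c => f a • g b • c) (by fun_prop) (by fun_prop)
    (by fun_prop)) key
  simp only [hr21, hs02, hs01, hr01, Finset.sum_mul, Finset.mul_sum, map_sum,
    Algebra.TensorProduct.tmul_mul_tmul, trilinearLift_tmul, one_mul, mul_one] at h
  simp only [← Finset.smul_sum] at h
  simp only [sum_dual_smul hg₁ hg₀ fun a => A a * B _] at h
  have h' : ∑ x, f (antipode k (A x)) • (A m * B x) = A m * B i :=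
    sum_dual_smul (A := antipode k ∘ A) hf₁ hf₀ fun a => A m * B a
  rw [h'] at h
  change A m * B i ∈ _
  rw [h]
  refine Submodule.sum_mem _ fun a _ => Submodule.sum_mem _ fun b _ => Submodule.sum_mem _
    fun c _ => Submodule.sum_mem _ fun d _ => Submodule.smul_mem _ _ (Submodule.smul_mem _ _ ?_)
  exact Submodule.mul_mem_mul (Submodule.subset_span ⟨c, rfl⟩) (Submodule.subset_span ⟨b, rfl⟩)

omit hA hB in
theorem exists_drinfeldGroupLike_pow_eq_one :
    ∃ n, 0 < n ∧ drinfeldGroupLike k A B ^ n = 1 := by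
  obtain ⟨m, A', B', hAB', hA, hB⟩ := TensorProduct.exists_linearIndependent_eq_sum (R : U ⊗[k] U)
  have hw : drinfeldGroupLike k A B = drinfeldGroupLike k A' B' := by
    have hu : drinfeld k A B = drinfeld k A' B' := by
      have h := congrArg (bilinearLift (fun a b => antipode k b * a) (by fun_prop)
        (by fun_prop)) (hAB.symm.trans hAB')
      simpa [map_sum, drinfeld] using h
    have hq : drinfeldInv k A B = drinfeldInv k A' B' := by
      have h := congrArg (bilinearLift (fun a b => b * antipode k (antipode k a)) (by fun_prop)
        (by fun_prop)) (hAB.symm.trans hAB')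
      simpa [map_sum, drinfeldInv] using h
    rw [drinfeldGroupLike, drinfeldGroupLike, hu, hq]
  rw [hw]
  set w := drinfeldGroupLike k A' B' with hwdef
  set VA := Submodule.span k (Set.range A') with hVA
  set VB := Submodule.span k (Set.range B') with hVB
  have : FiniteDimensional k VA := FiniteDimensional.span_of_finite k (Set.finite_range A')
  have : FiniteDimensional k VB := FiniteDimensional.span_of_finite k (Set.finite_range B')
  have hAmem (i) : A' i ∈ VA := Submodule.subset_span ⟨i, rfl⟩
  have hBmem (i) : B' i ∈ VB := Submodule.subset_span ⟨i, rfl⟩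
  have hSA {x} (hx : x ∈ VA) : antipode k x ∈ VA := antipode_left_mem hR hAB' hB hx
  have hSB {x} (hx : x ∈ VB) : antipode k x ∈ VB := antipode_right_mem hR hAB' hA hx
  have hle : VA * VB ≤ VB * VA := span_left_mul_span_right_le hR hAB' hA hB
  have hmul {x y} (hx : x ∈ VB * VA) (hy : y ∈ VB * VA) : x * y ∈ VB * VA := by
    have h1 : (VB * VA) * (VB * VA) ≤ VB * VA :=
      calc (VB * VA) * (VB * VA) = VB * (VA * VB) * VA := by simp only [mul_assoc]
        _ ≤ VB * (VB * VA) * VA :=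
            mul_le_mul' (mul_le_mul' le_rfl hle) le_rfl
        _ = (VB * VB) * (VA * VA) := by simp only [mul_assoc]
        _ ≤ VB * VA := mul_le_mul' (span_right_mul_le hR hAB' hA)
            (span_left_mul_le hR hAB' hB)
    exact h1 (Submodule.mul_mem_mul hx hy)
  have hwmem : w ∈ VB * VA := by
    refine hmul ?_ ?_
    · rw [drinfeldInv, map_sum]
      refine Submodule.sum_mem _ fun i _ => ?_
      rw [antipode_mul_antidistrib]
      exact hle (Submodule.mul_mem_mul (hSA (hSA (hSA (hAmem i)))) (hSB (hBmem i)))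
    · exact Submodule.sum_mem _ fun i _ => Submodule.mul_mem_mul (hSB (hBmem i)) (hAmem i)
  have hpow (n : ℕ) : w ^ (n + 1) ∈ VB * VA := by
    induction n with
    | zero => simpa using hwmem
    | succ n ih => rw [pow_succ]; exact hmul ih hwmem
  have hgl := isGroupLikeElem_drinfeldGroupLike hR hAB'
  have : FiniteDimensional k ↥(VB * VA) := Module.Finite.iff_fg.2
    (Submodule.FG.mul (Module.Finite.iff_fg.1 inferInstance) (Module.Finite.iff_fg.1 inferInstance))
  obtain ⟨a, b, hab, h⟩ := exists_ne_eq_of_isGroupLikeElem (fun n => hgl.pow (n := n + 1)) hpow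
  refine ⟨b - a, by omega, (hgl.isUnit.pow (a + 1)).mul_left_cancel ?_⟩
  rw [← pow_add, mul_one, show a + 1 + (b - a) = b + 1 by omega, ← h]

end IsUniversalRMatrix
end RMatrixGroupLike

section TraceIntegralUniqueness

open Coalgebra HopfAlgebra IsUniversalRMatrix

variable {k U M : Type*} [Field k] [Ring U] [HopfAlgebra k U] [AddCommGroup M] [Module k M]

theorem IsGroupLikeElem.sweedler_eq {C : Type*} [AddCommGroup C] [Module k C] [Coalgebra k C]
    {g : C} (hg : IsGroupLikeElem k g) (E : C → C → M) (h₁ : ∀ b, IsLinearMap k fun a => E a b)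
    (h₂ : ∀ a, IsLinearMap k fun b => E a b) : sweedler k g E = E g g := by
  rw [sweedler_eq_bilinearLift g E h₁ h₂, hg.comul_eq_tmul_self, bilinearLift_tmul]

theorem IsUniversalRMatrix.antipode_antipode_drinfeld {R : (U ⊗[k] U)ˣ}
    (hR : IsUniversalRMatrix R) {I : Type*} [Fintype I] {A B : I → U}
    (hAB : (R : U ⊗[k] U) = ∑ i, A i ⊗ₜ[k] B i) :
    antipode k (antipode k (drinfeld k A B)) = drinfeld k A B := by
  have h := congrArg (· * drinfeldInv k A B)
    (hR.antipode_antipode_mul_drinfeld hAB (drinfeld k A B))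
  simpa only [mul_assoc, hR.drinfeld_mul_drinfeldInv hAB, mul_one] using h

namespace IsBraidedHopfAlgebra

variable {R : (U ⊗[k] U)ˣ} {Y : Type*} [Ring Y] [Algebra k Y] [Coalgebra k Y] [Module U Y]
  [IsScalarTower k U Y] {S : Y →ₗ[k] Y} (hY : IsBraidedHopfAlgebra R S)
  (hR : IsUniversalRMatrix R) {I : Type*} [Fintype I] {A B : I → U}
  (hAB : (R : U ⊗[k] U) = ∑ i, A i ⊗ₜ[k] B i)

section InvariantGroupLike

include hY

theorem smul_mul_of_invariant {g : Y} (hg : ∀ h : U, h • g = counit (R := k) h • g) (h : U)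
    (x : Y) : h • (x * g) = (h • x) * g := by
  rw [hY.act_mul]
  simp only [hg, mul_smul_comm]
  exact sweedler_counit_right h (f := fun s => (s • x) * g) (by fun_prop)

include hR hAB

theorem sweedler_mul_isGroupLikeElem {g : Y} (hg : ∀ h : U, h • g = counit (R := k) h • g)
    (hg' : IsGroupLikeElem k g) (x : Y) (E : Y → Y → M) (h₁ : ∀ b, IsLinearMap k fun a => E a b)
    (h₂ : ∀ a, IsLinearMap k fun b => E a b) :
    sweedler k (x * g) E = sweedler k x fun a b => E (a * g) (b * g) := by
  rw [hY.sweedler_mul hAB x g E h₁ h₂]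
  simp only [fun i a b => hg'.sweedler_eq (fun c d => E (a * (B i • c)) ((A i • b) * d))
    (by fun_prop) (by fun_prop), hg, mul_smul_comm]
  rw [← sweedler_sum]
  congr! 3 with a b
  simp only [fun i => (h₁ ((A i • b) * g)).map_smul]
  conv_rhs => rw [← one_smul U b, ← hR.counit_right hAB, Finset.sum_smul, Finset.sum_mul]
  simp only [smul_assoc, smul_mul_assoc]
  exact ((map_sum ((h₂ (a * g)).mk' _) _ _).trans
    (Finset.sum_congr rfl fun i _ => (h₂ _).map_smul _ _)).symm

theorem exists_pow_eq_one_of_isGroupLikeElem [FiniteDimensional k Y] {g g' : Y}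
    (hg : ∀ h : U, h • g = counit (R := k) h • g) (hg' : IsGroupLikeElem k g) (h1 : g' * g = 1) :
    ∃ n, 0 < n ∧ g ^ n = 1 := by
  have hpow (n : ℕ) : IsGroupLikeElem k (g ^ n) := by
    induction n with
    | zero => exact ⟨by simp [hY.counit_one], by simp [hY.comul_one]⟩
    | succ n ih =>
      refine ⟨by rw [pow_succ, hY.counit_mul, ih.counit_eq_one, hg'.counit_eq_one, one_mul], ?_⟩
      rw [pow_succ, comul_eq_sweedler, hY.sweedler_mul_isGroupLikeElem hR hAB hg hg' _ _
        (by fun_prop) (by fun_prop), ih.sweedler_eq _ (by fun_prop) (by fun_prop)]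
  obtain ⟨a, b, hab, h⟩ := exists_ne_eq_of_isGroupLikeElem (W := ⊤) hpow fun _ => trivial
  refine ⟨b - a, by omega, ?_⟩
  have hg1 (n : ℕ) : g' ^ n * g ^ n = 1 := by
    induction n with
    | zero => simp
    | succ n ih => rw [pow_succ, pow_succ', mul_assoc, ← mul_assoc g', h1, one_mul, ih]
  calc g ^ (b - a) = g' ^ a * (g ^ a * g ^ (b - a)) := by rw [← mul_assoc, hg1, one_mul]
    _ = 1 := by rw [← pow_add, show a + (b - a) = b by omega, ← h, hg1]

end InvariantGroupLike

variable {T : Y →ₗ[k] Y} (hST : ∀ x, S (T x) = x) (hTS : ∀ x, T (S x) = x)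
  [FiniteDimensional k Y]

include hY hR hAB hST hTS

theorem twistedTrace_mul_comm (x y : Y) :
    twistedTrace (twist (drinfeldInv k A B) T) (x * y) =
      twistedTrace (twist (drinfeldInv k A B) T) (twist (drinfeldInv k A B) T y * x) := by
  set θ := twist (drinfeldInv k A B) T with hθ
  calc twistedTrace θ (x * y)
      = LinearMap.trace k Y (LinearMap.mulRight k y ∘ₗ (LinearMap.mulRight k x ∘ₗ θ)) := by
        rw [twistedTrace_apply]
        congr 1
        ext a
        simp [mul_assoc]
    _ = LinearMap.trace k Y ((LinearMap.mulRight k x ∘ₗ θ) ∘ₗ LinearMap.mulRight k y) :=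
        LinearMap.trace_comp_comm' _ _
    _ = _ := by
        rw [twistedTrace_apply]
        congr 1
        ext a
        simp [hθ, hY.twist_mul hR hAB hST hTS, mul_assoc]

theorem twistedTrace_smul_mul (h : U) (x y : Y) :
    twistedTrace (twist (drinfeldInv k A B) T) ((h • x) * y) =
      twistedTrace (twist (drinfeldInv k A B) T) (x * (antipode k h • y)) := by
  rw [hY.mul_antipode_smul, apply_sweedler (LinearMap.isLinear _)]
  simp only [hY.twistedTrace_smul hR hAB hST hTS, HopfAlgebra.counit_antipode]
  exact (sweedler_counit_left h (f := fun t =>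
    twistedTrace (twist (drinfeldInv k A B) T) ((t • x) * y)) (by fun_prop)).symm

theorem sweedler_twistedTrace_mul (a y : Y) :
    (sweedler k a fun a₁ a₂ => twistedTrace (twist (drinfeldInv k A B) T) (a₂ * y) • S a₁) =
      ∑ i, sweedler k y fun y₁ y₂ =>
        twistedTrace (twist (drinfeldInv k A B) T) ((A i • a) * y₂) • (B i • y₁) := by
  set t := twistedTrace (twist (drinfeldInv k A B) T)
  rw [← hY.sweedler_antipode_sweedler_mul hAB a y (fun p q => t q • p) (by fun_prop)
    (by fun_prop)]
  congr! 3 with a₁ a₂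
  have h := hY.sweedler_twistedTrace hR hAB hST hTS (Module.finBasis k Y) (a₂ * y)
  rw [← mul_one (S a₁), ← mul_smul_comm, ← h,
    apply_sweedler (k := k) (f := fun v => S a₁ * v) (by fun_prop)]
  simp only [mul_smul_comm, mul_one]
  rfl

variable {Λ : Y} (hΛ : ∀ x, x * Λ = counit (R := k) x • Λ)
  (htΛ : twistedTrace (twist (drinfeldInv k A B) T) Λ = 1)

omit hΛ htΛ in
theorem exists_integral (h : twistedTrace (twist (drinfeldInv k A B) T) ≠ 0) :
    ∃ Λ : Y, (∀ x, x * Λ = counit (R := k) x • Λ) ∧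
      twistedTrace (twist (drinfeldInv k A B) T) Λ = 1 := by
  set θ := twist (drinfeldInv k A B) T with hθ
  obtain ⟨y, hy⟩ := DFunLike.ne_iff.1 h
  set P := traceElement θ (Module.finBasis k Y) y with hP
  have hmul (x : Y) : x * P = counit (R := k) x • P := hY.mul_traceElement hR hAB hST hTS _ x y
  have hε : counit (R := k) P = twistedTrace θ y := counit_traceElement _ _ _
  refine ⟨(twistedTrace θ y)⁻¹ • P, fun x => ?_, ?_⟩
  · rw [mul_smul_comm, hmul, smul_comm]
  · have : twistedTrace θ P = twistedTrace θ y := by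
      rw [twistedTrace_eq_sum θ (Module.finBasis k Y), ← hε]
      simp only [hmul, hθ, hY.counit_twist hR hAB hST hTS, map_smul, smul_eq_mul]
      rw [← (Module.finBasis k Y).sum_coord_smul (LinearMap.isLinear (counit (R := k))) P]
      simp only [smul_eq_mul, mul_comm]
    rw [map_smul, this, smul_eq_mul, inv_mul_cancel₀ hy]

include hΛ htΛ

theorem antipode_eq_sum (a : Y) : S a = ∑ i, sweedler k Λ fun y₁ y₂ =>
    twistedTrace (twist (drinfeldInv k A B) T) ((A i • a) * y₂) • (B i • y₁) := by
  rw [← hY.sweedler_twistedTrace_mul hR hAB hST hTS]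
  simp only [hΛ, map_smul, htΛ, smul_eq_mul, mul_one]
  exact (sweedler_counit_right a (f := fun a => S a) (by fun_prop)).symm

theorem eq_zero_of_twistedTrace_mul_eq_zero {a : Y}
    (ha : ∀ x, twistedTrace (twist (drinfeldInv k A B) T) (a * x) = 0) : a = 0 := by
  have h := hY.antipode_eq_sum hR hAB hST hTS hΛ htΛ a
  simp only [hY.twistedTrace_smul_mul hR hAB hST hTS, ha, zero_smul] at h
  rw [← hTS a, h]
  simp [sweedler]

/-- Left-invariant vector-valued functionals are multiples of the trace integral. -/
theorem eq_twistedTrace_smul_of_invariant {f : Y →ₗ[k] M}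
    (hf : ∀ x, (sweedler k x fun a b => a ⊗ₜ[k] f b) = 1 ⊗ₜ f x) (a : Y) :
    f a = twistedTrace (twist (drinfeldInv k A B) T) a • f (T Λ) := by
  set t := twistedTrace (twist (drinfeldInv k A B) T) with ht
  set y := T Λ with hy
  have hSy : Λ = S y := (hST Λ).symm
  calc f a = ∑ i, sweedler k (S y) fun y₁ y₂ => t ((A i • a) * y₂) • f (B i • T y₁) := by
        conv_lhs => rw [← hTS a, hY.antipode_eq_sum hR hAB hST hTS hΛ htΛ a, hSy]
        simp only [map_sum]
        refine Finset.sum_congr rfl fun i _ => ?_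
        rw [apply_sweedler T.isLinear, apply_sweedler f.isLinear]
        simp only [map_smul, hY.inv_smul hST hTS, ht]
    _ = sweedler k y fun y₁ y₂ => ∑ i, ∑ j,
          t ((A i • a) * (A j • S y₁)) • f ((B i * B j) • y₂) := by
        simp only [sweedler_sum]
        refine Finset.sum_congr rfl fun i _ => ?_
        rw [hY.sweedler_antipode hR hAB _ _ (by fun_prop) (by fun_prop)]
        simp only [hY.inv_smul hST hTS, hTS, mul_smul]
    _ = sweedler k y fun y₁ y₂ => t (a * S y₁) • f y₂ := by
        congr! 3 with y₁ y₂
        rw [← hY.sum_left_act_mul hR hAB a (S y₁) (fun p c => t p • f (c • y₂)) (by fun_prop)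
          (by fun_prop)]
        have e (i : I) : t (A i • (a * S y₁)) • f (B i • y₂) =
            t (a * S y₁) • f ((counit (R := k) (A i) • B i) • y₂) := by
          rw [ht, hY.twistedTrace_smul hR hAB hST hTS, smul_assoc (_ : k) (B i), f.map_smul,
            smul_smul, smul_eq_mul, mul_comm]
        simp only [e]
        rw [← Finset.smul_sum, ← map_sum, ← Finset.sum_smul, hR.counit_left hAB, one_smul]
    _ = _ := by
        have h := congrArg (bilinearLift (fun p v => t (a * S p) • v) (by fun_prop)
          (by fun_prop)) (hf y)
        rw [bilinearLift_tmul, hY.antipode_one, mul_one,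
          apply_sweedler (LinearMap.isLinear _)] at h
        simpa only [bilinearLift_tmul] using h

omit [FiniteDimensional k Y] hΛ htΛ in
theorem twist_injective : Function.Injective (twist (drinfeldInv k A B) T : Y →ₗ[k] Y) := by
  rw [injective_iff_map_eq_zero]
  intro a ha
  have h := congrArg (fun v => drinfeld k A B • S (S v)) ha
  simpa only [hY.antipode_antipode_twist hST hTS, ← mul_smul, hR.drinfeld_mul_drinfeldInv hAB,
    one_smul, map_zero, smul_zero] using h

theorem eq_zero_of_twistedTrace_mul_eq_zero' {a : Y}
    (ha : ∀ x, twistedTrace (twist (drinfeldInv k A B) T) (x * a) = 0) : a = 0 := by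
  apply hY.twist_injective hR hAB hST hTS
  rw [map_zero]
  refine hY.eq_zero_of_twistedTrace_mul_eq_zero hR hAB hST hTS hΛ htΛ fun x => ?_
  rw [← hY.twistedTrace_mul_comm hR hAB hST hTS, ha]

/-- The group-like element which measures the failure of the trace integral to be invariant on the
other side. -/
theorem exists_isGroupLikeElem :
    ∃ g : Y, IsGroupLikeElem k g ∧ (∀ h : U, h • g = counit (R := k) h • g) ∧
      ∀ x, (sweedler k x fun a b => twistedTrace (twist (drinfeldInv k A B) T) a • b) =
        twistedTrace (twist (drinfeldInv k A B) T) x • g := by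
  set t := twistedTrace (twist (drinfeldInv k A B) T) with ht
  let f : Y →ₗ[k] Y := IsLinearMap.mk' (fun x => sweedler k x fun a b => t a • b) (by fun_prop)
  have hfdef (x : Y) : f x = sweedler k x fun a b => t a • b := rfl
  have hinv (x : Y) : (sweedler k x fun a b => a ⊗ₜ[k] f b) = 1 ⊗ₜ f x := by
    calc (sweedler k x fun a b => a ⊗ₜ[k] f b)
        = sweedler k x fun a c => sweedler k c fun b d => a ⊗ₜ[k] (t b • d) := by
          congr! 3 with a c
          rw [hfdef, apply_sweedler (k := k) (f := fun v : Y => a ⊗ₜ[k] v) (by fun_prop)]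
      _ = sweedler k x fun c d => sweedler k c fun a b => a ⊗ₜ[k] (t b • d) :=
          (sweedler_coassoc x (fun a b d => a ⊗ₜ[k] (t b • d)) (by fun_prop) (by fun_prop)
            (by fun_prop)).symm
      _ = sweedler k x fun c d => 1 ⊗ₜ[k] (t c • d) := by
          congr! 3 with c d
          rw [← smul_tmul, ← hY.sweedler_twistedTrace hR hAB hST hTS (Module.finBasis k Y) c,
            apply_sweedler (k := k) (f := fun v => v ⊗ₜ[k] d) (by fun_prop)]
          simp only [smul_tmul, ht]
      _ = _ := (apply_sweedler (k := k) (f := fun v : Y => (1 : Y) ⊗ₜ[k] v) (by fun_prop) _ _).symm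
  have hf (a : Y) : f a = t a • f (T Λ) :=
    hY.eq_twistedTrace_smul_of_invariant hR hAB hST hTS hΛ htΛ hinv a
  have hfΛ : f Λ = f (T Λ) := by rw [hf, htΛ, one_smul]
  have hfs (h : U) (x : Y) : f (h • x) = h • f x := by
    rw [hfdef, hY.sweedler_act h x _ (by fun_prop) (by fun_prop)]
    simp only [ht, hY.twistedTrace_smul hR hAB hST hTS, smul_assoc]
    have e (s t' : U) : (sweedler k x fun a b => counit (R := k) s • t a • t' • b) =
        counit (R := k) s • (t' • f x) := by
      rw [hfdef, apply_sweedler (k := k) (f := fun v => counit (R := k) s • (t' • v)) (by fun_prop)]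
      simp only [smul_comm t' (t _)]
    simp only [← ht, e]
    exact sweedler_counit_left h (f := fun t' => t' • f x) (by fun_prop)
  refine ⟨f (T Λ), ⟨?_, ?_⟩, fun h => ?_, hf⟩
  · rw [← hfΛ, hfdef, apply_sweedler (LinearMap.isLinear _)]
    simp only [map_smul, smul_eq_mul, mul_comm (t _)]
    exact (sweedler_counit_right Λ (f := fun a => t a) (by fun_prop)).trans htΛ
  · rw [← hfΛ]
    calc comul (R := k) (f Λ)
        = sweedler k Λ fun a c => sweedler k c fun b d => t a • b ⊗ₜ[k] d := by
          rw [hfdef, apply_sweedler (LinearMap.isLinear _)]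
          congr! 3 with a c
          rw [map_smul, comul_eq_sweedler,
            apply_sweedler (k := k) (f := fun v => t a • v) (by fun_prop)]
      _ = sweedler k Λ fun c d => sweedler k c fun a b => t a • b ⊗ₜ[k] d :=
          (sweedler_coassoc Λ (fun a b d => t a • b ⊗ₜ[k] d) (by fun_prop) (by fun_prop)
            (by fun_prop)).symm
      _ = sweedler k Λ fun c d => f (T Λ) ⊗ₜ[k] (t c • d) := by
          congr! 3 with c d
          rw [← smul_tmul, ← hf, hfdef,
            apply_sweedler (k := k) (f := fun v => v ⊗ₜ[k] d) (by fun_prop)]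
          simp only [smul_tmul']
      _ = _ := by
          rw [← apply_sweedler (k := k) (f := fun v : Y => f (T Λ) ⊗ₜ[k] v) (by fun_prop), ← hfdef, hfΛ]
  · rw [← hfΛ, ← hfs, hf, ht, hY.twistedTrace_smul hR hAB hST hTS, ← ht, htΛ, smul_assoc, one_smul,
      hfΛ]

end IsBraidedHopfAlgebra
end TraceIntegralUniqueness

section TwistFiniteOrder

open Coalgebra HopfAlgebra IsUniversalRMatrix

variable {k U M : Type*} [Field k] [Ring U] [HopfAlgebra k U] [AddCommGroup M] [Module k M]

namespace IsBraidedHopfAlgebra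

variable {R : (U ⊗[k] U)ˣ} {Y : Type*} [Ring Y] [Algebra k Y] [Coalgebra k Y] [Module U Y]
  [IsScalarTower k U Y] {S : Y →ₗ[k] Y} (hY : IsBraidedHopfAlgebra R S)
  (hR : IsUniversalRMatrix R) {I : Type*} [Fintype I] {A B : I → U}
  (hAB : (R : U ⊗[k] U) = ∑ i, A i ⊗ₜ[k] B i)
  {T : Y →ₗ[k] Y} (hST : ∀ x, S (T x) = x) (hTS : ∀ x, T (S x) = x)
  [FiniteDimensional k Y]

include hY

omit [FiniteDimensional k Y] in
theorem antipode_mul_of_isGroupLikeElem {g : Y} (hg : IsGroupLikeElem k g) : S g * g = 1 := by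
  have h := hY.sweedler_antipode_left g (f := fun x => x) (by fun_prop)
  rwa [hg.sweedler_eq _ (by fun_prop) (by fun_prop), hg.counit_eq_one, one_smul] at h

omit [FiniteDimensional k Y] in
theorem mul_antipode_of_isGroupLikeElem {g : Y} (hg : IsGroupLikeElem k g) : g * S g = 1 := by
  have h := hY.sweedler_antipode_right g (f := fun x => x) (by fun_prop)
  rwa [hg.sweedler_eq _ (by fun_prop) (by fun_prop), hg.counit_eq_one, one_smul] at h

include hR hAB hST hTS

theorem twistedTrace_antipode_mul (x y : Y) :
    twistedTrace (twist (drinfeldInv k A B) T) (S (x * y)) =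
      twistedTrace (twist (drinfeldInv k A B) T) (S y * (drinfeld k A B • S x)) := by
  rw [hY.antipode_mul hR hAB, map_sum]
  simp only [hY.twistedTrace_smul_mul hR hAB hST hTS, drinfeld, Finset.sum_smul, Finset.mul_sum,
    map_sum, mul_smul]

theorem twistedTrace_antipode_mul_comm (x y : Y) :
    twistedTrace (twist (drinfeldInv k A B) T) (S (x * y)) =
      twistedTrace (twist (drinfeldInv k A B) T) (S (y *
        (drinfeldGroupLike k A B • twist (drinfeldInv k A B) T x))) := by
  set θ := twist (drinfeldInv k A B) T with hθ
  have hSθ (x : Y) : θ (S x) = S (θ x) := by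
    simp only [hθ, twist_apply, hTS, hST, hY.antipode_smul]
  have hu : θ (drinfeld k A B • S x) = drinfeld k A B • S (θ x) := by
    rw [← hR.antipode_antipode_drinfeld hAB, hθ, hY.twist_antipode_antipode_smul hR hAB hST hTS,
      hR.antipode_antipode_drinfeld hAB, ← hθ, hSθ]
  have hw : antipode k (drinfeld k A B) • drinfeldGroupLike k A B • θ x =
      drinfeld k A B • θ x := by
    rw [drinfeldGroupLike, ← mul_smul, ← mul_assoc, ← antipode_mul_antidistrib,
      hR.drinfeldInv_mul_drinfeld hAB, HopfAlgebra.antipode_one, one_mul]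
  rw [hY.twistedTrace_antipode_mul hR hAB hST hTS, hY.twistedTrace_mul_comm hR hAB hST hTS, ← hθ,
    hu, hY.twistedTrace_antipode_mul hR hAB hST hTS, ← hR.antipode_antipode_drinfeld hAB,
    ← hY.twistedTrace_smul_mul hR hAB hST hTS (antipode k (drinfeld k A B)), ← hY.antipode_smul,
    ← hY.antipode_smul, hR.antipode_antipode_drinfeld hAB, hw]

variable {Λ : Y} (hΛ : ∀ x, x * Λ = counit (R := k) x • Λ)
  (htΛ : twistedTrace (twist (drinfeldInv k A B) T) Λ = 1)

include hΛ htΛ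

/-- The square of `θ` is inner, up to the action of a group-like element of `U`. -/
theorem drinfeldGroupLike_smul_twist_twist_mul {g : Y} (hg : IsGroupLikeElem k g)
    (hinv : ∀ h : U, h • g = counit (R := k) h • g)
    (hgt : ∀ x, (sweedler k x fun a b => twistedTrace (twist (drinfeldInv k A B) T) a • b) =
        twistedTrace (twist (drinfeldInv k A B) T) x • g) (x : Y) :
    (drinfeldGroupLike k A B • twist (drinfeldInv k A B) T (twist (drinfeldInv k A B) T x)) * g =
      g * x := by
  set θ := twist (drinfeldInv k A B) T with hθ
  set t := twistedTrace θ with ht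
  let μ : Y →ₗ[k] k := t ∘ₗ LinearMap.mulRight k g
  have hμ (x : Y) : μ x = t (x * g) := rfl
  have hμs (h : U) (x : Y) : μ (h • x) = counit (R := k) h • μ x := by
    rw [hμ, ← hY.smul_mul_of_invariant hinv, hμ, ht, hθ, hY.twistedTrace_smul hR hAB hST hTS]
  have hright (x : Y) : (sweedler k x fun a b => μ a • b) = μ x • 1 := by
    have h := congrArg (· * S g) (hgt (x * g))
    rw [hY.sweedler_mul_isGroupLikeElem hR hAB hinv hg _ _ (by fun_prop) (by fun_prop)] at h
    rw [apply_sweedler (k := k) (f := fun v => v * S g) (by fun_prop)] at h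
    simp only [smul_mul_assoc, mul_assoc, hY.mul_antipode_of_isGroupLikeElem hg, mul_one] at h
    exact h
  have hleft (x : Y) : (sweedler k x fun a b => a ⊗ₜ[k] (μ ∘ₗ T) b) = 1 ⊗ₜ (μ ∘ₗ T) x := by
    obtain ⟨y, rfl⟩ : ∃ y, S y = x := ⟨T x, hST x⟩
    rw [hY.sweedler_antipode hR hAB _ _ (by fun_prop) (by fun_prop)]
    simp only [LinearMap.comp_apply, hY.inv_smul hST hTS, hTS, hμs]
    rw [← sweedler_sum]
    have e (a b : Y) : ∑ i, (B i • S b) ⊗ₜ[k] (counit (R := k) (A i) • μ a) =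
        S (μ a • b) ⊗ₜ[k] (1 : k) := by
      simp only [← smul_tmul, ← sum_tmul, ← smul_assoc, ← Finset.sum_smul, hR.counit_left hAB,
        one_smul]
      rw [map_smul, smul_tmul, smul_eq_mul, mul_one]
    simp only [e]
    rw [← apply_sweedler (k := k) (f := fun v : Y => S v ⊗ₜ[k] (1 : k)) (by fun_prop), hright,
      map_smul, hY.antipode_one, smul_tmul, smul_eq_mul, mul_one]
  set c := (μ ∘ₗ T) (T Λ) with hc
  have hμc (x : Y) : μ x = c * t (S x) := by
    have h := hY.eq_twistedTrace_smul_of_invariant hR hAB hST hTS hΛ htΛ hleft (S x)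
    rw [LinearMap.comp_apply, hTS] at h
    rw [h, smul_eq_mul, mul_comm]
  have hcomm (x y : Y) : t (x * y * g) = t (y * (drinfeldGroupLike k A B • θ x) * g) := by
    rw [← hμ, ← hμ, hμc, hμc, ht, hY.twistedTrace_antipode_mul_comm hR hAB hST hTS]
  refine (sub_eq_zero.1 (hY.eq_zero_of_twistedTrace_mul_eq_zero' hR hAB hST hTS hΛ htΛ
    fun y => ?_)).symm
  rw [mul_sub, map_sub, sub_eq_zero, ← mul_assoc, ← mul_assoc, ← hθ, ← ht, ← hcomm,
    hY.twistedTrace_mul_comm hR hAB hST hTS, mul_assoc]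

omit hΛ htΛ in
/-- If the trace integral does not vanish, then `θ` has finite order. -/
theorem exists_twist_pow_eq_one (h : twistedTrace (twist (drinfeldInv k A B) T) ≠ 0) :
    ∃ n, 0 < n ∧ (twist (drinfeldInv k A B) T : Module.End k Y) ^ n = 1 := by
  obtain ⟨Λ, hΛ, htΛ⟩ := hY.exists_integral hR hAB hST hTS h
  obtain ⟨g, hg, hinv, hgt⟩ := hY.exists_isGroupLikeElem hR hAB hST hTS hΛ htΛ
  set θ : Module.End k Y := twist (drinfeldInv k A B) T with hθ
  set w := drinfeldGroupLike k A B with hwdef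
  have hgl := hR.isGroupLikeElem_drinfeldGroupLike hAB
  let W : Module.End k Y := Algebra.lsmul k k Y w
  have hcomm : Commute W (θ ^ 2) := by
    refine Commute.pow_right ?_ 2
    ext x
    change w • θ x = θ (w • x)
    have h := hY.twist_antipode_antipode_smul hR hAB hST hTS w x
    rw [hgl.antipode_antipode] at h
    exact h.symm
  have hgg := hY.mul_antipode_of_isGroupLikeElem hg
  have hconj : W * θ ^ 2 = LinearMap.mulLeft k g * LinearMap.mulRight k (S g) := by
    ext x
    have := hY.drinfeldGroupLike_smul_twist_twist_mul hR hAB hST hTS hΛ htΛ hg hinv hgt x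
    change w • θ (θ x) = g * (x * S g)
    rw [← mul_assoc, ← this, mul_assoc, hgg, mul_one]
  obtain ⟨a, ha, hga⟩ := hY.exists_pow_eq_one_of_isGroupLikeElem hR hAB hinv hg
    (hY.antipode_mul_of_isGroupLikeElem hg)
  obtain ⟨b, hb, hwb⟩ := hR.exists_drinfeldGroupLike_pow_eq_one hAB
  have hga' : S g ^ a = 1 := by
    have hc : Commute g (S g) := hgg.trans (hY.antipode_mul_of_isGroupLikeElem hg).symm
    have h := hc.mul_pow a
    rw [hgg, one_pow, hga, one_mul] at h
    exact h.symm
  have h1 : (W * θ ^ 2) ^ a = 1 := by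
    rw [hconj, (LinearMap.commute_mulLeft_right (R := k) g (S g)).mul_pow, LinearMap.pow_mulLeft,
      LinearMap.pow_mulRight, hga, hga']
    ext x
    simp
  have hWb : W ^ b = 1 := by
    rw [show W = Algebra.lsmul k k Y w from rfl, ← map_pow, hwb, map_one]
  refine ⟨2 * (a * b), by positivity, ?_⟩
  have h2 : (W * θ ^ 2) ^ (a * b) = 1 := by rw [pow_mul, h1, one_pow]
  rwa [hcomm.mul_pow, mul_comm a b, pow_mul W, hWb, one_pow, one_mul, ← pow_mul, mul_comm b a]
    at h2

end IsBraidedHopfAlgebra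
end TwistFiniteOrder

section TwistedTraceAlgebra

variable {k Y Z : Type*} [Field k] [Ring Y] [Algebra k Y] [Ring Z] [Algebra k Z]

theorem twistedTrace_baseChange [FiniteDimensional k Y] (K : Type*) [Field K] [Algebra k K]
    (θ : Y →ₗ[k] Y) (y : Y) :
    twistedTrace (θ.baseChange K) ((1 : K) ⊗ₜ[k] y) = algebraMap k K (twistedTrace θ y) := by
  rw [twistedTrace_apply, twistedTrace_apply, ← LinearMap.trace_baseChange]
  congr 1
  ext z
  simp

theorem twistedTrace_autCongr (e : Y ≃ₐ[k] Z) (σ : Y ≃ₐ[k] Y) (y : Y) :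
    twistedTrace (e.autCongr σ).toLinearMap (e y) = twistedTrace σ.toLinearMap y := by
  rw [twistedTrace_apply, twistedTrace_apply, ← LinearMap.trace_conj' _ e.toLinearEquiv]
  congr 1
  ext z
  simp [LinearEquiv.conj_apply]

theorem eq_zero_of_twistedTrace_autCongr (e : Y ≃ₐ[k] Z) {σ : Y ≃ₐ[k] Y}
    (h : ∀ a, (∀ x, twistedTrace σ.toLinearMap (a * x) = 0) → a = 0) (a : Z)
    (ha : ∀ x, twistedTrace (e.autCongr σ).toLinearMap (a * x) = 0) : a = 0 := by
  have := h (e.symm a) fun x => by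
    rw [← twistedTrace_autCongr e, map_mul, e.apply_symm_apply, ha]
  simpa using this

theorem eq_zero_of_twistedTrace_baseChange [FiniteDimensional k Y] (K : Type*) [Field K]
    [Algebra k K] {θ : Y →ₗ[k] Y} (h : ∀ a, (∀ x, twistedTrace θ (a * x) = 0) → a = 0)
    (a : K ⊗[k] Y) (ha : ∀ x, twistedTrace (θ.baseChange K) (a * x) = 0) : a = 0 := by
  set B : LinearMap.BilinForm k Y := (LinearMap.mul k Y).compr₂ (twistedTrace θ) with hB
  have hnd : B.Nondegenerate := by
    rw [LinearMap.BilinForm.nondegenerate_iff_ker_eq_bot, LinearMap.ker_eq_bot']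
    exact fun a ha => h a fun x => LinearMap.congr_fun ha x
  let b := Module.finBasis k Y
  let d := B.dualBasis hnd b
  let e := d.baseChange K
  have hc : ∀ j, e.repr a j = 0 := by
    intro j
    have h1 := ha ((1 : K) ⊗ₜ[k] b j)
    rw [← e.sum_repr a, Finset.sum_mul, map_sum] at h1
    rw [← h1, Finset.sum_eq_single j]
    · have : twistedTrace θ (d j * b j) = 1 := by
        have := B.apply_dualBasis_left hnd b j j
        simpa [hB] using this
      rw [smul_mul_assoc, map_smul, Module.Basis.baseChange_apply,
        Algebra.TensorProduct.tmul_mul_tmul, one_mul, twistedTrace_baseChange, this]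
      simp
    · intro i _ hij
      have : twistedTrace θ (d i * b j) = 0 := by
        have := B.apply_dualBasis_left hnd b i j
        simpa [hB, hij.symm] using this
      rw [smul_mul_assoc, map_smul, Module.Basis.baseChange_apply,
        Algebra.TensorProduct.tmul_mul_tmul, one_mul, twistedTrace_baseChange, this]
      simp
    · simp
  rw [← e.sum_repr a]
  simp [hc]

theorem eq_zero_of_isNilpotent_mul {θ : Y →ₗ[k] Y} [FiniteDimensional k Y]
    (h : ∀ a, (∀ x, twistedTrace θ (a * x) = 0) → a = 0) {a : Y}
    (ha : ∀ x, IsNilpotent (LinearMap.mulRight k (a * x) ∘ₗ θ : Module.End k Y)) : a = 0 :=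
  h a fun x => (LinearMap.isNilpotent_trace_of_isNilpotent (ha x)).eq_zero

theorem isSemisimpleRing_of_twistedTrace [FiniteDimensional k Y] (σ : Y ≃ₐ[k] Y)
    (h : ∀ a, (∀ x, twistedTrace σ.toLinearMap (a * x) = 0) → a = 0) : IsSemisimpleRing Y := by
  have : IsArtinianRing Y := IsArtinianRing.of_finite k Y
  rw [IsArtinianRing.isSemisimpleRing_iff_jacobson, eq_bot_iff]
  intro a ha
  rw [Ideal.mem_bot]
  obtain ⟨n, hn⟩ := IsSemiprimaryRing.isNilpotent (R := Y)
  refine eq_zero_of_isNilpotent_mul h fun x => ⟨n, ?_⟩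
  have hax : a * x ∈ Ring.jacobson Y := Ideal.mul_mem_right _ _ ha
  have hσ : ∀ (m : ℕ) y, y ∈ Ring.jacobson Y ^ m → σ y ∈ Ring.jacobson Y ^ m := by
    have : RingHomSurjective (σ : Y →+* Y) := ⟨σ.surjective⟩
    intro m
    induction m with
    | zero =>
      intro y _
      rw [Submodule.pow_zero, Ideal.one_eq_top]
      trivial
    | succ m ih =>
      intro y hy
      rw [Submodule.pow_succ] at hy ⊢
      induction hy using Submodule.smul_induction_on' with
      | smul b hb c hc =>
        rw [smul_eq_mul, map_mul]
        exact Ideal.mul_mem_mul (ih _ hb) (Ring.le_comap_jacobson (σ : Y →+* Y) hc)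
      | add b _ c _ hb hc => exact map_add σ b c ▸ add_mem hb hc
  have key : ∀ (m : ℕ) y, ((LinearMap.mulRight k (a * x) ∘ₗ σ.toLinearMap : Module.End k Y) ^ m) y ∈
      Ring.jacobson Y ^ m := by
    intro m
    induction m with
    | zero =>
      intro y
      rw [Submodule.pow_zero, Ideal.one_eq_top]
      trivial
    | succ m ih =>
      intro y
      rw [_root_.pow_succ', Submodule.pow_succ]
      exact Ideal.mul_mem_mul (hσ m _ (ih y)) hax
  ext y
  have := key n y
  rw [hn] at this
  exact this

end TwistedTraceAlgebra

section RootsOfUnity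

theorem IsPrimitiveRoot.aeval_eq_zero_iff {K : Type*} [Field K] [CharZero K] {N : ℕ} {ζ : K}
    (hζ : IsPrimitiveRoot ζ N) (hN : 0 < N) (F : Polynomial ℤ) :
    Polynomial.aeval ζ F = 0 ↔ Polynomial.cyclotomic N ℤ ∣ F := by
  rw [Polynomial.cyclotomic_eq_minpoly hζ hN]
  exact minpoly.isIntegrallyClosed_dvd_iff (hζ.isIntegral hN) F

theorem Finset.sum_range_eq_sum_range_succ {M : Type*} [AddCommGroup M] {N : ℕ} (f : ℕ → M)
    (h : f N = f 0) : ∑ l ∈ Finset.range N, f (l + 1) = ∑ l ∈ Finset.range N, f l := by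
  have h1 := Finset.sum_range_succ f N
  have h2 := Finset.sum_range_succ' f N
  rw [h1, h] at h2
  exact (add_right_cancel h2).symm

theorem IsPrimitiveRoot.pow_pred_eq_inv {K : Type*} [Field K] {N : ℕ} (hN : 0 < N) {ζ : K}
    (hζ : IsPrimitiveRoot ζ N) : ζ ^ (N - 1) = ζ⁻¹ := by
  refine eq_inv_of_mul_eq_one_left ?_
  rw [← pow_succ, Nat.sub_add_cancel hN, hζ.pow_eq_one]

/-- The polynomial with the natural numbers `m 0, …, m (N - 1)` as coefficients. -/
noncomputable def multiplicityPoly (N : ℕ) (m : ℕ → ℕ) : Polynomial ℤ :=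
  ∑ j ∈ Finset.range N, (m j : Polynomial ℤ) * .X ^ j

theorem aeval_multiplicityPoly {K : Type*} [Field K] (N : ℕ) (m : ℕ → ℕ) (z : K) :
    Polynomial.aeval z (multiplicityPoly N m) = ∑ j ∈ Finset.range N, (m j : K) * z ^ j := by
  simp [multiplicityPoly, map_sum]

theorem aeval_multiplicityPoly_conj {z : ℂ} (hz : ‖z‖ = 1) (N : ℕ) (m : ℕ → ℕ) :
    Polynomial.aeval z⁻¹ (multiplicityPoly N m) =
      (starRingEnd ℂ) (Polynomial.aeval z (multiplicityPoly N m)) := by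
  simp [aeval_multiplicityPoly, Complex.inv_eq_conj hz, map_sum]

/-- Sums `∑ᵢ zᵢ z̄ᵢ` over integral combinations `zᵢ` of `N`-th roots of unity vanish in a field of
characteristic zero only if every `zᵢ` does. -/
theorem IsPrimitiveRoot.aeval_multiplicityPoly_eq_zero {K ι : Type*} [Field K] [CharZero K]
    [Fintype ι] {N : ℕ} (hN : 0 < N) {ζ : K} (hζ : IsPrimitiveRoot ζ N) (m : ι → ℕ → ℕ)
    (h : ∑ i, Polynomial.aeval ζ (multiplicityPoly N (m i)) *
      Polynomial.aeval ζ⁻¹ (multiplicityPoly N (m i)) = 0) (i : ι) :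
    Polynomial.aeval ζ (multiplicityPoly N (m i)) = 0 := by
  let F : Polynomial ℤ := ∑ i, multiplicityPoly N (m i) *
    (multiplicityPoly N (m i)).comp (.X ^ (N - 1))
  have hω := Complex.isPrimitiveRoot_exp N hN.ne'
  set ω := Complex.exp (2 * Real.pi * Complex.I / N) with hωdef
  have hF : Polynomial.aeval ζ F = 0 := by
    simpa [F, map_sum, Polynomial.aeval_comp, hζ.pow_pred_eq_inv hN] using h
  rw [hζ.aeval_eq_zero_iff hN, ← hω.aeval_eq_zero_iff hN] at hF ⊢
  have hnorm : ‖ω‖ = 1 := hω.norm'_eq_one hN.ne'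
  have hsum : ∑ i, Complex.normSq (Polynomial.aeval ω (multiplicityPoly N (m i))) = 0 := by
    apply Complex.ofReal_injective
    simpa [F, map_sum, Polynomial.aeval_comp, hω.pow_pred_eq_inv hN,
      aeval_multiplicityPoly_conj hnorm, Complex.mul_conj] using hF
  rw [Finset.sum_eq_zero_iff_of_nonneg fun i _ => Complex.normSq_nonneg _] at hsum
  exact Complex.normSq_eq_zero.1 (hsum i (Finset.mem_univ i))

end RootsOfUnity

section TracePow

variable {K n : Type*} [Field K] [CharZero K] [Fintype n] [DecidableEq n]

theorem Matrix.exists_trace_eq_natCast {P : Matrix n n K} (hP : P * P = P) :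
    ∃ m : ℕ, P.trace = m := by
  have h : IsIdempotentElem (Matrix.toLin' P) := by
    rw [IsIdempotentElem, Module.End.mul_eq_comp, ← Matrix.toLin'_mul, hP]
  refine ⟨Module.finrank K (LinearMap.range (Matrix.toLin' P)), ?_⟩
  rw [← Matrix.trace_toLin'_eq]
  exact (LinearMap.IsIdempotentElem.isProj_range _ h).trace

/-- The traces of the powers of a matrix of finite order are given by the multiplicities of its
eigenvalues. -/
theorem Matrix.exists_trace_pow_eq_sum {N : ℕ} (hN : 0 < N) {ζ : K} (hζ : IsPrimitiveRoot ζ N)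
    {u : Matrix n n K} (hu : u ^ N = 1) :
    ∃ m : ℕ → ℕ, ∀ l < N, (u ^ l).trace = ∑ j ∈ Finset.range N, (m j : K) * (ζ ^ j) ^ l := by
  have hζ0 : ζ ≠ 0 := hζ.ne_zero hN.ne'
  have hNK : (N : K) ≠ 0 := Nat.cast_ne_zero.2 hN.ne'
  let P : ℕ → Matrix n n K := fun j =>
    (N : K)⁻¹ • ∑ l ∈ Finset.range N, ((ζ ^ j)⁻¹) ^ l • u ^ l
  have huP : ∀ j, u * P j = ζ ^ j • P j := by
    intro j
    have h0 : ζ ^ j ≠ 0 := pow_ne_zero _ hζ0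
    have := Finset.sum_range_eq_sum_range_succ (N := N) (fun l => ((ζ ^ j)⁻¹) ^ l • u ^ l) (by
      rw [hu, inv_pow, ← pow_mul, mul_comm j N, pow_mul, hζ.pow_eq_one, one_pow, inv_one, pow_zero,
        pow_zero])
    simp only [P]
    rw [mul_smul_comm, smul_comm (ζ ^ j)]
    conv_rhs => rw [← this, Finset.smul_sum]
    rw [Finset.mul_sum]
    refine congrArg _ (Finset.sum_congr rfl fun l _ => ?_)
    rw [mul_smul_comm, smul_smul, ← pow_succ', pow_succ' (ζ ^ j)⁻¹ l, mul_inv_cancel_left₀ h0]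
  have hulP : ∀ j l, u ^ l * P j = (ζ ^ j) ^ l • P j := by
    intro j l
    induction l with
    | zero => simp
    | succ l ih => rw [pow_succ, mul_assoc, huP, mul_smul_comm, ih, smul_smul, pow_succ, mul_comm]
  have hPP : ∀ j, P j * P j = P j := by
    intro j
    conv_lhs => enter [1]; simp only [P]
    have h0 : ζ ^ j ≠ 0 := pow_ne_zero _ hζ0
    rw [smul_mul_assoc, Finset.sum_mul]
    simp only [smul_mul_assoc, hulP, smul_smul, ← mul_pow, inv_mul_cancel₀ h0, one_pow, one_smul]
    rw [Finset.sum_const, Finset.card_range, ← Nat.cast_smul_eq_nsmul K, smul_smul,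
      inv_mul_cancel₀ hNK, one_smul]
  have hsum : ∀ l < N, ∑ j ∈ Finset.range N, (ζ ^ j) ^ l • P j = u ^ l := by
    intro l hl
    have hgeom : ∀ r < N, ∑ j ∈ Finset.range N, (ζ ^ j) ^ l * ((ζ ^ j)⁻¹) ^ r =
        if r = l then (N : K) else 0 := by
      intro r hr
      have hpow : ∀ j, (ζ ^ j) ^ l * ((ζ ^ j)⁻¹) ^ r = (ζ ^ l * (ζ ^ r)⁻¹) ^ j := fun j => by
        rw [mul_pow, inv_pow, inv_pow, ← pow_mul, ← pow_mul, ← pow_mul, ← pow_mul, mul_comm j,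
          mul_comm j]
      simp only [hpow]
      split_ifs with h
      · rw [h, mul_inv_cancel₀ (pow_ne_zero _ hζ0)]
        simp
      · have h1 : ζ ^ l * (ζ ^ r)⁻¹ ≠ 1 := fun h1 =>
          h (hζ.pow_inj hl hr ((mul_inv_eq_one₀ (pow_ne_zero _ hζ0)).1 h1)).symm
        have h2 := mul_geom_sum (ζ ^ l * (ζ ^ r)⁻¹) N
        have h3 : (ζ ^ l * (ζ ^ r)⁻¹) ^ N = 1 := by
          rw [mul_pow, inv_pow, ← pow_mul, ← pow_mul, mul_comm l, mul_comm r, pow_mul, pow_mul,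
            hζ.pow_eq_one, one_pow, one_pow, inv_one, one_mul]
        rw [h3, sub_self] at h2
        exact (mul_eq_zero.1 h2).resolve_left (sub_ne_zero.2 h1)
    calc ∑ j ∈ Finset.range N, (ζ ^ j) ^ l • P j
        = (N : K)⁻¹ • ∑ r ∈ Finset.range N,
            (∑ j ∈ Finset.range N, (ζ ^ j) ^ l * ((ζ ^ j)⁻¹) ^ r) • u ^ r := by
          simp only [P, Finset.smul_sum, smul_smul, Finset.sum_smul]
          rw [Finset.sum_comm]
          simp only [mul_left_comm]
      _ = (N : K)⁻¹ • ∑ r ∈ Finset.range N, (if r = l then (N : K) else 0) • u ^ r := by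
          refine congrArg _ (Finset.sum_congr rfl fun r hr => ?_)
          rw [hgeom r (Finset.mem_range.1 hr)]
      _ = u ^ l := by
          simp [ite_smul, hl, hNK]
  choose m hm using fun j => Matrix.exists_trace_eq_natCast (hPP j)
  refine ⟨m, fun l hl => ?_⟩
  rw [← hsum l hl, Matrix.trace_sum]
  simp only [Matrix.trace_smul, hm, smul_eq_mul, mul_comm]

end TracePow

section MatrixAut

variable {K n : Type*} [Field K] [Fintype n] [DecidableEq n]

/-- Skolem–Noether for matrix algebras. -/
theorem Matrix.exists_eq_conj (f : Matrix n n K ≃ₐ[K] Matrix n n K) :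
    ∃ u v : Matrix n n K, u * v = 1 ∧ v * u = 1 ∧ ∀ m, f m = u * m * v := by
  obtain ⟨T, hT⟩ := (Matrix.toLinAlgEquiv'.autCongr f).eq_linearEquivConjAlgEquiv
  refine ⟨LinearMap.toMatrix' T.toLinearMap, LinearMap.toMatrix' T.symm.toLinearMap, ?_, ?_, ?_⟩
  · rw [← LinearMap.toMatrix'_comp]; simp
  · rw [← LinearMap.toMatrix'_comp]; simp
  · intro m
    have h := congr($hT (Matrix.toLinAlgEquiv' m))
    apply Matrix.toLinAlgEquiv'.injective
    simp only [map_mul]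
    simp only [AlgEquiv.autCongr_apply, AlgEquiv.trans_apply, AlgEquiv.symm_apply_apply,
      LinearEquiv.conjAlgEquiv_apply] at h
    rw [h]
    refine LinearMap.ext fun x => ?_
    simp [Matrix.toLinAlgEquiv'_apply, -Matrix.mulVec_mulVec, LinearMap.toMatrix'_mulVec]

theorem Matrix.exists_smul_one_of_commute {a : Matrix n n K} (h : ∀ m, a * m = m * a) :
    ∃ c : K, a = c • 1 := by
  have hmem : a ∈ Subalgebra.center K (Matrix n n K) :=
    Subalgebra.mem_center_iff.2 fun m => (h m).symm
  rcases isEmpty_or_nonempty n with hn | hn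
  · exact ⟨0, Subsingleton.elim _ _⟩
  rw [Algebra.IsCentral.center_eq_bot, Algebra.mem_bot] at hmem
  obtain ⟨c, rfl⟩ := hmem
  exact ⟨c, Algebra.algebraMap_eq_smul_one c⟩

theorem Matrix.trace_mulLeftRight (u w : Matrix n n K) :
    LinearMap.trace K (Matrix n n K) (LinearMap.mulRight K w ∘ₗ LinearMap.mulLeft K u) =
      u.trace * w.trace := by
  rw [Module.Basis.trace_eq_sum (Matrix.stdBasis K n n), Fintype.sum_prod_type, Matrix.trace,
    Matrix.trace, Finset.sum_mul_sum]
  refine Finset.sum_congr rfl fun i _ => Finset.sum_congr rfl fun j _ => ?_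
  rw [Module.Basis.coord_apply, Matrix.stdBasis_eq_single]
  have : ∀ (m : Matrix n n K), (Matrix.stdBasis K n n).repr m (i, j) = m i j := by
    intro m
    simp [Matrix.stdBasis]
  rw [this]
  simp [Matrix.mul_apply, Matrix.single_apply, Finset.sum_ite_eq, ite_and]

end MatrixAut

section MatrixBlocks

variable {K ι : Type*} [Field K] [Fintype ι] [DecidableEq ι] {d : ι → Type*} [∀ i, Fintype (d i)]
  [∀ i, DecidableEq (d i)]

theorem LinearMap.trace_pi_eq_sum {M : ι → Type*} [∀ i, AddCommGroup (M i)] [∀ i, Module K (M i)]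
    [∀ i, FiniteDimensional K (M i)] (f : (Π i, M i) →ₗ[K] Π i, M i) (g : ∀ i, M i →ₗ[K] M i)
    (h : ∀ i m, f (Pi.single i m) i = g i m) :
    LinearMap.trace K _ f = ∑ i, LinearMap.trace K _ (g i) := by
  classical
  let b := fun i => Module.finBasis K (M i)
  rw [(Pi.basis b).trace_eq_sum, Fintype.sum_sigma]
  refine Finset.sum_congr rfl fun i _ => ?_
  rw [(b i).trace_eq_sum]
  refine Finset.sum_congr rfl fun j _ => ?_
  rw [Module.Basis.coord_apply, Pi.basis_repr, Pi.basis_apply, h, Module.Basis.coord_apply]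

variable (τ : (Π i, Matrix (d i) (d i) K) ≃ₐ[K] Π i, Matrix (d i) (d i) K)

theorem apply_single_one_of_twistedTrace [∀ i, Nonempty (d i)]
    (h : ∀ a, (∀ x, twistedTrace τ.toLinearMap (a * x) = 0) → a = 0) (i : ι) :
    τ (Pi.single i 1) = Pi.single i 1 := by
  set e : ι → (Π i, Matrix (d i) (d i) K) := fun i => Pi.single i 1 with he
  have hee : ∀ i j, i ≠ j → e i * e j = 0 := by
    intro i j hij
    ext1 l
    by_cases hl : l = i
    · subst hl; simp [e, hij]
    · simp [e, hl]
  have hei : ∀ i, e i * e i = e i := fun i => by simp [e, ← Pi.single_mul]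
  have hcomm : ∀ i x, e i * x = x * e i := by
    intro i x
    ext1 l
    by_cases hl : l = i
    · subst hl; simp [e]
    · simp [e, hl]
  have hτcomm : ∀ i x, τ (e i) * x = x * τ (e i) := by
    intro i x
    rw [← τ.apply_symm_apply x, ← map_mul, hcomm, map_mul]
  have hmain : ∀ i, τ (e i) i = 1 := by
    intro i
    obtain ⟨c, hc⟩ := Matrix.exists_smul_one_of_commute (a := τ (e i) i) fun m => by
      have := congrFun (hτcomm i (Pi.single i m)) i
      simpa using this
    have hcc : c * c = c := by
      have := congrFun (congrArg τ (hei i)) i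
      rw [map_mul, Pi.mul_apply, hc, smul_mul_smul_comm, one_mul] at this
      have h2 := congrFun (congrFun this (Classical.arbitrary _)) (Classical.arbitrary (d i))
      simpa using h2
    have hc1 : c * (c - 1) = 0 := by rw [mul_sub, hcc, mul_one, sub_self]
    rcases mul_eq_zero.1 hc1 with h0 | h1
    · exfalso
      have hz : τ (e i) * e i = 0 := by
        ext1 l
        by_cases hl : l = i
        · subst hl; simp [hc, h0]
        · simp [e, hl]
      have := eq_zero_of_isNilpotent_mul (a := e i) h fun x => ⟨2, by
        refine LinearMap.ext fun y => ?_
        rw [sq]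
        simp only [Module.End.mul_apply, LinearMap.comp_apply, LinearMap.mulRight_apply,
          AlgEquiv.toLinearMap_apply, map_mul, LinearMap.zero_apply]
        rw [hcomm i x, hτcomm, ← mul_assoc, ← mul_assoc, mul_assoc _ (τ (e i)) x, hτcomm,
          ← mul_assoc, mul_assoc _ _ (e i), hz, mul_zero]⟩
      have h2 := congrFun this i
      simp [e] at h2
    · rw [hc, sub_eq_zero.1 h1, one_smul]
  ext1 l
  by_cases hl : l = i
  · subst hl; rw [hmain]; simp
  · have := congrFun (congrArg τ (hee i l (Ne.symm hl))) l
    rw [map_mul, Pi.mul_apply, hmain, mul_one, map_zero] at this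
    rw [this]; simp [hl]

/-- An algebra automorphism of a product of matrix algebras with nondegenerate twisted trace form
preserves the factors. -/
theorem exists_eq_conj_of_twistedTrace [∀ i, Nonempty (d i)]
    (h : ∀ a, (∀ x, twistedTrace τ.toLinearMap (a * x) = 0) → a = 0) :
    ∃ u v : Π i, Matrix (d i) (d i) K, u * v = 1 ∧ v * u = 1 ∧ ∀ x, τ x = u * x * v := by
  have hτ := apply_single_one_of_twistedTrace τ h
  have hsingle : ∀ i m, τ (Pi.single i m) = Pi.single i (τ (Pi.single i m) i) := by
    intro i m
    have h1 : (Pi.single i m : Π i, Matrix (d i) (d i) K) = Pi.single i 1 * Pi.single i m := by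
      rw [← Pi.single_mul, one_mul]
    ext1 l
    by_cases hl : l = i
    · subst hl; simp
    · rw [h1, map_mul, hτ]; simp [hl]
  let f : ∀ i, Matrix (d i) (d i) K →ₐ[K] Matrix (d i) (d i) K := fun i =>
    AlgHom.ofLinearMap (LinearMap.proj i ∘ₗ τ.toLinearMap ∘ₗ LinearMap.single K (fun i => Matrix (d i) (d i) K) i)
      (by simp [hτ]) (fun a b => by simp [Pi.single_mul])
  have hf : ∀ i m, τ (Pi.single i m) = Pi.single i (f i m) := hsingle
  have hbij : ∀ i, Function.Bijective (f i) := by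
    intro i
    have hinj : Function.Injective (f i).toLinearMap := by
      intro a b hab
      have : τ (Pi.single i a) = τ (Pi.single i b) := by
        rw [hf, hf]; exact congrArg _ hab
      exact Pi.single_injective i (τ.injective this)
    exact ⟨hinj, LinearMap.injective_iff_surjective.1 hinj⟩
  choose u v huv hvu hconj using fun i => Matrix.exists_eq_conj (AlgEquiv.ofBijective (f i) (hbij i))
  refine ⟨u, v, funext huv, funext hvu, fun x => ?_⟩
  conv_lhs => rw [← Finset.univ_sum_single x, map_sum]
  simp only [hf]
  ext1 i
  simp only [Finset.sum_apply, Pi.mul_apply]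
  rw [Finset.sum_eq_single i (fun j _ hj => by simp [hj.symm]) (by simp), Pi.single_eq_same]
  exact hconj i (x i)

theorem twistedTrace_eq_sum_of_conj {u v : Π i, Matrix (d i) (d i) K}
    (hτ : ∀ x, τ x = u * x * v) (y : Π i, Matrix (d i) (d i) K) :
    twistedTrace τ.toLinearMap y = ∑ i, (u i).trace * (v i * y i).trace := by
  rw [twistedTrace_apply, LinearMap.trace_pi_eq_sum _ fun i =>
    LinearMap.mulRight K (v i * y i) ∘ₗ LinearMap.mulLeft K (u i)]
  · simp only [Matrix.trace_mulLeftRight]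
  · intro i m
    simp [hτ, mul_assoc]

end MatrixBlocks

section FiniteOrder

variable {K : Type*} [Field K] [CharZero K] [IsAlgClosed K]

theorem Matrix.exists_trace_eq_aeval {n : Type*} [Fintype n] [DecidableEq n] {N : ℕ} (hN : 0 < N)
    {ζ : K} (hζ : IsPrimitiveRoot ζ N) {u v : Matrix n n K} (huv : u * v = 1) {c : K}
    (hu : u ^ N = c • 1) : ∃ (r : K) (m : ℕ → ℕ), r ≠ 0 ∧
      u.trace = r * Polynomial.aeval ζ (multiplicityPoly N m) ∧
      v.trace = r⁻¹ * Polynomial.aeval ζ⁻¹ (multiplicityPoly N m) := by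
  rcases isEmpty_or_nonempty n with hn | hn
  · refine ⟨1, fun _ => 0, one_ne_zero, ?_, ?_⟩ <;> simp [multiplicityPoly, Matrix.trace]
  have hvu : v * u = 1 := mul_eq_one_comm.1 huv
  have hcomm : Commute u v := huv.trans hvu.symm
  have huvN : u ^ N * v ^ N = 1 := by rw [← hcomm.mul_pow, huv, one_pow]
  have hc : c ≠ 0 := by
    rintro rfl
    rw [hu, zero_smul, zero_mul] at huvN
    exact zero_ne_one huvN
  obtain ⟨r, hr⟩ := IsAlgClosed.exists_pow_nat_eq c hN
  have hr0 : r ≠ 0 := fun h => hc (by rw [← hr, h, zero_pow hN.ne'])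
  have hw : (r⁻¹ • u) ^ N = 1 := by
    rw [smul_pow, hu, smul_smul, inv_pow, hr, inv_mul_cancel₀ hc, one_smul]
  have hwv : r • v = (r⁻¹ • u) ^ (N - 1) := by
    have h1 : (r⁻¹ • u) * (r • v) = 1 := by
      rw [smul_mul_smul_comm, huv, inv_mul_cancel₀ hr0, one_smul]
    calc r • v = (r⁻¹ • u) ^ (N - 1) * (r⁻¹ • u) * (r • v) := by
          rw [← pow_succ, Nat.sub_add_cancel hN, hw, one_mul]
      _ = _ := by rw [mul_assoc, h1, mul_one]
  obtain ⟨m, hm⟩ := Matrix.exists_trace_pow_eq_sum hN hζ hw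
  refine ⟨r, m, hr0, ?_, ?_⟩
  · have h1 := hm (1 % N) (Nat.mod_lt _ hN)
    have hmodK : ∀ j, (ζ ^ j) ^ (1 % N) = ζ ^ j := fun j => by
      rw [← pow_eq_pow_mod 1 (by rw [← pow_mul, mul_comm, pow_mul, hζ.pow_eq_one, one_pow]),
        pow_one]
    rw [← pow_eq_pow_mod 1 hw, pow_one, Matrix.trace_smul, smul_eq_mul] at h1
    simp only [hmodK] at h1
    rw [← inv_mul_eq_iff_eq_mul₀ hr0, h1, aeval_multiplicityPoly]
  · have h1 := hm (N - 1) (Nat.sub_lt hN one_pos)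
    rw [← hwv, Matrix.trace_smul, smul_eq_mul] at h1
    rw [eq_inv_mul_iff_mul_eq₀ hr0, h1, aeval_multiplicityPoly]
    refine Finset.sum_congr rfl fun j _ => ?_
    rw [← pow_mul, mul_comm j, pow_mul, hζ.pow_pred_eq_inv hN]

/-- In characteristic zero, a nondegenerate trace form twisted by an algebra automorphism of finite
order does not vanish at the unit. -/
theorem twistedTrace_one_ne_zero_of_isAlgClosed {Y : Type*} [Ring Y] [Algebra K Y] [Nontrivial Y]
    [FiniteDimensional K Y] (σ : Y ≃ₐ[K] Y) {N : ℕ} (hN : 0 < N) (hσ : σ ^ N = 1)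
    (h : ∀ a, (∀ x, twistedTrace σ.toLinearMap (a * x) = 0) → a = 0) :
    twistedTrace σ.toLinearMap 1 ≠ 0 := by
  intro h1
  have := isSemisimpleRing_of_twistedTrace σ h
  obtain ⟨s, d, hd, ⟨e⟩⟩ := IsSemisimpleRing.exists_algEquiv_pi_matrix_of_isAlgClosed K Y
  set τ := e.autCongr σ with hτdef
  have hτN : τ ^ N = 1 := by rw [hτdef, ← map_pow, hσ, map_one]
  have hnd := eq_zero_of_twistedTrace_autCongr e h
  rw [← twistedTrace_autCongr e, map_one] at h1
  obtain ⟨u, v, huv, hvu, hτ⟩ := exists_eq_conj_of_twistedTrace τ hnd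
  have htr := twistedTrace_eq_sum_of_conj τ hτ
  have hpow : ∀ (l : ℕ) x, (τ ^ l) x = u ^ l * x * v ^ l := by
    intro l
    induction l with
    | zero => simp
    | succ l ih =>
      intro x
      rw [pow_succ', AlgEquiv.mul_apply, ih, hτ, pow_succ', pow_succ]
      simp only [mul_assoc]
  have hcomm : Commute u v := huv.trans hvu.symm
  have hc : ∀ i, ∃ c : K, u i ^ N = c • 1 := by
    intro i
    refine Matrix.exists_smul_one_of_commute fun m => ?_
    have h2 := hpow N (Pi.single i m)
    rw [hτN, AlgEquiv.one_apply] at h2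
    have h3 : u ^ N * Pi.single i m = Pi.single i m * u ^ N := by
      conv_rhs => rw [h2, mul_assoc, ← hcomm.symm.mul_pow, hvu, one_pow, mul_one]
    simpa using congrFun h3 i
  obtain ⟨ζ, hζ⟩ : ∃ ζ : K, IsPrimitiveRoot ζ N := by
    have : NeZero (N : K) := ⟨Nat.cast_ne_zero.2 hN.ne'⟩
    exact HasEnoughRootsOfUnity.exists_primitiveRoot K N
  choose c hc using hc
  choose r m hr hum hvm using fun i =>
    Matrix.exists_trace_eq_aeval hN hζ (congrFun huv i : u i * v i = 1) (hc i)
  have hsum : ∑ i, Polynomial.aeval ζ (multiplicityPoly N (m i)) *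
      Polynomial.aeval ζ⁻¹ (multiplicityPoly N (m i)) = 0 := by
    rw [← h1, htr]
    refine Finset.sum_congr rfl fun i _ => ?_
    rw [Pi.one_apply, mul_one, hum, hvm]
    field_simp [hr i]
  have hzero := hζ.aeval_multiplicityPoly_eq_zero hN m hsum
  have hone : (1 : Π i, Matrix (Fin (d i)) (Fin (d i)) K) = 0 := hnd 1 fun x => by
    rw [htr]
    refine Finset.sum_eq_zero fun i _ => ?_
    rw [hum, hzero, mul_zero, zero_mul]
  exact one_ne_zero (e.injective (by rw [map_one, map_zero, hone]))

theorem twistedTrace_one_ne_zero {k Y : Type*} [Field k] [CharZero k] [Ring Y] [Algebra k Y]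
    [Nontrivial Y] [FiniteDimensional k Y] (θ : Y →ₗ[k] Y) (hmul : ∀ a b, θ (a * b) = θ a * θ b)
    (hone : θ 1 = 1) {N : ℕ} (hN : 0 < N) (hθ : (θ : Module.End k Y) ^ N = 1)
    (h : ∀ a, (∀ x, twistedTrace θ (a * x) = 0) → a = 0) : twistedTrace θ 1 ≠ 0 := by
  have hbij : Function.Bijective θ := by
    obtain ⟨n, rfl⟩ := Nat.exists_eq_succ_of_ne_zero hN.ne'
    exact ⟨fun a b hab => by
        simpa [← Module.End.mul_apply, ← pow_succ, hθ] using congrArg ((θ : Module.End k Y) ^ n) hab,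
      fun a => ⟨((θ : Module.End k Y) ^ n) a, by
        rw [← Module.End.mul_apply, ← pow_succ', hθ, Module.End.one_apply]⟩⟩
  let σ : Y ≃ₐ[k] Y := AlgEquiv.ofBijective (AlgHom.ofLinearMap θ hone hmul) hbij
  let K := AlgebraicClosure k
  let σK : K ⊗[k] Y ≃ₐ[K] K ⊗[k] Y := Algebra.TensorProduct.congr AlgEquiv.refl σ
  have hσ : σK.toLinearMap = θ.baseChange K := by
    ext y
    rfl
  have hσpow : ∀ l : ℕ, (σK ^ l).toLinearMap = ((θ : Module.End k Y) ^ l).baseChange K := by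
    intro l
    induction l with
    | zero => ext y; simp
    | succ l ih =>
      ext y
      have := LinearMap.congr_fun ih ((1 : K) ⊗ₜ[k] θ y)
      have h2 := LinearMap.congr_fun hσ ((1 : K) ⊗ₜ[k] y)
      simp only [AlgEquiv.toLinearMap_apply, LinearMap.baseChange_tmul] at this h2
      simp [pow_succ, AlgEquiv.mul_apply, h2, this, Module.End.mul_apply]
  have hσN : σK ^ N = 1 := by
    ext y
    have := LinearMap.congr_fun (hσpow N) y
    rw [hθ] at this
    simpa using this
  have key := twistedTrace_one_ne_zero_of_isAlgClosed σK hN hσN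
    (by rw [hσ]; exact eq_zero_of_twistedTrace_baseChange K h)
  rw [hσ, Algebra.TensorProduct.one_def, twistedTrace_baseChange] at key
  exact fun h0 => key (by rw [h0, map_zero])

end FiniteOrder

section NonInvertible

variable {k U X D : Type*} [Field k] [Ring U] [HopfAlgebra k U]
  [Ring X] [Algebra k X] [Coalgebra k X] [Module U X] [IsScalarTower k U X]
  [Ring D] [Algebra k D] [Coalgebra k D] [Module U D] [IsScalarTower k U D]

theorem exists_inverse_of_isUnit {V : Type*} [AddCommGroup V] [Module k V] {S : V →ₗ[k] V}
    (h : IsUnit (S : Module.End k V)) :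
    ∃ T : V →ₗ[k] V, (∀ x, S (T x) = x) ∧ ∀ x, T (S x) = x := by
  obtain ⟨u, rfl⟩ := h
  exact ⟨(u⁻¹ : (Module.End k V)ˣ), fun x => LinearMap.congr_fun u.mul_inv x,
    fun x => LinearMap.congr_fun u.inv_mul x⟩

/-- The antipodes of dually paired braided Hopf algebras are adjoint, so that one of them is
bijective if and only if the other is. -/
theorem IsBraidedDualPairing.isUnit_antipode_iff {p : D →ₗ[k] X →ₗ[k] k}
    (hp : IsBraidedDualPairing U p) {R : (U ⊗[k] U)ˣ} {SX : X →ₗ[k] X}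
    (hX : IsBraidedHopfAlgebra R SX) {SD : D →ₗ[k] D} (hD : IsBraidedHopfAlgebra R SD)
    {ι : Type*} [Fintype ι] [DecidableEq ι] {φ : Module.Basis ι k X} {ε : Module.Basis ι k D}
    (hdual : ∀ i j, p (ε i) (φ j) = if i = j then 1 else 0) :
    IsUnit (SX : Module.End k X) ↔ IsUnit (SD : Module.End k D) := by
  have : FiniteDimensional k X := .of_basis φ
  have : FiniteDimensional k D := .of_basis ε
  have hmat : LinearMap.toMatrix φ φ SX = (LinearMap.toMatrix ε ε SD).transpose := by
    ext i j
    rw [LinearMap.toMatrix_apply, Matrix.transpose_apply, LinearMap.toMatrix_apply,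
      ← Module.Basis.coord_apply, ← Module.Basis.coord_apply, ← apply_basis_left hdual,
      ← apply_basis_right hdual, hp.antipode_left hX hD]
  rw [← MulEquiv.isUnit_map (LinearMap.toMatrixAlgEquiv φ),
    ← MulEquiv.isUnit_map (LinearMap.toMatrixAlgEquiv ε), ← Matrix.isUnit_transpose]
  change IsUnit (LinearMap.toMatrix φ φ SX).transpose ↔ IsUnit (LinearMap.toMatrix ε ε SD)
  rw [hmat, Matrix.transpose_transpose]

end NonInvertible

theorem IsBraidedHopfAlgebra.twistedTrace_eq_zero_of_one {k U : Type*} [Field k] [CharZero k]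
    [Ring U] [HopfAlgebra k U] {R : (U ⊗[k] U)ˣ} {Y : Type*} [Ring Y] [Algebra k Y] [Coalgebra k Y]
    [Module U Y] [IsScalarTower k U Y] [FiniteDimensional k Y] {S : Y →ₗ[k] Y}
    (hY : IsBraidedHopfAlgebra R S) (hR : IsUniversalRMatrix R) {I : Type*} [Fintype I] {A B : I → U}
    (hAB : (R : U ⊗[k] U) = ∑ i, A i ⊗ₜ[k] B i)
    {T : Y →ₗ[k] Y} (hST : ∀ x, S (T x) = x) (hTS : ∀ x, T (S x) = x)
    (h : twistedTrace (twist (IsUniversalRMatrix.drinfeldInv k A B) T) (1 : Y) = 0) :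
    twistedTrace (twist (IsUniversalRMatrix.drinfeldInv k A B) T) = 0 := by
  by_contra hne
  obtain ⟨Λ, hΛ, htΛ⟩ := hY.exists_integral hR hAB hST hTS hne
  obtain ⟨N, hN, hpow⟩ := hY.exists_twist_pow_eq_one hR hAB hST hTS hne
  have : Nontrivial Y := nontrivial_of_ne Λ 0 fun h0 => by
    rw [h0, map_zero] at htΛ
    exact zero_ne_one htΛ
  exact twistedTrace_one_ne_zero _ (hY.twist_mul hR hAB hST hTS)
    (hY.twist_one hR hAB hST hTS) hN hpow
    (fun a ha => hY.eq_zero_of_twistedTrace_mul_eq_zero hR hAB hST hTS hΛ htΛ ha) h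

theorem lemma7 {k U X D ι : Type*} [Field k] [Ring U] [HopfAlgebra k U]
    (R : (U ⊗[k] U)ˣ) (hR : IsUniversalRMatrix R)
    [Ring X] [Algebra k X] [Coalgebra k X] [Module U X] [IsScalarTower k U X]
    [Ring D] [Algebra k D] [Coalgebra k D] [Module U D] [IsScalarTower k U D]
    (SX : X →ₗ[k] X) (hX : IsBraidedHopfAlgebra R SX)
    (SD : D →ₗ[k] D) (hD : IsBraidedHopfAlgebra R SD)
    (p : D →ₗ[k] X →ₗ[k] k) (hp : IsBraidedDualPairing U p)
    [Fintype ι] [DecidableEq ι] (φ : Module.Basis ι k X) (ε : Module.Basis ι k D)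
    (hdual : ∀ i j, p (ε i) (φ j) = if i = j then 1 else 0)
    (c : X ⊗[k] D) (hc : c = ∑ i, φ i ⊗ₜ[k] ε i) :
    (∀ (σ : D) (ξ : X),
      braidedTraceDual R p c SX σ * braidedTrace R p c SD ξ =
        braidedTrace R p c SD 1 * braidedLoop R p c SD σ ξ) ∧
    (braidedTrace R p c SD 1 ≠ 0 →
      IsInvariantIntegral (braidedTrace R p c SD) ∧
        braidedTrace R p c SD ≠ 0 ∧ braidedTraceDual R p c SX ≠ 0) ∧
    (braidedTrace R p c SD 1 = 0 →
      braidedTrace R p c SD = 0 ∨ braidedTraceDual R p c SX = 0) ∧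
    (CharZero k → (braidedTrace R p c SD = 0 ↔ braidedTrace R p c SD 1 = 0)) := by
  subst hc
  obtain ⟨n, A, B, hAB⟩ := IsUniversalRMatrix.exists_eq_sum (R : U ⊗[k] U)
  by_cases hSX : IsUnit (SX : Module.End k X)
  · obtain ⟨TX, hSTX, hTSX⟩ := exists_inverse_of_isUnit hSX
    obtain ⟨TD, hSTD, hTSD⟩ := exists_inverse_of_isUnit
      ((hp.isUnit_antipode_iff hX hD hdual).1 hSX)
    have hmul := hp.braidedTraceDual_mul_braidedTrace hR hAB hX hD hdual hSTX hTSX hSTD hTSD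
    have hone := hp.braidedTrace_one_eq hR hAB hX hD hdual hSTX hTSX hSTD hTSD
    refine ⟨hmul, fun h => ⟨?_, ?_, ?_⟩, fun h => ?_, fun _ => ⟨fun h => by rw [h]; rfl, fun h => ?_⟩⟩
    · exact hp.isInvariantIntegral_braidedTrace hR hAB hX hD hdual hSTX hTSX hSTD hTSD
    · exact fun h0 => h (by rw [h0]; rfl)
    · exact fun h0 => h (by rw [hone, h0]; rfl)
    · by_contra! hne
      obtain ⟨ξ, hξ⟩ := DFunLike.ne_iff.1 hne.1
      obtain ⟨σ, hσ⟩ := DFunLike.ne_iff.1 hne.2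
      exact mul_ne_zero hσ hξ (by rw [hmul, h, zero_mul])
    · ext ξ
      have heq := hp.braidedTrace_apply hR hAB hX hD hdual hSTX hTSX hSTD hTSD
      have : FiniteDimensional k X := .of_basis φ
      rw [heq] at h ⊢
      rw [hX.twistedTrace_eq_zero_of_one hR hAB hSTX hTSX h]
  · have hSD := mt (hp.isUnit_antipode_iff hX hD hdual).2 hSX
    have h0 : braidedTrace R p (∑ i, φ i ⊗ₜ[k] ε i) SD = 0 := by
      ext ξ
      simp [braidedTrace, antipodeInvSq_of_not_isUnit hSD]
    have h0' : braidedTraceDual R p (∑ i, φ i ⊗ₜ[k] ε i) SX = 0 := by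
      ext σ
      simp [braidedTraceDual, antipodeInvSq_of_not_isUnit hSX]
    simp [h0, h0']
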